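/- Let $\Omega\subset\mathbb R^3$ be a bounded convex domain with $C^2$ boundary and outward unit normal $\mathbf n$, let $\tau>0$, $\theta>0$, $Q_\tau=(0,\tau)\times\Omega$, and let $W_p^{2,1}$ denote the space of functions $\phi\in L^p$ whose weak derivatives $\partial_t\phi$, $\partial_{x_i}\phi$, $\partial_{x_i}\partial_{x_j}\phi$ are in $L^p$. Let $G\in L^2(Q_\tau)$, let $0\le g\in W_\infty^{2,1}((0,\infty)\times\overline\Omega)\cap C^2(0,\infty;C^1(\overline\Omega))$, and let $0\le T_0\in H^1(\Omega)$. Let $a,b\in\mathbb R$ with $|a|+|b|>0$; in the case $a=0$ assume also the compatibility condition $T_0=b^{-1}g(0,\cdot)$ on $\partial\Omega$ (in the sense of traces, where $g(0,\cdot)=\lim_{t\to0+}g(t,\cdot)$). Let $T\in W_2^{2,1}(Q_\tau)$ be a nonnegative solution of $$\partial_tT-\Delta T+4\pi\theta T^4=\theta G\ \text{ in }Q_\tau,\qquad a\,\partial_{\mathbf n}T+bT=g\ \text{ on }(0,\tau)\times\partial\Omega,\qquad T(0,\cdot)=T_0\ \text{ in }\Omega .$$ Below, $C(\cdot)$ denotes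 positive constants that depend only on the quantities in brackets, $|\Omega|$ is the volume of $\Omega$ and $|\partial\Omega|$ the surface area of $\partial\Omega$. 1. (Robin) If $a\neq0$, $b\ne0$ and $ab>0$, then $$\|T\|^8_{L^8(Q_\tau)}\le\frac1{16\pi^2}\|G\|^2_{L^2(Q_\tau)}+C(a,b,\theta)\,\tau\,|\partial\Omega|\,\|g\|^5_{L^\infty((0,\tau)\times\overline\Omega)}+\frac1{10\pi\theta}\|T_0\|^5_{L^5(\Omega)} .$$ 2. (Neumann) If $a\ne0$ and $b=0$, then $$\|T\|^8_{L^8(Q_\tau)}\le\frac5{64\pi^2}\|G\|^2_{L^2(Q_\tau)}+\tau\Big(C(\theta)|\Omega|+C(a,\Omega,\theta)\|g\|^5_{L^\infty((0,\tau)\times\overline\Omega)}\Big)+\frac1{8\pi\theta}\|T_0\|^5_{L^5(\Omega)} .$$ 3. (Dirichlet) If $a=0$ and $b>0$, then $$\begin{aligned}\|T\|^8_{L^8(Q_\tau)}\le{}&\frac1{8\pi^2}\|G\|^2_{L^2(Q_\tau)}+C(b)\,\tau\,|\Omega|\,\|g\|^8_{L^\infty(Q_\tau)}+\frac1{5\pi\theta}\|T_0\|^5_{L^5(\Omega)}+C(\theta,b)\,|\Omega|\,\|g\|^5_{L^\infty(Q_\tau)}\\&+C(\theta,b)\,\tau\,|\partial\Omega|\,\|g\,\partial_{\mathbf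 n}g^4\|_{L^\infty((0,\tau)\times\partial\Omega)}+C(\theta,b)\,\tau\,|\Omega|\,\|(\partial_t-\Delta)g^4\|^{8/7}_{L^\infty(Q_\tau)} .\end{aligned}$$ -/

import Mathlib

open MeasureTheory Set Filter Topology
open scoped ENNReal ContDiff BoundedContinuousFunction

noncomputable section

/-- The Euclidean space `ℝ³`. -/
abbrev E3 : Type := EuclideanSpace ℝ (Fin 3)

/-- The `i`-th coordinate vector of `ℝ³`. -/
def unitVec (i : Fin 3) : E3 := EuclideanSpace.single i 1

/-! ### Domains with `C²` boundary -/

/-- `ρ` is a local `C²` defining function of `Ω` at the point `x`: near `x` the set `Ω` is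
`{ρ < 0}`, `ρ` is of class `C²` and `∇ρ(x) ≠ 0`. -/
def IsC2DefiningFunctionAt (Ω : Set E3) (x : E3) (ρ : E3 → ℝ) : Prop :=
  ContDiffAt ℝ 2 ρ x ∧ gradient ρ x ≠ 0 ∧ ∀ᶠ y in 𝓝 x, (y ∈ Ω ↔ ρ y < 0)

/-- Bounded convex domains of `ℝ³` with `C²` boundary. -/
structure IsConvexC2Domain (Ω : Set E3) : Prop where
  isOpen : IsOpen Ω
  nonempty : Ω.Nonempty
  convex : Convex ℝ Ω
  bounded : Bornology.IsBounded Ω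
  boundary : ∀ x ∈ frontier Ω, ∃ ρ, IsC2DefiningFunctionAt Ω x ρ

open Classical in
/-- The outward unit normal `n(x) = ∇ρ(x) / |∇ρ(x)|` at a boundary point `x`; it does not depend
on the local defining function `ρ`. (Outside the `C²` part of the boundary the value is `0`.) -/
def outwardNormal (Ω : Set E3) (x : E3) : E3 :=
  if h : ∃ ρ, IsC2DefiningFunctionAt Ω x ρ then
    ‖gradient h.choose x‖⁻¹ • gradient h.choose x
  else 0

/-- The surface measure of `∂Ω`: the two-dimensional Hausdorff measure, normalised to agree with
Lebesgue measure on planes, restricted to `∂Ω`. -/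
def surfaceMeasure (Ω : Set E3) : Measure E3 :=
  (Measure.euclideanHausdorffMeasure 2 : Measure E3).restrict (frontier Ω)

/-- The space-time cylinder `Q_τ = (0,τ) × Ω`. -/
def spaceTimeCylinder (τ : ℝ) (Ω : Set E3) : Set (ℝ × E3) := Ioo 0 τ ×ˢ Ω

/-! ### Weak derivatives and Sobolev spaces -/

/-- `u'` is the weak derivative of `u` on the open set `U` in the direction of the vector `v`. -/
def HasWeakDeriv {V : Type*} [NormedAddCommGroup V] [NormedSpace ℝ V] [MeasureSpace V]
    (U : Set V) (v : V) (u u' : V → ℝ) : Prop :=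
  LocallyIntegrableOn u U ∧ LocallyIntegrableOn u' U ∧
    ∀ φ : V → ℝ, ContDiff ℝ ∞ φ → HasCompactSupport φ → tsupport φ ⊆ U →
      ∫ x in U, u x * fderiv ℝ φ x v = -∫ x in U, u' x * φ x

/-- `u ∈ H¹(Ω)`, with weak gradient `(Du 0, Du 1, Du 2)`. -/
structure HasH1Gradient (Ω : Set E3) (u : E3 → ℝ) (Du : Fin 3 → E3 → ℝ) : Prop where
  memLp : MemLp u 2 (volume.restrict Ω)
  memLp_grad : ∀ i, MemLp (Du i) 2 (volume.restrict Ω)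
  weakDeriv : ∀ i, HasWeakDeriv Ω (unitVec i) u (Du i)

/-- `u ∈ W_p^{2,1}(U)` for an open set `U` of space-time points `(t,x)`, with weak derivatives
`ut = ∂ₜu`, `Du i = ∂ᵢu`, `D2u i j = ∂ⱼ∂ᵢu`, all of them in `L^p(U)`. -/
structure HasW21Derivs (p : ℝ≥0∞) (U : Set (ℝ × E3)) (u ut : ℝ × E3 → ℝ)
    (Du : Fin 3 → ℝ × E3 → ℝ) (D2u : Fin 3 → Fin 3 → ℝ × E3 → ℝ) : Prop where
  memLp : MemLp u p (volume.restrict U)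
  memLp_time : MemLp ut p (volume.restrict U)
  memLp_grad : ∀ i, MemLp (Du i) p (volume.restrict U)
  memLp_hess : ∀ i j, MemLp (D2u i j) p (volume.restrict U)
  weakDeriv_time : HasWeakDeriv U ((1, 0) : ℝ × E3) u ut
  weakDeriv_grad : ∀ i, HasWeakDeriv U ((0, unitVec i) : ℝ × E3) u (Du i)
  weakDeriv_hess : ∀ i j, HasWeakDeriv U ((0, unitVec j) : ℝ × E3) (Du i) (D2u i j)

/-- `w` is the trace on `∂Ω` of `u ∈ H¹(Ω)`: for some functions `φₖ` of class `C¹`, `φₖ → u` in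
`H¹(Ω)` and `φₖ → w` in `L²(∂Ω)`. -/
def HasTrace (Ω : Set E3) (u w : E3 → ℝ) : Prop :=
  MemLp w 2 (surfaceMeasure Ω) ∧
  ∃ (Du : Fin 3 → E3 → ℝ) (φ : ℕ → E3 → ℝ), HasH1Gradient Ω u Du ∧
    (∀ k, ContDiff ℝ 1 (φ k)) ∧
    Tendsto (fun k => eLpNorm (fun x => φ k x - u x) 2 (volume.restrict Ω)) atTop (𝓝 0) ∧
    (∀ i, Tendsto (fun k => eLpNorm (fun x => fderiv ℝ (φ k) x (unitVec i) - Du i x) 2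
      (volume.restrict Ω)) atTop (𝓝 0)) ∧
    Tendsto (fun k => eLpNorm (fun x => φ k x - w x) 2 (surfaceMeasure Ω)) atTop (𝓝 0)

/-! ### The data -/

/-- `g ∈ C²(0,∞; C¹(Ω̄))`. A function of class `C¹` on `Ω̄` is identified with the pair of bounded
continuous functions `(u, ∇u)` on `Ω̄`, whose sup norm is the norm of `C¹(Ω̄)`. -/
def IsC2TimeC1Space (Ω : Set E3) (g : ℝ × E3 → ℝ) : Prop :=
  ∃ γ : ℝ → (closure Ω →ᵇ ℝ × (E3 →L[ℝ] ℝ)), ContDiffOn ℝ 2 γ (Ioi 0) ∧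
    ∀ t, 0 < t → ∀ x : closure Ω, (γ t x).1 = g (t, x) ∧
      HasFDerivWithinAt (fun y => g (t, y)) (γ t x).2 (closure Ω) x

/-- The assumptions on the boundary datum:
`0 ≤ g ∈ W_∞^{2,1}((0,∞) × Ω̄) ∩ C²(0,∞; C¹(Ω̄))`. -/
structure IsBoundaryDatum (Ω : Set E3) (g : ℝ × E3 → ℝ) : Prop where
  nonneg : ∀ t, 0 < t → ∀ x ∈ closure Ω, 0 ≤ g (t, x)
  sobolev : ∃ gt Dg D2g, HasW21Derivs ⊤ (Ioi (0 : ℝ) ×ˢ Ω) g gt Dg D2g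
  smooth : IsC2TimeC1Space Ω g

/-- The assumptions on the initial datum: `0 ≤ T₀ ∈ H¹(Ω)`. -/
structure IsInitialDatum (Ω : Set E3) (T₀ : E3 → ℝ) : Prop where
  nonneg : ∀ᵐ x ∂(volume.restrict Ω), 0 ≤ T₀ x
  sobolev : ∃ DT₀, HasH1Gradient Ω T₀ DT₀

/-- The compatibility condition `T₀ = b⁻¹ g(0,·)` on `∂Ω` of the Dirichlet case. The values
`g(0,·)` are the limits of `g(t,·)` as `t → 0+`. -/
def IsDirichletCompatible (b : ℝ) (Ω : Set E3) (g : ℝ × E3 → ℝ) (T₀ : E3 → ℝ) : Prop :=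
  (∀ x ∈ frontier Ω, Tendsto (fun t => g (t, x)) (𝓝[>] 0) (𝓝 (g (0, x)))) ∧
  HasTrace Ω T₀ (fun x => b⁻¹ * g (0, x))

/-! ### The conductive equation -/

/-- `T ∈ W_2^{2,1}(Q_τ)` is a nonnegative solution of
`∂ₜT - ΔT + 4πθT⁴ = θG` in `Q_τ`, `a ∂ₙT + bT = g` on `(0,τ) × ∂Ω`, `T(0,·) = T₀` in `Ω`.

The boundary condition holds for almost every `t`, in the sense of the traces `w` of `T(t,·)` and
`v i` of `∂ᵢT(t,·)`. The initial condition means that `T(t,·) → T₀` in `L²(Ω)` as `t → 0+`, where a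
null set of times is disregarded because `T` is only determined almost everywhere. -/
def IsNonnegSolution (a b θ τ : ℝ) (Ω : Set E3) (G g : ℝ × E3 → ℝ) (T₀ : E3 → ℝ)
    (T : ℝ × E3 → ℝ) : Prop :=
  ∃ (Tt : ℝ × E3 → ℝ) (DT : Fin 3 → ℝ × E3 → ℝ) (D2T : Fin 3 → Fin 3 → ℝ × E3 → ℝ),
    HasW21Derivs 2 (spaceTimeCylinder τ Ω) T Tt DT D2T ∧
    (∀ᵐ q ∂(volume.restrict (spaceTimeCylinder τ Ω)), 0 ≤ T q) ∧
    (∀ᵐ q ∂(volume.restrict (spaceTimeCylinder τ Ω)),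
      Tt q - ∑ i, D2T i i q + 4 * Real.pi * θ * T q ^ 4 = θ * G q) ∧
    (∀ᵐ t ∂(volume.restrict (Ioo 0 τ)), ∃ (w : E3 → ℝ) (v : Fin 3 → E3 → ℝ),
      HasTrace Ω (fun x => T (t, x)) w ∧
      (∀ i, HasTrace Ω (fun x => DT i (t, x)) (v i)) ∧
      ∀ᵐ x ∂(surfaceMeasure Ω),
        a * ∑ i, v i x * outwardNormal Ω x i + b * w x = g (t, x)) ∧
    Tendsto (fun t => eLpNorm (fun x => T (t, x) - T₀ x) 2 (volume.restrict Ω))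
      (𝓝[>] 0 ⊓ ae volume) (𝓝 0)

/-! ### The norms in the estimates -/

/-- The volume `|Ω|`. -/
def domainVolume (Ω : Set E3) : ℝ≥0∞ := volume Ω

/-- The surface area `|∂Ω|`. -/
def boundaryArea (Ω : Set E3) : ℝ≥0∞ := surfaceMeasure Ω univ

/-- The norm of `L^p(Ω)`. -/
def normDomain (p : ℝ≥0∞) (Ω : Set E3) (u : E3 → ℝ) : ℝ≥0∞ :=
  eLpNorm u p (volume.restrict Ω)

/-- The norm of `L^p(Q_τ)`. -/
def normCylinder (p : ℝ≥0∞) (τ : ℝ) (Ω : Set E3) (u : ℝ × E3 → ℝ) : ℝ≥0∞ :=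
  eLpNorm u p (volume.restrict (spaceTimeCylinder τ Ω))

/-- The supremum norm of `g` over `(0,τ) × Ω̄`. -/
def supNormClosure (τ : ℝ) (Ω : Set E3) (g : ℝ × E3 → ℝ) : ℝ≥0∞ :=
  ⨆ t ∈ Ioo 0 τ, ⨆ x ∈ closure Ω, ‖g (t, x)‖ₑ

/-- The supremum over `(0,τ) × ∂Ω` of `|g ∂ₙ(g⁴)|`, where `∂ₙ` is computed from the derivative of
`g(t,·)⁴` relative to `Ω̄`. -/
def supNormalTerm (τ : ℝ) (Ω : Set E3) (g : ℝ × E3 → ℝ) : ℝ≥0∞ :=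
  ⨆ t ∈ Ioo 0 τ, ⨆ x ∈ frontier Ω,
    ‖g (t, x) * fderivWithin ℝ (fun y => g (t, y) ^ 4) (closure Ω) x (outwardNormal Ω x)‖ₑ

/-- The norm `‖(∂ₜ - Δ)u‖` in `L^∞(Q_τ)` of `u ∈ W_∞^{2,1}(Q_τ)`. The weak derivatives are unique up
to null sets, so that the infimum runs over equal numbers; it is `∞` for other functions `u`. -/
def heatNorm (τ : ℝ) (Ω : Set E3) (u : ℝ × E3 → ℝ) : ℝ≥0∞ :=
  ⨅ (ut : ℝ × E3 → ℝ) (Du : Fin 3 → ℝ × E3 → ℝ) (D2u : Fin 3 → Fin 3 → ℝ × E3 → ℝ)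
    (_ : HasW21Derivs ⊤ (spaceTimeCylinder τ Ω) u ut Du D2u),
    normCylinder ⊤ τ Ω (fun q => ut q - ∑ i, D2u i i q)

end

open scoped RealInnerProductSpace
open scoped NNReal

/-! ### The outward unit normal of a convex domain -/


/-! The estimates come from testing the equation with `h(T)`, where `h(s)` approximates `(s⁴ - M)₊`
for a level `M ≥ 0`. Since `h² ≤ T⁴ h`, Young's inequality gives `G h ≤ 2π T⁴ h + G² / (8π)`, and
half of the term `4πθ T⁴ h` absorbs the source. The primitive `H` of `h` satisfies `0 ≤ H(s) ≤ s⁵/5`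
for `s ≥ 0`, so the time derivative costs at most `(1/5) ∫ T₀⁵`. There remains an upper bound for `∫
ΔT h(T)`, which by Green's formula is the boundary flux `∫ ∂ₙT h(T)` minus `∫ h'(T) |∇T|²`.

Robin (`robin_flux_le`, `M = 0`): the flux `(g - bT)/a` is positive only where `T ≤ |g|/|b|`, so the
boundary integrand is at most `|g|⁵ / (|a| |b|⁴)`.

Neumann (`IsConvexC2Domain.exists_neumann_bound`, `M = 0`): a pointwise Young inequality leaves `δ ∫
T h(T)` on `∂Ω`. A convex domain containing a ball of radius `r` around `x₀` satisfies `n · (x - x₀)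
≥ r`, so the divergence theorem for `T h(T) (x - x₀)` moves this integral inside. For small `δ` it
is absorbed by `∫ h'(T) |∇T|²` and `∫ T⁵`, and `T⁵` is in turn absorbed by `T⁸`.

Dirichlet (`IsNonnegSolution.dirichlet_estimate`): with `M = (‖g‖/b)⁴` the test function vanishes on
`∂Ω`, so there is no flux, and `T⁸ ≤ 2 T⁴ (T⁴ - M)₊ + M²`. This already bounds `‖T‖⁸` by the terms
in `G`, `T₀` and `‖g‖⁸`; the other terms of the claim are nonnegative.

Much of the work makes this legitimate for weak derivatives and Hausdorff surface measure.
Gauss–Green for convex domains rests on the area formula `|nᵢ| dS = dz` for projections of `∂Ω`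
(`IsConvexC2Domain.map_boundarySection`) and on Fubini. It passes to `H¹` functions with traces by
approximation, which requires bounded `h'`; this is why `testFun` is a bounded `C¹` regularisation,
removed at the end by dominated convergence. Weak derivatives are restricted to time slices, and to
lines in the time direction, through countable families of test functions. -/

theorem IsC2DefiningFunctionAt.exists_segment_mem {Ω : Set E3} {x : E3} {ρ : E3 → ℝ}
    (h : IsC2DefiningFunctionAt Ω x ρ) (h0 : ρ x = 0) {v : E3} (hv : ⟪gradient ρ x, v⟫ < 0) :
    ∀ᶠ t in 𝓝[>] (0 : ℝ), x + t • v ∈ Ω := by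
  obtain ⟨hC, -, hΩ⟩ := h
  have hd : DifferentiableAt ℝ ρ x := hC.differentiableAt (by norm_num)
  have hl : HasDerivAt (fun t : ℝ => x + t • v) v 0 := by
    simpa using ((hasDerivAt_id (0 : ℝ)).smul_const v).const_add x
  have hderiv : HasDerivAt (fun t : ℝ => ρ (x + t • v)) ⟪gradient ρ x, v⟫ 0 := by
    have hg : HasFDerivAt ρ (InnerProductSpace.toDual ℝ E3 (gradient ρ x)) (x + (0 : ℝ) • v) := by
      simpa using hd.hasGradientAt.hasFDerivAt
    have := hg.comp_hasDerivAt (0 : ℝ) hl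
    rwa [InnerProductSpace.toDual_apply_apply] at this
  have hcont : Tendsto (fun t : ℝ => x + t • v) (𝓝[>] 0) (𝓝 x) := by
    have := hl.continuousAt.tendsto
    simp only [zero_smul, add_zero] at this
    exact this.mono_left nhdsWithin_le_nhds
  have hs := (hasDerivAt_iff_tendsto_slope.1 hderiv).mono_left
    (nhdsWithin_mono 0 (fun t (ht : t ∈ Ioi (0 : ℝ)) => ne_of_gt ht))
  filter_upwards [hcont.eventually hΩ, hs.eventually (gt_mem_nhds hv), self_mem_nhdsWithin]
    with t h1 h2 h3
  rw [h1]
  have h3' : (0 : ℝ) < t := h3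
  simp only [slope_def_field, zero_smul, add_zero, h0, sub_zero] at h2
  by_contra hc
  exact absurd h2 (not_lt.2 (div_nonneg (not_lt.1 hc) h3'.le))

theorem IsC2DefiningFunctionAt.apply_eq_zero {Ω : Set E3} (hΩ : IsOpen Ω) {x : E3} {ρ : E3 → ℝ}
    (h : IsC2DefiningFunctionAt Ω x ρ) (hx : x ∈ frontier Ω) : ρ x = 0 := by
  obtain ⟨hC, -, hev⟩ := h
  have hxn : x ∉ Ω := by
    rw [hΩ.frontier_eq] at hx; exact hx.2
  refine le_antisymm ?_ (not_lt.1 fun hlt => hxn (hev.self_of_nhds.2 hlt))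
  have hcl : x ∈ closure Ω := frontier_subset_closure hx
  rw [mem_closure_iff_nhdsWithin_neBot] at hcl
  refine le_of_tendsto (hC.continuousAt.tendsto.mono_left (nhdsWithin_le_nhds (s := Ω))) ?_
  filter_upwards [nhdsWithin_le_nhds hev, self_mem_nhdsWithin] with y h1 h2 using (h1.1 h2).le

namespace IsConvexC2Domain

theorem exists_segment_mem {Ω : Set E3} (hΩ : IsConvexC2Domain Ω)
    {x : E3} (hx : x ∈ frontier Ω) {v : E3}
    (hv : ⟪outwardNormal Ω x, v⟫ < 0) : ∀ᶠ t in 𝓝[>] (0 : ℝ), x + t • v ∈ Ω := by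
  have h := hΩ.boundary x hx
  rw [outwardNormal, dif_pos h, real_inner_smul_left] at hv
  have hn : 0 < ‖gradient h.choose x‖⁻¹ := inv_pos.2 (norm_pos_iff.2 h.choose_spec.2.1)
  exact h.choose_spec.exists_segment_mem (h.choose_spec.apply_eq_zero hΩ.isOpen hx)
    (by by_contra hc; exact absurd hv (not_lt.2 (mul_nonneg hn.le (not_lt.1 hc))))

theorem norm_outwardNormal {Ω : Set E3} (hΩ : IsConvexC2Domain Ω)
    {x : E3} (hx : x ∈ frontier Ω) : ‖outwardNormal Ω x‖ = 1 := by
  have h := hΩ.boundary x hx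
  rw [outwardNormal, dif_pos h, norm_smul, norm_inv, norm_norm,
    inv_mul_cancel₀ (norm_ne_zero_iff.2 h.choose_spec.2.1)]

/-- If a point `y` of `Ω` lay strictly beyond the tangent plane at `x`, then moving from `x` away
from `y` would enter `Ω`, and convexity would put `x` itself in the open set `Ω`. -/
theorem inner_outwardNormal_nonpos {Ω : Set E3} (hΩ : IsConvexC2Domain Ω)
    {x y : E3} (hx : x ∈ frontier Ω) (hy : y ∈ closure Ω) :
    ⟪outwardNormal Ω x, y - x⟫ ≤ 0 := by
  have key : ∀ y ∈ Ω, ⟪outwardNormal Ω x, y - x⟫ ≤ 0 := by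
    intro y hy
    by_contra! hc
    have hxn : x ∉ Ω := by
      rw [hΩ.isOpen.frontier_eq] at hx; exact hx.2
    have h1 := hΩ.exists_segment_mem hx (v := -(y - x)) (by rw [inner_neg_right]; linarith)
    obtain ⟨t, ht, ht0⟩ := (h1.and self_mem_nhdsWithin).exists
    have ht0' : (0 : ℝ) < t := ht0
    apply hxn
    have h1t : (0 : ℝ) < 1 + t := by linarith
    have := hΩ.convex ht hy (a := 1 / (1 + t)) (b := t / (1 + t)) (by positivity) (by positivity)
      (by field_simp)
    convert this using 1
    have e : (1 / (1 + t)) * t = t / (1 + t) := by ring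
    have e2 : (1 / (1 + t)) + t / (1 + t) = 1 := by field_simp
    rw [smul_add, smul_smul, e, smul_neg, smul_sub]
    calc x = ((1 / (1 + t)) + t / (1 + t)) • x := by rw [e2, one_smul]
      _ = _ := by rw [add_smul]; abel
  have hcl : IsClosed {y : E3 | ⟪outwardNormal Ω x, y - x⟫ ≤ 0} :=
    isClosed_le (by fun_prop) continuous_const
  exact hcl.closure_subset_iff.2 key hy

/-- Uniqueness of the supporting plane. If `n` differs from the normal `ν`, the direction `n - ν`
has negative product with `ν`, so it enters `Ω`; but its product with `n` is positive, against the
support property of `n`. -/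
theorem eq_outwardNormal {Ω : Set E3} (hΩ : IsConvexC2Domain Ω)
    {x n : E3} (hx : x ∈ frontier Ω) (hn : ‖n‖ = 1)
    (h : ∀ y ∈ Ω, ⟪n, y - x⟫ ≤ 0) : n = outwardNormal Ω x := by
  by_contra hne
  have h1 := hΩ.norm_outwardNormal hx
  have hlt : ⟪outwardNormal Ω x, n⟫ < 1 := by
    rw [inner_lt_one_iff_real_of_norm_eq_one h1 hn]; exact fun e => hne e.symm
  have h2 := hΩ.exists_segment_mem hx (v := n - outwardNormal Ω x) (by
    rw [inner_sub_right, real_inner_self_eq_norm_sq, h1]; linarith)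
  obtain ⟨t, ht, ht0⟩ := (h2.and self_mem_nhdsWithin).exists
  have ht0' : (0 : ℝ) < t := ht0
  have h3 := h _ ht
  rw [add_sub_cancel_left, real_inner_smul_right, inner_sub_right, real_inner_self_eq_norm_sq, hn,
    real_inner_comm] at h3
  nlinarith

/-- Normals lie in the compact unit sphere, and a cluster point of normals at points tending to `x`
still supports `Ω` at `x`. Uniqueness of the supporting normal identifies it, so the choice of
defining functions plays no role. -/
theorem continuousOn_outwardNormal {Ω : Set E3} (hΩ : IsConvexC2Domain Ω) :
    ContinuousOn (outwardNormal Ω) (frontier Ω) := by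
  rw [continuousOn_iff_continuous_domRestrict]
  have hmem : ∀ x : frontier Ω, outwardNormal Ω x ∈ Metric.sphere (0 : E3) 1 := fun x => by
    simpa using hΩ.norm_outwardNormal x.2
  have hcomp : IsCompact (Metric.sphere (0 : E3) 1) := isCompact_sphere _ _
  rw [continuous_iff_continuousAt]
  intro x
  refine hcomp.tendsto_nhds_of_unique_mapClusterPt (Eventually.of_forall hmem) ?_
  intro n hn hcl
  refine hΩ.eq_outwardNormal x.2 (by simpa using hn) fun y hy => ?_
  obtain ⟨F, hF, hFn⟩ := mapClusterPt_iff_ultrafilter.1 hcl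
  have hFx : Tendsto (fun z : frontier Ω => y - (z : E3)) F (𝓝 (y - x)) :=
    (tendsto_const_nhds.sub continuous_subtype_val.continuousAt.tendsto).mono_left hF
  exact le_of_tendsto (hFn.inner hFx) (Eventually.of_forall fun z =>
    hΩ.inner_outwardNormal_nonpos z.2 (subset_closure hy))

/-- Quantitative flatness of `∂Ω`: the support inequality at `y` bounds the product of `z - y` with
the normal at `y`, and near `x` replacing that normal by the one at `x` costs at most `ε ‖z - y‖`.
Exchanging `y` and `z` gives the other sign. -/
theorem exists_flat {Ω : Set E3} (hΩ : IsConvexC2Domain Ω)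
    {x : E3} (hx : x ∈ frontier Ω) {ε : ℝ} (hε : 0 < ε) :
    ∃ U : Set E3, IsOpen U ∧ x ∈ U ∧ ∀ y ∈ frontier Ω ∩ U, ∀ z ∈ frontier Ω ∩ U,
      |⟪outwardNormal Ω x, y - z⟫| ≤ ε * ‖y - z‖ := by
  have hc := Metric.continuousWithinAt_iff.1 (hΩ.continuousOn_outwardNormal x hx) ε hε
  obtain ⟨δ, hδ, h⟩ := hc
  refine ⟨Metric.ball x δ, Metric.isOpen_ball, Metric.mem_ball_self hδ, ?_⟩
  have key : ∀ y ∈ frontier Ω ∩ Metric.ball x δ, ∀ z ∈ frontier Ω ∩ Metric.ball x δ,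
      ⟪outwardNormal Ω x, z - y⟫ ≤ ε * ‖z - y‖ := by
    intro y hy z hz
    have h1 := hΩ.inner_outwardNormal_nonpos hy.1 (frontier_subset_closure hz.1)
    have h2 : ‖outwardNormal Ω y - outwardNormal Ω x‖ < ε := by
      rw [← dist_eq_norm]; exact h hy.1 hy.2
    have h3 := real_inner_le_norm (outwardNormal Ω x - outwardNormal Ω y) (z - y)
    rw [inner_sub_left, norm_sub_rev] at h3
    have := mul_le_mul_of_nonneg_right h2.le (norm_nonneg (z - y))
    linarith
  intro y hy z hz
  rw [abs_le]
  have h1 := key y hy z hz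
  have h2 := key z hz y hy
  rw [← neg_sub z y, inner_neg_right, norm_neg] at *
  constructor <;> linarith

/-- The point of the ball farthest in the direction of the normal still lies on the inner side of
the tangent plane. This uniform star-shapedness is what the Neumann estimate uses. -/
theorem le_inner_outwardNormal {Ω : Set E3} (hΩ : IsConvexC2Domain Ω)
    {x x₀ : E3} {r : ℝ} (hr : 0 ≤ r) (hx : x ∈ frontier Ω)
    (hball : Metric.closedBall x₀ r ⊆ Ω) : r ≤ ⟪outwardNormal Ω x, x - x₀⟫ := by
  have h1 := hΩ.norm_outwardNormal hx
  have h2 := hΩ.inner_outwardNormal_nonpos hx (subset_closure (hball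
    (show x₀ + r • outwardNormal Ω x ∈ Metric.closedBall x₀ r by
      simp [norm_smul, h1, abs_of_nonneg hr])))
  have e : x₀ + r • outwardNormal Ω x - x = r • outwardNormal Ω x - (x - x₀) := by abel
  rw [e, inner_sub_right, real_inner_smul_right, real_inner_self_eq_norm_sq, h1] at h2
  linarith

end IsConvexC2Domain

/-! ### Area of hypersurfaces and of their projections -/


/-- The Euclidean plane. -/
abbrev E2 : Type := EuclideanSpace ℝ (Fin 2)

/-- The projection of `ℝ³` to `ℝ²` that forgets the `i`-th coordinate. -/
noncomputable def dropCoord (i : Fin 3) : E3 →L[ℝ] E2 :=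
  LinearMap.toContinuousLinearMap
    { toFun := fun y => WithLp.toLp 2 fun j => y (i.succAbove j)
      map_add' := fun _ _ => rfl
      map_smul' := fun _ _ => rfl }

@[simp] theorem dropCoord_apply (i : Fin 3) (y : E3) (j : Fin 2) :
    dropCoord i y j = y (i.succAbove j) := rfl

theorem inner_eq_dropCoord (i : Fin 3) (x y : E3) :
    ⟪x, y⟫ = ⟪dropCoord i x, dropCoord i y⟫ + x i * y i := by
  simp only [PiLp.inner_apply, dropCoord_apply]
  rw [Fin.sum_univ_succAbove _ i]
  simp [mul_comm, add_comm]

/-- The projection along the unit vector `n`, isometric on the plane orthogonal to `n`; it is the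
composition of the reflection that exchanges `n` and `∓eᵢ` with the projection along `eᵢ`. -/
noncomputable def tiltedProj (i : Fin 3) (n : E3) : E3 →ₗ[ℝ] E2 :=
  (dropCoord i : E3 →ₗ[ℝ] E2) - LinearMap.smulRight
    ((1 + |n i|)⁻¹ • (innerₛₗ ℝ (dropCoord i n) ∘ₗ (dropCoord i : E3 →ₗ[ℝ] E2)) +
      (SignType.sign (n i) : ℝ) • (EuclideanSpace.proj i : E3 →L[ℝ] ℝ).toLinearMap) (dropCoord i n)

theorem tiltedProj_apply (i : Fin 3) (n y : E3) : tiltedProj i n y = dropCoord i y -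
    ((1 + |n i|)⁻¹ * ⟪dropCoord i n, dropCoord i y⟫ + (SignType.sign (n i) : ℝ) * y i) •
      dropCoord i n := by
  simp [tiltedProj]

theorem norm_tiltedProj_sq {i : Fin 3} {n : E3} (hn : ‖n‖ = 1) (hi : n i ≠ 0) (y : E3) :
    ‖tiltedProj i n y‖ ^ 2 = ‖y‖ ^ 2 - ⟪n, y⟫ ^ 2 := by
  have h1 : ⟪n, n⟫ = 1 := by rw [real_inner_self_eq_norm_sq, hn, one_pow]
  rw [inner_eq_dropCoord i] at h1
  rw [← real_inner_self_eq_norm_sq, ← real_inner_self_eq_norm_sq, inner_eq_dropCoord i y,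
    inner_eq_dropCoord i n, tiltedProj_apply, inner_sub_left, inner_sub_right, inner_sub_right]
  simp only [real_inner_smul_left, real_inner_smul_right]
  rw [real_inner_comm (dropCoord i n) (dropCoord i y)]
  have hs : (SignType.sign (n i) : ℝ) ^ 2 = 1 := by
    rcases lt_or_gt_of_ne hi with h | h <;> simp [h]
  have hs2 : (SignType.sign (n i) : ℝ) * |n i| = n i := sign_mul_abs (n i)
  have hne : 1 + |n i| ≠ 0 := by positivity
  have hab : |n i| ^ 2 = n i * n i := by rw [sq_abs, sq]
  generalize ⟪dropCoord i n, dropCoord i n⟫ = pp at *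
  generalize ⟪dropCoord i n, dropCoord i y⟫ = pz at *
  generalize ⟪dropCoord i y, dropCoord i y⟫ = zz at *
  generalize (SignType.sign (n i) : ℝ) = s at *
  generalize y i = t at *
  generalize |n i| = a at *
  rw [← hs2] at h1 ⊢
  obtain rfl : pp = 1 - a ^ 2 := by linear_combination h1 - a ^ 2 * hs
  have hκ : pz = (1 + a) * ((1 + a)⁻¹ * pz + s * t - s * t) := by field_simp; ring
  generalize (1 + a)⁻¹ * pz + s * t = c at *
  subst hκ
  linear_combination t ^ 2 * hs

/-- The linear map of the plane that relates `tiltedProj i n` and `dropCoord i`. -/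
noncomputable def tiltMap (i : Fin 3) (n : E3) : E2 →ₗ[ℝ] E2 :=
  LinearMap.transvection (-((1 + |n i|)⁻¹ • innerₛₗ ℝ (dropCoord i n))) (dropCoord i n)

/-- The determinant `1 - (1 - nᵢ²) / (1 + |nᵢ|)` of the transvection is `|nᵢ|`, the factor by which
areas in the plane orthogonal to `n` shrink under projection along `eᵢ`. -/
theorem det_tiltMap {i : Fin 3} {n : E3} (hn : ‖n‖ = 1) : (tiltMap i n).det = |n i| := by
  have h1 : ⟪n, n⟫ = 1 := by rw [real_inner_self_eq_norm_sq, hn, one_pow]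
  rw [inner_eq_dropCoord i] at h1
  rw [tiltMap, LinearMap.transvection.det]
  have hne : 1 + |n i| ≠ 0 := by positivity
  have hab : |n i| ^ 2 = n i * n i := by rw [sq_abs, sq]
  have : ((-((1 + |n i|)⁻¹ • innerₛₗ ℝ (dropCoord i n))) (dropCoord i n) : ℝ) =
    -((1 + |n i|)⁻¹ * ⟪dropCoord i n, dropCoord i n⟫) := by simp
  rw [this, show ⟪dropCoord i n, dropCoord i n⟫ = 1 - |n i| ^ 2 by linarith]
  field_simp
  ring

/-- Projecting along `n` and then applying `tiltMap i n` reproduces `dropCoord i` up to the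
component along `n`, which is small for differences of points of a flat set. -/
theorem tiltMap_tiltedProj {i : Fin 3} {n : E3} (hn : ‖n‖ = 1) (hi : n i ≠ 0) (y : E3) :
    dropCoord i y - tiltMap i n (tiltedProj i n y) = ⟪n, y⟫ • dropCoord i n := by
  have h1 : ⟪n, n⟫ = 1 := by rw [real_inner_self_eq_norm_sq, hn, one_pow]
  rw [inner_eq_dropCoord i] at h1
  have hne : 1 + |n i| ≠ 0 := by positivity
  have hab : |n i| ^ 2 = n i * n i := by rw [sq_abs, sq]
  have hs2 : (SignType.sign (n i) : ℝ) * |n i| = n i := sign_mul_abs (n i)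
  rw [inner_eq_dropCoord i n y, tiltMap, LinearMap.transvection.apply, tiltedProj_apply]
  simp only [LinearMap.neg_apply, LinearMap.smul_apply, innerₛₗ_apply_apply, inner_sub_right,
    real_inner_smul_right, smul_eq_mul]
  rw [sub_add, sub_sub_cancel, ← sub_smul]
  congr 1
  rw [show ⟪dropCoord i n, dropCoord i n⟫ = 1 - |n i| ^ 2 by linarith]
  have hκ : (1 + |n i|)⁻¹ * (1 + |n i|) = 1 := inv_mul_cancel₀ hne
  generalize ⟪dropCoord i n, dropCoord i y⟫ = pz at *
  generalize (SignType.sign (n i) : ℝ) = s at *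
  generalize y i = t at *
  generalize |n i| = a at *
  rw [← hs2]
  field_simp
  ring

theorem LipschitzOnWith.euclideanHausdorffMeasure_image_le {X Y : Type*} [MetricSpace X]
    [MeasurableSpace X] [BorelSpace X] [MetricSpace Y] [MeasurableSpace Y] [BorelSpace Y]
    {K : ℝ≥0} {f : X → Y} {s : Set X} (h : LipschitzOnWith K f s) (d : ℕ) :
    Measure.euclideanHausdorffMeasure d (f '' s) ≤
      (K : ℝ≥0∞) ^ d * Measure.euclideanHausdorffMeasure d s := by
  have := h.hausdorffMeasure_image_le (d := d) (by positivity)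
  simp only [Measure.euclideanHausdorffMeasure_def, Measure.smul_apply, ENNReal.smul_def,
    smul_eq_mul]
  rw [ENNReal.rpow_natCast] at this
  calc _ ≤ _ := mul_le_mul_right this _
    _ = _ := by ring

theorem norm_dropCoord_le (i : Fin 3) (y : E3) : ‖dropCoord i y‖ ≤ ‖y‖ := by
  have h := inner_eq_dropCoord i y y
  rw [real_inner_self_eq_norm_sq, real_inner_self_eq_norm_sq] at h
  exact le_of_sq_le_sq (by nlinarith [mul_self_nonneg (y i)]) (norm_nonneg y)

theorem lipschitzWith_tiltedProj {i : Fin 3} {n : E3} (hn : ‖n‖ = 1) (hi : n i ≠ 0) :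
    LipschitzWith 1 (tiltedProj i n) := by
  refine LipschitzWith.of_dist_le_mul fun y z => ?_
  rw [dist_eq_norm, dist_eq_norm, ← map_sub, NNReal.coe_one, one_mul]
  refine le_of_sq_le_sq ?_ (norm_nonneg _)
  rw [norm_tiltedProj_sq hn hi]
  linarith [sq_nonneg ⟪n, y - z⟫]

/-- On a set that is flat in the direction `n`, the tilted projection has a Lipschitz inverse `g`,
and `dropCoord i ∘ g` is almost the linear map `tiltMap i n`. -/
theorem exists_inverse_tiltedProj {i : Fin 3} {n : E3} (hn : ‖n‖ = 1) (hi : n i ≠ 0) {K δ : ℝ≥0}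
    {ε : ℝ} (hK : 1 ≤ (K : ℝ) ^ 2 * (1 - ε ^ 2)) (hδ : ε * K ≤ δ) (hε : 0 ≤ ε) {B : Set E3}
    (hB : ∀ y ∈ B, ∀ z ∈ B, |⟪n, y - z⟫| ≤ ε * ‖y - z‖) :
    ∃ g : E2 → E3, LipschitzOnWith K g (tiltedProj i n '' B) ∧ g '' (tiltedProj i n '' B) = B ∧
      ApproximatesLinearOn (fun z => dropCoord i (g z))
        (LinearMap.toContinuousLinearMap (tiltMap i n)) (tiltedProj i n '' B) δ := by
  -- On a flat set the component along `n` takes away at most the fraction `ε²` of `‖y - z‖²`, so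
  -- the tilted projection is bi-Lipschitz there.
  have hanti : ∀ y ∈ B, ∀ z ∈ B, ‖y - z‖ ≤ K * ‖tiltedProj i n y - tiltedProj i n z‖ := by
    intro y hy z hz
    have h1 := hB y hy z hz
    refine le_of_sq_le_sq ?_ (by positivity)
    rw [← map_sub, mul_pow, norm_tiltedProj_sq hn hi]
    have h2 : ⟪n, y - z⟫ ^ 2 ≤ ε ^ 2 * ‖y - z‖ ^ 2 := by
      rw [← sq_abs, ← mul_pow]; gcongr
    have h3 := mul_le_mul_of_nonneg_right hK (sq_nonneg ‖y - z‖)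
    have h4 := mul_le_mul_of_nonneg_left h2 (sq_nonneg (K : ℝ))
    nlinarith
  have hinj : InjOn (tiltedProj i n) B := by
    intro y hy z hz h
    have := hanti y hy z hz
    rw [h, sub_self, norm_zero, mul_zero] at this
    exact sub_eq_zero.1 (norm_le_zero_iff.1 this)
  have hg : ∀ y ∈ B, Function.invFunOn (tiltedProj i n) B (tiltedProj i n y) = y :=
    fun y hy => hinj.leftInvOn_invFunOn hy
  refine ⟨Function.invFunOn (tiltedProj i n) B, ?_, ?_, ?_⟩
  · refine LipschitzOnWith.of_dist_le_mul ?_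
    rintro _ ⟨y, hy, rfl⟩ _ ⟨z, hz, rfl⟩
    rw [hg y hy, hg z hz, dist_eq_norm, dist_eq_norm]
    exact hanti y hy z hz
  · rw [image_image]
    exact (image_congr hg).trans (image_id' B)
  · intro x hx x' hx'
    obtain ⟨y, hy, rfl⟩ := hx
    obtain ⟨z, hz, rfl⟩ := hx'
    simp only [hg y hy, hg z hz]
    rw [← map_sub, ← map_sub, LinearMap.coe_toContinuousLinearMap', tiltMap_tiltedProj hn hi,
      norm_smul, Real.norm_eq_abs]
    have h1 : ‖dropCoord i n‖ ≤ 1 := hn ▸ norm_dropCoord_le i n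
    calc |⟪n, y - z⟫| * ‖dropCoord i n‖ ≤ |⟪n, y - z⟫| * 1 := by gcongr
      _ ≤ ε * ‖y - z‖ := by rw [mul_one]; exact hB y hy z hz
      _ ≤ ε * (K * ‖tiltedProj i n (y - z)‖) := by
        rw [map_sub]; exact mul_le_mul_of_nonneg_left (hanti y hy z hz) hε
      _ ≤ δ * ‖tiltedProj i n (y - z)‖ := by rw [← mul_assoc]; gcongr

theorem abs_det_tiltMap {i : Fin 3} {n : E3} (hn : ‖n‖ = 1) :
    |(LinearMap.toContinuousLinearMap (tiltMap i n)).det| = |n i| := by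
  rw [LinearMap.det_toContinuousLinearMap, det_tiltMap hn, abs_abs]

/-- The projection of `B` is the image of its tilted projection under a map close to a linear map of
determinant `|nᵢ|`, and the tilted projection does not increase Hausdorff measure. -/
theorem exists_volume_dropCoord_le {i : Fin 3} {n : E3} (hn : ‖n‖ = 1) (hi : n i ≠ 0) {m : ℝ≥0}
    (hm : |n i| < m) : ∃ ε > 0, ∀ B : Set E3, (∀ y ∈ B, ∀ z ∈ B, |⟪n, y - z⟫| ≤ ε * ‖y - z‖) →
      volume (dropCoord i '' B) ≤ m * Measure.euclideanHausdorffMeasure 2 B := by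
  have h := addHaar_image_le_mul_of_det_lt (volume : Measure E2)
    (LinearMap.toContinuousLinearMap (tiltMap i n)) (m := m)
    (by rw [abs_det_tiltMap hn, ENNReal.ofReal_lt_coe_iff (abs_nonneg _)]; exact hm)
  obtain ⟨δ, hδ, hδ0⟩ := (h.and self_mem_nhdsWithin).exists
  have hδ0' : (0 : ℝ) < δ := hδ0
  have hε0 : 0 < min ((δ : ℝ) / 2) (1 / 2) := by positivity
  refine ⟨min ((δ : ℝ) / 2) (1 / 2), hε0, fun B hB => ?_⟩
  have h1 : min ((δ : ℝ) / 2) (1 / 2) ≤ (δ : ℝ) / 2 := min_le_left _ _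
  have h2 : min ((δ : ℝ) / 2) (1 / 2) ≤ 1 / 2 := min_le_right _ _
  -- Only the approximation by the linear map matters here, so the crude Lipschitz constant `2`,
  -- valid for `ε ≤ 1/2`, suffices.
  obtain ⟨g, -, hgB, hg⟩ := exists_inverse_tiltedProj hn hi (K := 2) (δ := δ)
    (by push_cast; nlinarith) (by push_cast; linarith) hε0.le hB
  have e : dropCoord i '' B = (fun z => dropCoord i (g z)) '' (tiltedProj i n '' B) := by
    conv_lhs => rw [← hgB]
    rw [image_image]
  rw [e]
  refine (hδ _ _ hg).trans ?_
  gcongr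
  rw [← EuclideanSpace.euclideanHausdorffMeasure_eq_volume]
  have := ((lipschitzWith_tiltedProj hn hi).lipschitzOnWith
    (s := B)).euclideanHausdorffMeasure_image_le 2
  simpa using this

theorem exists_le_volume_dropCoord {i : Fin 3} {n : E3} (hn : ‖n‖ = 1) {m : ℝ≥0}
    (hm : m < |n i|) : ∃ ε > 0, ∀ B : Set E3, (∀ y ∈ B, ∀ z ∈ B, |⟪n, y - z⟫| ≤ ε * ‖y - z‖) →
      m * Measure.euclideanHausdorffMeasure 2 B ≤ volume (dropCoord i '' B) := by
  have hi : n i ≠ 0 := by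
    intro h; rw [h, abs_zero] at hm; exact absurd hm (not_lt.2 m.2)
  rcases eq_or_ne m 0 with rfl | hm0
  · exact ⟨1, one_pos, fun B _ => by simp⟩
  have hmpos : (0 : ℝ) < m := by exact_mod_cast pos_iff_ne_zero.2 hm0
  obtain ⟨m', hm1, hm2⟩ := exists_between hm
  lift m' to ℝ≥0 using hmpos.le.trans hm1.le
  have h := mul_le_addHaar_image_of_lt_det (volume : Measure E2)
    (LinearMap.toContinuousLinearMap (tiltMap i n)) (m := m')
    (by rw [abs_det_tiltMap hn, ← ENNReal.ofReal_coe_nnreal,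
      ENNReal.ofReal_lt_ofReal_iff_of_nonneg (NNReal.coe_nonneg m')]; exact hm2)
  obtain ⟨δ, hδ, hδ0⟩ := (h.and self_mem_nhdsWithin).exists
  have hδ0' : (0 : ℝ) < δ := hδ0
  -- The loss `K²` in area caused by the inverse of the tilted projection is exactly the room
  -- between `m` and `m'`; flatness has to be fine enough for the constant `K > 1`.
  obtain ⟨K, hK⟩ : ∃ K : ℝ≥0, K ^ 2 = m' / m := ⟨NNReal.sqrt (m' / m), NNReal.sq_sqrt _⟩
  have hKr : (K : ℝ) ^ 2 = m' / m := by exact_mod_cast hK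
  have hK1 : 1 < (K : ℝ) ^ 2 := by rw [hKr, one_lt_div hmpos]; exact hm1
  have hK0 : 0 < (K : ℝ) := by
    rcases (NNReal.coe_nonneg K).eq_or_lt with h0 | h0
    · rw [← h0] at hK1; norm_num at hK1
    · exact h0
  obtain ⟨ε, hε0, hε1, hε2⟩ : ∃ ε : ℝ, 0 < ε ∧ ε * K ≤ δ ∧ ε ^ 2 ≤ 1 - 1 / (K : ℝ) ^ 2 := by
    have hp : 0 < 1 - 1 / (K : ℝ) ^ 2 := by
      rw [sub_pos, div_lt_one (by positivity)]; exact hK1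
    refine ⟨min (δ / K) (√(1 - 1 / (K : ℝ) ^ 2)), by positivity, ?_, ?_⟩
    · rw [← le_div_iff₀ hK0]; exact min_le_left _ _
    · calc _ ≤ (√(1 - 1 / (K : ℝ) ^ 2)) ^ 2 := by gcongr; exact min_le_right _ _
        _ = _ := Real.sq_sqrt hp.le
  refine ⟨ε, hε0, fun B hB => ?_⟩
  obtain ⟨g, hgL, hgB, hg⟩ := exists_inverse_tiltedProj hn hi (K := K) (δ := δ)
    (by
      have := mul_le_mul_of_nonneg_left hε2 (sq_nonneg (K : ℝ))
      rw [mul_sub, mul_one_div_cancel (by positivity)] at this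
      linarith) hε1 hε0.le hB
  have e : dropCoord i '' B = (fun z => dropCoord i (g z)) '' (tiltedProj i n '' B) := by
    conv_lhs => rw [← hgB]
    rw [image_image]
  rw [e]
  refine le_trans ?_ (hδ _ _ hg)
  have h3 := hgL.euclideanHausdorffMeasure_image_le 2
  rw [hgB, EuclideanSpace.euclideanHausdorffMeasure_eq_volume] at h3
  refine (mul_le_mul_right h3 _).trans ?_
  rw [← mul_assoc]
  gcongr
  have : m * K ^ 2 = m' := by rw [hK]; field_simp
  exact_mod_cast this.le

/-! ### Comparison of measures from local bounds -/

/-- Second countability reduces the neighbourhoods to a countable cover of `S`; making it disjoint,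
the local inequalities add up. -/
theorem Measure.restrict_le_restrict_of_forall_exists_isOpen {X : Type*} [TopologicalSpace X]
    [SecondCountableTopology X] [MeasurableSpace X] [BorelSpace X] {μ ν : Measure X} {S : Set X}
    (hS : MeasurableSet S) (h : ∀ x ∈ S, ∃ U, IsOpen U ∧ x ∈ U ∧
      ∀ B, MeasurableSet B → B ⊆ U ∩ S → ν B ≤ μ B) : ν.restrict S ≤ μ.restrict S := by
  choose! U hUo hUx hU using h
  obtain ⟨T, hTS, hTc, hT⟩ := TopologicalSpace.countable_cover_nhdsWithin
    (fun x hx => mem_nhdsWithin_of_mem_nhds ((hUo x hx).mem_nhds (hUx x hx)))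
  rcases T.eq_empty_or_nonempty with rfl | hne
  · obtain rfl : S = ∅ := by simpa using hT
    simp
  obtain ⟨x, rfl⟩ := hTc.exists_eq_range hne
  refine Measure.le_iff.2 fun A hA => ?_
  rw [Measure.restrict_apply hA, Measure.restrict_apply hA]
  have hcov : A ∩ S = ⋃ k, (A ∩ S) ∩ disjointed (fun k => U (x k)) k := by
    rw [← inter_iUnion, iUnion_disjointed, eq_comm, inter_eq_left]
    intro y hy
    have := hT hy.2
    simpa using this
  have hmeas : ∀ k, MeasurableSet ((A ∩ S) ∩ disjointed (fun k => U (x k)) k) := fun k =>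
    (hA.inter hS).inter (MeasurableSet.disjointed
      (fun k => (hUo _ (hTS (mem_range_self k))).measurableSet) k)
  have hdisj : Pairwise (Function.onFun Disjoint
      fun k => (A ∩ S) ∩ disjointed (fun k => U (x k)) k) := fun a b hab =>
    (disjoint_disjointed _ hab).mono inter_subset_right inter_subset_right
  rw [hcov, measure_iUnion hdisj hmeas, measure_iUnion hdisj hmeas]
  refine ENNReal.tsum_le_tsum fun k => hU _ (hTS (mem_range_self k)) _ (hmeas k) ?_
  exact fun y hy => ⟨disjointed_subset (fun k => U (x k)) _ hy.2, hy.1.2⟩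

/-- A differentiation theorem without coverings: continuity of `f` lets the local bounds be compared
with `f` up to any factor `K > 1`, the local inequalities globalise, and `K → 1`. Positivity of `f`
leaves room between `f x` and `K * f x`. -/
theorem Measure.restrict_eq_withDensity_of_local_bounds {X : Type*} [TopologicalSpace X]
    [SecondCountableTopology X] [MeasurableSpace X] [BorelSpace X] {μ ν : Measure X} {S : Set X}
    (hS : MeasurableSet S) {f : X → ℝ≥0} (hf : ContinuousOn f S) (hpos : ∀ x ∈ S, 0 < f x)
    (hu : ∀ x ∈ S, ∀ m, f x < m → ∃ U, IsOpen U ∧ x ∈ U ∧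
      ∀ B, MeasurableSet B → B ⊆ U ∩ S → ν B ≤ m * μ B)
    (hl : ∀ x ∈ S, ∀ m, m < f x → ∃ U, IsOpen U ∧ x ∈ U ∧
      ∀ B, MeasurableSet B → B ⊆ U ∩ S → m * μ B ≤ ν B) :
    ν.restrict S = (μ.withDensity fun x => (f x : ℝ≥0∞)).restrict S := by
  have hlim : ∀ (a b : Measure X), (∀ K : ℝ≥0, 1 < K → a ≤ (K : ℝ≥0∞) • b) → a ≤ b := by
    intro a b h
    refine Measure.le_iff.2 fun A hA => ?_
    have ht : Tendsto (fun K : ℝ≥0 => (K : ℝ≥0∞) * b A) (𝓝[>] 1) (𝓝 (1 * b A)) :=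
      ENNReal.Tendsto.mul_const (by
        have : Tendsto (fun K : ℝ≥0 => (K : ℝ≥0∞)) (𝓝 1) (𝓝 ((1 : ℝ≥0) : ℝ≥0∞)) :=
          ENNReal.tendsto_coe.2 tendsto_id
        exact this.mono_left nhdsWithin_le_nhds) (Or.inl (by simp))
    rw [one_mul] at ht
    refine ge_of_tendsto ht ?_
    filter_upwards [self_mem_nhdsWithin] with K hK
    simpa using Measure.le_iff.1 (h K hK) A hA
  have hnear : ∀ x ∈ S, ∀ V : Set ℝ≥0, IsOpen V → f x ∈ V → ∃ U, IsOpen U ∧ x ∈ U ∧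
      ∀ y ∈ U ∩ S, f y ∈ V := by
    intro x hx V hV hxV
    obtain ⟨U, hU, hxU, hUV⟩ := mem_nhdsWithin.1 ((hf x hx).preimage_mem_nhdsWithin (hV.mem_nhds hxV))
    exact ⟨U, hU, hxU, hUV⟩
  refine le_antisymm (hlim _ _ fun K hK => ?_) (hlim _ _ fun K hK => ?_)
  · rw [← Measure.restrict_smul]
    refine Measure.restrict_le_restrict_of_forall_exists_isOpen hS fun x hx => ?_
    have h1 : f x < K * f x := lt_mul_of_one_lt_left (hpos x hx) hK
    obtain ⟨m, hm1, hm2⟩ := exists_between h1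
    obtain ⟨U, hU, hxU, hB⟩ := hu x hx m hm1
    obtain ⟨W, hW, hxW, hWm⟩ := hnear x hx {r | m < K * r}
      (isOpen_lt continuous_const (by fun_prop)) hm2
    refine ⟨U ∩ W, hU.inter hW, ⟨hxU, hxW⟩, fun B hBm hBs => ?_⟩
    refine (hB B hBm fun y hy => ⟨(hBs hy).1.1, (hBs hy).2⟩).trans ?_
    rw [Measure.smul_apply, withDensity_apply _ hBm, smul_eq_mul, ← lintegral_const_mul' _ _ (by simp),
      ← setLIntegral_const]
    refine setLIntegral_mono' hBm fun y hy => ?_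
    exact_mod_cast (hWm y ⟨(hBs hy).1.2, (hBs hy).2⟩).le
  · rw [← Measure.restrict_smul]
    refine Measure.restrict_le_restrict_of_forall_exists_isOpen hS fun x hx => ?_
    have h1 : f x < K * f x := lt_mul_of_one_lt_left (hpos x hx) hK
    have hK0 : 0 < K := zero_lt_one.trans hK
    obtain ⟨m', hm1, hm2⟩ := exists_between h1
    obtain ⟨m, rfl⟩ : ∃ m, m' = K * m := ⟨m' / K, by field_simp⟩
    obtain ⟨U, hU, hxU, hB⟩ := hl x hx m (lt_of_mul_lt_mul_left hm2 hK0.le)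
    obtain ⟨W, hW, hxW, hWm⟩ := hnear x hx {r | r < K * m} isOpen_Iio hm1
    refine ⟨U ∩ W, hU.inter hW, ⟨hxU, hxW⟩, fun B hBm hBs => ?_⟩
    have h2 := hB B hBm fun y hy => ⟨(hBs hy).1.1, (hBs hy).2⟩
    rw [Measure.smul_apply, withDensity_apply _ hBm, smul_eq_mul]
    refine le_trans ?_ (mul_le_mul_right h2 (K : ℝ≥0∞))
    rw [← mul_assoc, ← setLIntegral_const]
    refine setLIntegral_mono' hBm fun y hy => ?_
    exact_mod_cast (hWm y ⟨(hBs hy).1.2, (hBs hy).2⟩).le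

/-! ### The Gauss–Green formula for convex domains -/

/-- The point of `ℝ³` with `i`-th coordinate `t` and the other coordinates given by `z`. -/
noncomputable def insertCoord (i : Fin 3) (z : E2) (t : ℝ) : E3 :=
  WithLp.toLp 2 (i.insertNth t (fun j => z j) : Fin 3 → ℝ)

@[simp] theorem dropCoord_insertCoord (i : Fin 3) (z : E2) (t : ℝ) :
    dropCoord i (insertCoord i z t) = z := by
  ext j; simp [insertCoord]

@[simp] theorem insertCoord_apply_same (i : Fin 3) (z : E2) (t : ℝ) : insertCoord i z t i = t := by
  simp [insertCoord]

@[simp] theorem insertCoord_dropCoord (i : Fin 3) (y : E3) :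
    insertCoord i (dropCoord i y) (y i) = y := by
  ext j
  rcases Fin.eq_self_or_eq_succAbove i j with rfl | ⟨k, rfl⟩ <;> simp [insertCoord]

theorem insertCoord_eq_add (i : Fin 3) (z : E2) (t r : ℝ) :
    insertCoord i z t = insertCoord i z r + (t - r) • unitVec i := by
  ext j
  rcases Fin.eq_self_or_eq_succAbove i j with rfl | ⟨k, rfl⟩ <;> simp [insertCoord, unitVec]

theorem continuous_insertCoord (i : Fin 3) : Continuous fun p : ℝ × E2 => insertCoord i p.2 p.1 := by
  unfold insertCoord
  refine (PiLp.continuous_toLp 2 _).comp ?_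
  refine Continuous.finInsertNth i continuous_fst ?_
  fun_prop

/-- The splitting of `ℝ³` into the `i`-th coordinate and the other two. -/
noncomputable def splitCoord (i : Fin 3) : E3 ≃ᵐ ℝ × E2 where
  toFun y := (y i, dropCoord i y)
  invFun p := insertCoord i p.2 p.1
  left_inv y := by simp
  right_inv p := by simp
  measurable_toFun := by
    refine Measurable.prodMk ?_ (dropCoord i).continuous.measurable
    exact (EuclideanSpace.proj i : E3 →L[ℝ] ℝ).continuous.measurable
  measurable_invFun := (continuous_insertCoord i).measurable

theorem measurePreserving_splitCoord (i : Fin 3) : MeasurePreserving (splitCoord i) := by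
  have h1 := EuclideanSpace.volume_preserving_symm_measurableEquiv_toLp (Fin 3)
  have h2 := volume_preserving_piFinSuccAbove (fun _ : Fin 3 => ℝ) i
  have h3 := (MeasurePreserving.id (volume : Measure ℝ)).prod
    (EuclideanSpace.volume_preserving_symm_measurableEquiv_toLp (Fin 2)).symm
  exact h3.comp (h2.comp h1)

/-- The height of the part of `∂Ω` above `z` in the direction `s eᵢ`, where `s = ±1`. -/
noncomputable def sliceTop (Ω : Set E3) (i : Fin 3) (s : ℝ) (z : E2) : ℝ :=
  sSup {t | insertCoord i z (s * t) ∈ Ω}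

/-- The point of `∂Ω` above `z` in the direction `s eᵢ`, where `s = ±1`. -/
noncomputable def boundarySection (Ω : Set E3) (i : Fin 3) (s : ℝ) (z : E2) : E3 :=
  insertCoord i z (s * sliceTop Ω i s z)

theorem inner_unitVec (i : Fin 3) (y : E3) : ⟪y, unitVec i⟫ = y i := by
  simp [unitVec, EuclideanSpace.inner_single_right]

theorem IsOpen.dropCoord_image {Ω : Set E3} (hΩ : IsOpen Ω) (i : Fin 3) :
    IsOpen (dropCoord i '' Ω) :=
  (dropCoord i).isOpenMap (fun z => ⟨insertCoord i z 0, by simp⟩) _ hΩ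

theorem mem_dropCoord_image {Ω : Set E3} {i : Fin 3} {z : E2} :
    z ∈ dropCoord i '' Ω ↔ ∃ t, insertCoord i z t ∈ Ω := by
  constructor
  · rintro ⟨y, hy, rfl⟩
    exact ⟨y i, by simpa using hy⟩
  · rintro ⟨t, ht⟩
    exact ⟨_, ht, by simp⟩

theorem continuous_insertCoord_mul (i : Fin 3) (s : ℝ) (z : E2) :
    Continuous fun t : ℝ => insertCoord i z (s * t) :=
  (continuous_insertCoord i).comp (by fun_prop : Continuous fun t : ℝ => (s * t, z))

/-! ### The boundary as a pair of graphs over a coordinate plane -/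

namespace IsConvexC2Domain

theorem isCompact_closure {Ω : Set E3} (hΩ : IsConvexC2Domain Ω) : IsCompact (closure Ω) :=
  hΩ.bounded.isCompact_closure

theorem isCompact_frontier {Ω : Set E3} (hΩ : IsConvexC2Domain Ω) : IsCompact (frontier Ω) :=
  hΩ.isCompact_closure.of_isClosed_subset isClosed_frontier frontier_subset_closure

theorem bddAbove_slice {Ω : Set E3} (hΩ : IsConvexC2Domain Ω) (i : Fin 3) {s : ℝ} (hs : s ^ 2 = 1)
    (z : E2) : BddAbove {t | insertCoord i z (s * t) ∈ Ω} := by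
  obtain ⟨R, hR⟩ := hΩ.bounded.exists_norm_le
  refine ⟨R, fun t ht => ?_⟩
  have h1 := hR _ ht
  have h2 := PiLp.norm_apply_le (insertCoord i z (s * t)) i
  rw [insertCoord_apply_same, norm_mul, Real.norm_eq_abs, show |s| = 1 by rw [← Real.sqrt_sq_eq_abs, hs, Real.sqrt_one],
    one_mul] at h2
  exact (le_abs_self t).trans (h2.trans h1)

theorem slice_lt_sliceTop {Ω : Set E3} (hΩ : IsConvexC2Domain Ω) {i : Fin 3} {s : ℝ}
    (hs : s ^ 2 = 1) {z : E2} {t : ℝ} (ht : insertCoord i z (s * t) ∈ Ω) :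
    t < sliceTop Ω i s z := by
  have ho : IsOpen {t | insertCoord i z (s * t) ∈ Ω} :=
    hΩ.isOpen.preimage (continuous_insertCoord_mul i s z)
  have hev : ∀ᶠ r in 𝓝[>] t, r ∈ {t | insertCoord i z (s * t) ∈ Ω} :=
    nhdsWithin_le_nhds (ho.mem_nhds ht)
  obtain ⟨t', h1, h2⟩ := (hev.and self_mem_nhdsWithin).exists
  exact lt_of_lt_of_le h2 (le_csSup (hΩ.bddAbove_slice i hs z) h1)

theorem boundarySection_mem_frontier {Ω : Set E3} (hΩ : IsConvexC2Domain Ω) {i : Fin 3} {s : ℝ}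
    (hs : s ^ 2 = 1) {z : E2} (hz : z ∈ dropCoord i '' Ω) :
    boundarySection Ω i s z ∈ frontier Ω := by
  obtain ⟨t, ht⟩ := mem_dropCoord_image.1 hz
  have hne : {t | insertCoord i z (s * t) ∈ Ω}.Nonempty :=
    ⟨s * t, by simpa [← mul_assoc, ← sq, hs] using ht⟩
  rw [hΩ.isOpen.frontier_eq]
  refine ⟨?_, fun hmem => lt_irrefl _ (hΩ.slice_lt_sliceTop hs hmem)⟩
  have := csSup_mem_closure hne (hΩ.bddAbove_slice i hs z)
  exact map_mem_closure (f := fun t => insertCoord i z (s * t))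
    (continuous_insertCoord_mul i s z) this (fun t ht => ht)

/-- A point of `Ω` lies below the top point on the same line, and a small ball around it gives their
difference, a multiple of `s eᵢ`, a positive product with the normal. -/
theorem outwardNormal_boundarySection_pos {Ω : Set E3} (hΩ : IsConvexC2Domain Ω) {i : Fin 3}
    {s : ℝ} (hs : s ^ 2 = 1) {z : E2} (hz : z ∈ dropCoord i '' Ω) :
    0 < s * outwardNormal Ω (boundarySection Ω i s z) i := by
  have hf := hΩ.boundarySection_mem_frontier hs hz
  obtain ⟨t, ht⟩ := mem_dropCoord_image.1 hz
  obtain ⟨t, rfl⟩ : ∃ r, t = s * r := ⟨s * t, by rw [← mul_assoc, ← sq, hs, one_mul]⟩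
  obtain ⟨r, hr, hball⟩ := Metric.nhds_basis_closedBall.mem_iff.1 (hΩ.isOpen.mem_nhds ht)
  have h1 := hΩ.le_inner_outwardNormal hr.le hf hball
  have h2 := hΩ.slice_lt_sliceTop hs ht
  rw [boundarySection, insertCoord_eq_add i z _ (s * t), add_sub_cancel_left,
    real_inner_smul_right, inner_unitVec, ← insertCoord_eq_add, ← boundarySection] at h1
  rw [← mul_sub] at h1
  by_contra! hc
  nlinarith

theorem exists_segment_mem_of_normal_pos {Ω : Set E3} (hΩ : IsConvexC2Domain Ω) {i : Fin 3}
    {s : ℝ} (hs : s ^ 2 = 1) {y : E3} (hy : y ∈ frontier Ω) (hn : 0 < s * outwardNormal Ω y i) :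
    ∀ᶠ t in 𝓝[>] (0 : ℝ), insertCoord i (dropCoord i y) (s * (s * y i - t)) ∈ Ω := by
  have h := hΩ.exists_segment_mem hy (v := -(s • unitVec i))
    (by rw [inner_neg_right, real_inner_smul_right, inner_unitVec]; linarith)
  filter_upwards [h] with t ht
  rw [insertCoord_eq_add i _ _ (y i), insertCoord_dropCoord]
  convert ht using 2
  rw [smul_neg, smul_smul, ← neg_smul]
  congr 1
  linear_combination y i * hs

theorem dropCoord_mem_of_normal_pos {Ω : Set E3} (hΩ : IsConvexC2Domain Ω) {i : Fin 3}
    {s : ℝ} (hs : s ^ 2 = 1) {y : E3} (hy : y ∈ frontier Ω) (hn : 0 < s * outwardNormal Ω y i) :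
    dropCoord i y ∈ dropCoord i '' Ω := by
  obtain ⟨t, ht⟩ := (hΩ.exists_segment_mem_of_normal_pos hs hy hn).exists
  exact mem_dropCoord_image.2 ⟨_, ht⟩

/-- The line through `y` enters `Ω` just below `y`, and the supporting plane at `y` keeps it out of
`Ω` above. So `y` is the top of its slice, and the section parametrises exactly the part of `∂Ω`
with the given sign of the normal. -/
theorem boundarySection_dropCoord {Ω : Set E3} (hΩ : IsConvexC2Domain Ω) {i : Fin 3}
    {s : ℝ} (hs : s ^ 2 = 1) {y : E3} (hy : y ∈ frontier Ω) (hn : 0 < s * outwardNormal Ω y i) :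
    boundarySection Ω i s (dropCoord i y) = y := by
  have hev := hΩ.exists_segment_mem_of_normal_pos hs hy hn
  have htop : sliceTop Ω i s (dropCoord i y) = s * y i := by
    refine csSup_eq_of_forall_le_of_forall_lt_exists_gt ?_ ?_ ?_
    · obtain ⟨t, ht⟩ := hev.exists
      exact ⟨_, ht⟩
    · intro t ht
      have h1 := hΩ.inner_outwardNormal_nonpos hy (subset_closure ht)
      rw [insertCoord_eq_add i _ _ (y i), insertCoord_dropCoord, add_sub_cancel_left,
        real_inner_smul_right, inner_unitVec] at h1
      have h2 : (t - s * y i) * (s * outwardNormal Ω y i) ≤ 0 := by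
        calc _ = (s * t - s ^ 2 * y i) * outwardNormal Ω y i := by ring
          _ ≤ 0 := by rw [hs, one_mul]; exact h1
      by_contra! hc
      nlinarith
    · intro w hw
      have h2 : ∀ᶠ t in 𝓝[>] (0 : ℝ), t < s * y i - w :=
        nhdsWithin_le_nhds (gt_mem_nhds (by linarith))
      obtain ⟨t, h3, h4⟩ := (hev.and h2).exists
      exact ⟨_, h3, by linarith⟩
  rw [boundarySection, htop, ← mul_assoc, ← sq, hs, one_mul, insertCoord_dropCoord]

theorem measurable_sliceTop {Ω : Set E3} (hΩ : IsConvexC2Domain Ω) (i : Fin 3) {s : ℝ}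
    (hs : s ^ 2 = 1) : Measurable (sliceTop Ω i s) := by
  refine measurable_of_Ioi fun c => ?_
  have hempty : ∀ z, z ∉ dropCoord i '' Ω → sliceTop Ω i s z = 0 := by
    intro z hz
    have : {t | insertCoord i z (s * t) ∈ Ω} = ∅ := by
      ext t
      simp only [mem_ofPred_eq, mem_empty_iff_false, iff_false]
      exact fun h => hz (mem_dropCoord_image.2 ⟨_, h⟩)
    rw [sliceTop, this, Real.sSup_empty]
  have hD := (hΩ.isOpen.dropCoord_image i).measurableSet
  have hV : IsOpen (⋃ t : Ioi c, {z | insertCoord i z (s * t) ∈ Ω}) :=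
    isOpen_iUnion fun t => hΩ.isOpen.preimage
      ((continuous_insertCoord i).comp (by fun_prop : Continuous fun z : E2 => (s * (t : ℝ), z)))
  have hDc : ∀ z ∈ dropCoord i '' Ω, c < sliceTop Ω i s z ↔
      z ∈ ⋃ t : Ioi c, {z | insertCoord i z (s * t) ∈ Ω} := by
    intro z hz
    simp only [mem_iUnion, mem_ofPred_eq]
    constructor
    · intro h
      obtain ⟨t, ht⟩ := mem_dropCoord_image.1 hz
      obtain ⟨t, h1, h2⟩ := exists_lt_of_lt_csSup
        ⟨s * t, by simpa [← mul_assoc, ← sq, hs] using ht⟩ h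
      exact ⟨⟨t, h2⟩, h1⟩
    · rintro ⟨⟨t, h2⟩, h1⟩
      exact lt_trans h2 (hΩ.slice_lt_sliceTop hs h1)
  -- Off the projection of `Ω` the slice is empty and its supremum takes the default value `0`,
  -- whence the second set.
  have : sliceTop Ω i s ⁻¹' Ioi c = (dropCoord i '' Ω ∩ ⋃ t : Ioi c,
      {z | insertCoord i z (s * t) ∈ Ω}) ∪ ((dropCoord i '' Ω)ᶜ ∩ {_z | c < 0}) := by
    ext z
    by_cases hz : z ∈ dropCoord i '' Ω
    · have := hDc z hz
      simp only [mem_preimage, mem_Ioi, mem_union, mem_inter_iff, hz, true_and, mem_compl_iff,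
        not_true_eq_false, false_and, or_false, this]
    · simp only [mem_preimage, mem_Ioi, hempty z hz, mem_union, mem_inter_iff, hz, false_and,
        mem_compl_iff, not_false_eq_true, true_and, false_or, mem_ofPred_eq]
  rw [this]
  exact (hD.inter hV.measurableSet).union (hD.compl.inter (MeasurableSet.const _))

theorem measurable_boundarySection {Ω : Set E3} (hΩ : IsConvexC2Domain Ω) (i : Fin 3) {s : ℝ}
    (hs : s ^ 2 = 1) : Measurable (boundarySection Ω i s) := by
  have h1 : Measurable fun z : E2 => (s * sliceTop Ω i s z, z) :=
    ((hΩ.measurable_sliceTop i hs).const_mul s).prodMk measurable_id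
  exact (continuous_insertCoord i).measurable.comp h1

theorem slice_eq_Ioo {Ω : Set E3} (hΩ : IsConvexC2Domain Ω) {i : Fin 3} {z : E2}
    (hz : z ∈ dropCoord i '' Ω) :
    {t | insertCoord i z t ∈ Ω} = Ioo (-sliceTop Ω i (-1) z) (sliceTop Ω i 1 z) := by
  obtain ⟨t₀, ht₀⟩ := mem_dropCoord_image.1 hz
  have hconv : Convex ℝ {t | insertCoord i z t ∈ Ω} := by
    intro t ht r hr a b ha hb hab
    have := hΩ.convex ht hr ha hb hab
    rw [mem_ofPred_eq]
    convert this using 1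
    rw [insertCoord_eq_add i z t 0, insertCoord_eq_add i z r 0, insertCoord_eq_add i z _ 0]
    simp only [smul_add, smul_smul, smul_eq_mul, sub_zero, add_smul]
    rw [add_add_add_comm, ← add_smul, ← add_smul, hab, one_smul]
  ext t
  constructor
  · intro ht
    have h1 := hΩ.slice_lt_sliceTop (i := i) (s := 1) (by norm_num) (z := z) (t := t)
      (by simpa using ht)
    have h2 := hΩ.slice_lt_sliceTop (i := i) (s := -1) (by norm_num) (z := z) (t := -t)
      (by simpa using ht)
    exact ⟨by linarith, h1⟩
  · rintro ⟨h1, h2⟩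
    obtain ⟨b, hb, htb⟩ := exists_lt_of_lt_csSup (s := {t | insertCoord i z (1 * t) ∈ Ω})
      ⟨t₀, by simpa using ht₀⟩ h2
    obtain ⟨a, ha, hta⟩ := exists_lt_of_lt_csSup (s := {t | insertCoord i z (-1 * t) ∈ Ω})
      ⟨-t₀, by simpa using ht₀⟩ (show -t < sliceTop Ω i (-1) z by linarith)
    refine hconv.ordConnected.out (x := -a) (y := b) (by simpa using ha) (by simpa using hb)
      ⟨by linarith, htb.le⟩

end IsConvexC2Domain

/-! ### Area element and finiteness of the surface measure -/

namespace IsConvexC2Domain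

theorem measurableSet_normal_pos {Ω : Set E3} (hΩ : IsConvexC2Domain Ω) (i : Fin 3) (s : ℝ) :
    MeasurableSet {y ∈ frontier Ω | 0 < s * outwardNormal Ω y i} := by
  have hc : ContinuousOn (fun y => s * outwardNormal Ω y i) (frontier Ω) :=
    continuousOn_const.mul ((EuclideanSpace.proj i : E3 →L[ℝ] ℝ).continuous.comp_continuousOn
      hΩ.continuousOn_outwardNormal)
  obtain ⟨U, hU, hUe⟩ := continuousOn_iff'.1 hc (Ioi 0) isOpen_Ioi
  have : {y ∈ frontier Ω | 0 < s * outwardNormal Ω y i} = U ∩ frontier Ω := by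
    rw [← hUe]; ext y; exact and_comm
  rw [this]
  exact hU.measurableSet.inter isClosed_frontier.measurableSet

/-- The area element of the part of `∂Ω` whose normal points in the direction `s eᵢ`. -/
theorem map_boundarySection {Ω : Set E3} (hΩ : IsConvexC2Domain Ω) (i : Fin 3) {s : ℝ}
    (hs : s ^ 2 = 1) :
    (volume.restrict (dropCoord i '' Ω)).map (boundarySection Ω i s) =
      ((Measure.euclideanHausdorffMeasure 2 : Measure E3).restrict
        {y ∈ frontier Ω | 0 < s * outwardNormal Ω y i}).withDensity
        fun y => (‖outwardNormal Ω y i‖₊ : ℝ≥0∞) := by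
  have hS := hΩ.measurableSet_normal_pos i s
  set S := {y ∈ frontier Ω | 0 < s * outwardNormal Ω y i} with hSdef
  have hD := (hΩ.isOpen.dropCoord_image i).measurableSet
  have hsec := hΩ.measurable_boundarySection i hs
  -- The image measure lives on `S`, so it may be compared with surface measure on `S` only; there
  -- it assigns to a set the area of its projection.
  have hconc : ((volume.restrict (dropCoord i '' Ω)).map (boundarySection Ω i s)).restrict S =
      (volume.restrict (dropCoord i '' Ω)).map (boundarySection Ω i s) := by
    refine Measure.restrict_eq_self_of_ae_mem ?_
    refine (ae_map_iff (p := (· ∈ S)) hsec.aemeasurable hS).2 ((ae_restrict_iff' hD).2 ?_)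
    exact Eventually.of_forall fun z hz => ⟨hΩ.boundarySection_mem_frontier hs hz,
      hΩ.outwardNormal_boundarySection_pos hs hz⟩
  have hB : ∀ B, MeasurableSet B → B ⊆ S →
      (volume.restrict (dropCoord i '' Ω)).map (boundarySection Ω i s) B =
        volume (dropCoord i '' B) := by
    intro B hBm hBS
    rw [Measure.map_apply hsec hBm, Measure.restrict_apply (hsec hBm)]
    congr 1
    ext z
    constructor
    · rintro ⟨h1, h2⟩
      exact ⟨_, h1, by simp [boundarySection]⟩
    · rintro ⟨y, hy, rfl⟩
      have hyS := hBS hy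
      refine ⟨?_, hΩ.dropCoord_mem_of_normal_pos hs hyS.1 hyS.2⟩
      rw [mem_preimage, hΩ.boundarySection_dropCoord hs hyS.1 hyS.2]
      exact hy
  have hne : ∀ y ∈ S, outwardNormal Ω y i ≠ 0 := fun y hy h => by
    have := hy.2; rw [h, mul_zero] at this; exact lt_irrefl _ this
  rw [← restrict_withDensity hS, ← hconc]
  refine Measure.restrict_eq_withDensity_of_local_bounds hS ?_ ?_ ?_ ?_
  · have := (EuclideanSpace.proj i : E3 →L[ℝ] ℝ).continuous.comp_continuousOn
      (hΩ.continuousOn_outwardNormal.mono (sep_subset _ _ : S ⊆ _))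
    exact continuous_nnnorm.comp_continuousOn this
  · exact fun y hy => nnnorm_pos.2 (hne y hy)
  · intro x hx m hm
    obtain ⟨ε, hε, h⟩ := exists_volume_dropCoord_le (hΩ.norm_outwardNormal hx.1) (hne x hx)
      (m := m) (by exact_mod_cast hm)
    obtain ⟨U, hU, hxU, hflat⟩ := hΩ.exists_flat hx.1 hε
    refine ⟨U, hU, hxU, fun B hBm hBs => ?_⟩
    rw [hB B hBm fun y hy => (hBs hy).2]
    exact h B fun y hy z hz => hflat y ⟨(hBs hy).2.1, (hBs hy).1⟩ z ⟨(hBs hz).2.1, (hBs hz).1⟩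
  · intro x hx m hm
    obtain ⟨ε, hε, h⟩ := exists_le_volume_dropCoord (i := i) (hΩ.norm_outwardNormal hx.1)
      (m := m) (by exact_mod_cast hm)
    obtain ⟨U, hU, hxU, hflat⟩ := hΩ.exists_flat hx.1 hε
    refine ⟨U, hU, hxU, fun B hBm hBs => ?_⟩
    rw [hB B hBm fun y hy => (hBs hy).2]
    exact h B fun y hy z hz => hflat y ⟨(hBs hy).2.1, (hBs hy).1⟩ z ⟨(hBs hz).2.1, (hBs hz).1⟩

theorem aemeasurable_outwardNormal {Ω : Set E3} (hΩ : IsConvexC2Domain Ω) (i : Fin 3) :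
    AEMeasurable (fun y => outwardNormal Ω y i) (surfaceMeasure Ω) := by
  have := (EuclideanSpace.proj i : E3 →L[ℝ] ℝ).continuous.comp_continuousOn
      hΩ.continuousOn_outwardNormal
  exact this.aemeasurable isClosed_frontier.measurableSet

theorem ae_mem_frontier (Ω : Set E3) : ∀ᵐ y ∂(surfaceMeasure Ω), y ∈ frontier Ω :=
  ae_restrict_mem isClosed_frontier.measurableSet

theorem lintegral_normal_pos {Ω : Set E3} (hΩ : IsConvexC2Domain Ω) (i : Fin 3) {s : ℝ}
    (hs : s ^ 2 = 1) :
    ∫⁻ y in {y ∈ frontier Ω | 0 < s * outwardNormal Ω y i}, ‖outwardNormal Ω y i‖ₑ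
      ∂(Measure.euclideanHausdorffMeasure 2) = volume (dropCoord i '' Ω) := by
  have h := congrArg (fun μ : Measure E3 => μ univ) (hΩ.map_boundarySection i hs)
  simp only at h
  rw [Measure.map_apply (hΩ.measurable_boundarySection i hs) MeasurableSet.univ, preimage_univ,
    Measure.restrict_apply_univ, withDensity_apply _ MeasurableSet.univ, setLIntegral_univ] at h
  exact h.symm

/-- On `∂Ω` one has `1 = ‖n‖ ≤ ∑ |nᵢ|`, and the integral of `|nᵢ|` is at most twice the area of the
projection along `eᵢ`, once for each sign of `nᵢ`. -/
theorem isFiniteMeasure_surfaceMeasure {Ω : Set E3} (hΩ : IsConvexC2Domain Ω) :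
    IsFiniteMeasure (surfaceMeasure Ω) := by
  have hfin : ∀ i, volume (dropCoord i '' Ω) < ⊤ := fun i =>
    ((dropCoord i).lipschitz.isBounded_image hΩ.bounded).measure_lt_top
  have hi : ∀ i, ∫⁻ y in frontier Ω, ‖outwardNormal Ω y i‖ₑ
      ∂(Measure.euclideanHausdorffMeasure 2) ≤ 2 * volume (dropCoord i '' Ω) := by
    intro i
    have hsub : frontier Ω = {y ∈ frontier Ω | 0 < (1 : ℝ) * outwardNormal Ω y i} ∪
        {y ∈ frontier Ω | 0 < (-1 : ℝ) * outwardNormal Ω y i} ∪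
        {y ∈ frontier Ω | outwardNormal Ω y i = 0} := by
      ext y
      simp only [mem_union, mem_ofPred_eq, one_mul, neg_mul, Left.neg_pos_iff, ← and_or_left]
      constructor
      · intro h
        refine ⟨h, ?_⟩
        rcases lt_trichotomy (outwardNormal Ω y i) 0 with h | h | h <;> tauto
      · exact fun h => h.1
    rw [hsub]
    refine (lintegral_union_le _ _ _).trans ?_
    have h0 : ∫⁻ y in {y ∈ frontier Ω | outwardNormal Ω y i = 0}, ‖outwardNormal Ω y i‖ₑ
        ∂(Measure.euclideanHausdorffMeasure 2) = 0 := by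
      have hm : MeasurableSet {y ∈ frontier Ω | outwardNormal Ω y i = 0} := by
        have : {y ∈ frontier Ω | outwardNormal Ω y i = 0} = frontier Ω \
          ({y ∈ frontier Ω | 0 < (1 : ℝ) * outwardNormal Ω y i} ∪
          {y ∈ frontier Ω | 0 < (-1 : ℝ) * outwardNormal Ω y i}) := by
          ext y
          simp only [Set.mem_sdiff, mem_union, mem_ofPred_eq, one_mul, neg_mul, Left.neg_pos_iff]
          constructor
          · rintro ⟨h1, h2⟩
            simp [h1, h2]
          · rintro ⟨h1, h2⟩
            push Not at h2
            exact ⟨h1, le_antisymm (h2.1 h1) (h2.2 h1)⟩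
        rw [this]
        exact isClosed_frontier.measurableSet.diff
          ((hΩ.measurableSet_normal_pos i 1).union (hΩ.measurableSet_normal_pos i (-1)))
      rw [setLIntegral_congr_fun (g := fun _ => 0) hm]
      · simp
      · intro y hy
        simp [hy.2]
    rw [h0, add_zero, two_mul]
    refine (lintegral_union_le _ _ _).trans ?_
    rw [hΩ.lintegral_normal_pos i (by norm_num), hΩ.lintegral_normal_pos i (by norm_num)]
  refine ⟨?_⟩
  rw [surfaceMeasure, Measure.restrict_apply_univ]
  calc _ = ∫⁻ _y in frontier Ω, 1 ∂(Measure.euclideanHausdorffMeasure 2) := by simp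
    _ ≤ ∫⁻ y in frontier Ω, ∑ i, ‖outwardNormal Ω y i‖ₑ ∂(Measure.euclideanHausdorffMeasure 2) := by
      refine setLIntegral_mono' isClosed_frontier.measurableSet fun y hy => ?_
      have h1 := hΩ.norm_outwardNormal hy
      have h2 : ‖outwardNormal Ω y‖ ≤ ∑ i, ‖outwardNormal Ω y i‖ := by
        conv_lhs => rw [← (EuclideanSpace.basisFun (Fin 3) ℝ).sum_repr (outwardNormal Ω y)]
        refine (norm_sum_le _ _).trans (Finset.sum_le_sum fun i _ => ?_)
        rw [norm_smul]; simp
      rw [h1] at h2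
      simp_rw [← ofReal_norm]
      rw [← ENNReal.ofReal_sum_of_nonneg (fun i _ => norm_nonneg _), ← ENNReal.ofReal_one]
      exact ENNReal.ofReal_le_ofReal h2
    _ = ∑ i, ∫⁻ y in frontier Ω, ‖outwardNormal Ω y i‖ₑ ∂(Measure.euclideanHausdorffMeasure 2) :=
      lintegral_finsetSum' _ fun i _ => (hΩ.aemeasurable_outwardNormal i).enorm
    _ < ⊤ := by
      refine ENNReal.sum_lt_top.2 fun i _ => (hi i).trans_lt ?_
      exact ENNReal.mul_lt_top (by simp) (hfin i)

end IsConvexC2Domain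

namespace IsConvexC2Domain

theorem setIntegral_normal_pos {Ω : Set E3} (hΩ : IsConvexC2Domain Ω) (i : Fin 3) {s : ℝ}
    (hs : s ^ 2 = 1) {φ : E3 → ℝ} (hφ : Continuous φ) :
    ∫ y in {y ∈ frontier Ω | 0 < s * outwardNormal Ω y i}, |outwardNormal Ω y i| * φ y
      ∂(surfaceMeasure Ω) = ∫ z in dropCoord i '' Ω, φ (boundarySection Ω i s z) := by
  rw [← integral_map (hΩ.measurable_boundarySection i hs).aemeasurable hφ.aestronglyMeasurable,
    hΩ.map_boundarySection i hs, integral_withDensity_eq_integral_smul₀,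
    surfaceMeasure, Measure.restrict_restrict_of_subset (sep_subset _ _)]
  · rfl
  · have := (hΩ.aemeasurable_outwardNormal i).nnnorm
    exact this.mono_measure (Measure.restrict_mono (sep_subset _ _) le_rfl)

theorem integrable_mul_normal {Ω : Set E3} (hΩ : IsConvexC2Domain Ω) (i : Fin 3) {f : E3 → ℝ}
    (hf : Integrable f (surfaceMeasure Ω)) :
    Integrable (fun y => f y * outwardNormal Ω y i) (surfaceMeasure Ω) := by
  refine hf.mul_bdd (c := 1) (hΩ.aemeasurable_outwardNormal i).aestronglyMeasurable ?_
  filter_upwards [ae_mem_frontier Ω] with y hy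
  exact hΩ.norm_outwardNormal hy ▸ PiLp.norm_apply_le _ i

theorem _root_.Continuous.integrable_surfaceMeasure {Ω : Set E3} (hΩ : IsConvexC2Domain Ω)
    {φ : E3 → ℝ} (hφ : Continuous φ) : Integrable φ (surfaceMeasure Ω) := by
  have := hΩ.isFiniteMeasure_surfaceMeasure
  obtain ⟨C, hC⟩ := hΩ.isCompact_frontier.exists_bound_of_continuousOn hφ.continuousOn
  refine Integrable.of_bound hφ.aestronglyMeasurable C ?_
  filter_upwards [ae_mem_frontier Ω] with y hy using hC y hy

/-- The boundary splits by the sign of `nᵢ` into an upper and a lower graph; the part with `nᵢ = 0`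
contributes nothing. -/
theorem integral_mul_normal {Ω : Set E3} (hΩ : IsConvexC2Domain Ω) (i : Fin 3) {φ : E3 → ℝ}
    (hφ : Continuous φ) : ∫ y, φ y * outwardNormal Ω y i ∂(surfaceMeasure Ω) =
      (∫ z in dropCoord i '' Ω, φ (boundarySection Ω i 1 z)) -
        ∫ z in dropCoord i '' Ω, φ (boundarySection Ω i (-1) z) := by
  rw [← hΩ.setIntegral_normal_pos i (by norm_num) hφ, ← hΩ.setIntegral_normal_pos i (by norm_num) hφ]
  have hm := hΩ.measurableSet_normal_pos i
  rw [← integral_indicator (hm 1), ← integral_indicator (hm (-1)), ← integral_sub]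
  · refine integral_congr_ae ?_
    filter_upwards [ae_mem_frontier Ω] with y hy
    simp only [indicator, mem_ofPred_eq, hy, true_and, one_mul, neg_mul, Left.neg_pos_iff]
    rcases lt_trichotomy (outwardNormal Ω y i) 0 with h | h | h
    · rw [if_neg h.not_gt, if_pos h, abs_of_neg h]; ring
    · simp [h]
    · rw [if_pos h, if_neg h.not_gt, abs_of_pos h]; ring
  all_goals
    refine Integrable.indicator ?_ (hm _)
    refine (hΩ.integrable_mul_normal i (hφ.integrable_surfaceMeasure hΩ)).mono
      (((continuous_abs.measurable.comp_aemeasurable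
        (hΩ.aemeasurable_outwardNormal i)).aestronglyMeasurable).mul hφ.aestronglyMeasurable) ?_
    exact Eventually.of_forall fun y => by simp [mul_comm]

/-- Gauss–Green formula for a bounded convex domain with `C²` boundary. -/
theorem integral_fderiv_unitVec {Ω : Set E3} (hΩ : IsConvexC2Domain Ω) (i : Fin 3) {φ : E3 → ℝ}
    (hφ : ContDiff ℝ 1 φ) : ∫ x in Ω, fderiv ℝ φ x (unitVec i) =
      ∫ y, φ y * outwardNormal Ω y i ∂(surfaceMeasure Ω) := by
  have hD := (hΩ.isOpen.dropCoord_image i).measurableSet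
  have hvol : volume (dropCoord i '' Ω) < ⊤ :=
    ((dropCoord i).lipschitz.isBounded_image hΩ.bounded).measure_lt_top
  have hc : Continuous fun x => fderiv ℝ φ x (unitVec i) :=
    (hφ.continuous_fderiv (by norm_num)).clm_apply continuous_const
  have hint : IntegrableOn (fun x => fderiv ℝ φ x (unitVec i)) Ω :=
    (hc.continuousOn.integrableOn_compact hΩ.isCompact_closure).mono_set subset_closure
  have hsecint : ∀ s : ℝ, s ^ 2 = 1 →
      IntegrableOn (fun z => φ (boundarySection Ω i s z)) (dropCoord i '' Ω) := by
    intro s hs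
    obtain ⟨C, hC⟩ := hΩ.isCompact_frontier.exists_bound_of_continuousOn hφ.continuous.continuousOn
    refine IntegrableOn.of_bound hvol
      (hφ.continuous.measurable.comp (hΩ.measurable_boundarySection i hs)).aestronglyMeasurable C ?_
    filter_upwards [ae_restrict_mem hD] with z hz
    exact hC _ (hΩ.boundarySection_mem_frontier hs hz)
  rw [hΩ.integral_mul_normal i hφ.continuous, ← integral_sub (hsecint 1 (by norm_num))
    (hsecint (-1) (by norm_num)), ← integral_indicator hΩ.isOpen.measurableSet,
    ← (measurePreserving_splitCoord i).symm.integral_comp (splitCoord i).symm.measurableEmbedding]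
  have hint' := (integrable_indicator_iff hΩ.isOpen.measurableSet).2 hint
  have hint2 := (measurePreserving_splitCoord i).symm.integrable_comp_of_integrable hint'
  rw [Measure.volume_eq_prod] at hint2 ⊢
  rw [← integral_indicator hD]
  -- By Fubini it remains to integrate `∂ᵢφ` along each line in the direction `eᵢ`. The line meets
  -- `Ω` in an interval whose ends are the two boundary sections, and the fundamental theorem of
  -- calculus applies.
  refine (integral_prod_symm _ hint2).trans ?_
  refine integral_congr_ae (Eventually.of_forall fun z => ?_)
  have hsymm : ∀ t, (splitCoord i).symm (t, z) = insertCoord i z t := fun t => rfl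
  simp only [Function.comp_apply, hsymm]
  have hind : (fun t => Ω.indicator (fun x => fderiv ℝ φ x (unitVec i)) (insertCoord i z t)) =
      {t | insertCoord i z t ∈ Ω}.indicator
        (fun t => fderiv ℝ φ (insertCoord i z t) (unitVec i)) := by
    ext t; rfl
  by_cases hz : z ∈ dropCoord i '' Ω
  · have hsl := hΩ.slice_eq_Ioo hz
    obtain ⟨t, ht⟩ := mem_dropCoord_image.1 hz
    have htI : t ∈ {t | insertCoord i z t ∈ Ω} := ht
    rw [hsl] at htI
    rw [indicator_of_mem hz, hind, hsl, integral_indicator measurableSet_Ioo,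
      ← integral_Ioc_eq_integral_Ioo, ← intervalIntegral.integral_of_le (htI.1.trans htI.2).le,
      boundarySection, boundarySection, one_mul, neg_one_mul]
    refine intervalIntegral.integral_eq_sub_of_hasDerivAt (f := fun t => φ (insertCoord i z t))
      (fun t _ => ?_) ?_
    · have hl : HasDerivAt (fun t => insertCoord i z t) (unitVec i) t := by
        have : (fun t => insertCoord i z t) = fun t => insertCoord i z 0 + t • unitVec i := by
          ext1 t; rw [insertCoord_eq_add i z t 0, sub_zero]
        rw [this]
        simpa using ((hasDerivAt_id t).smul_const (unitVec i)).const_add (insertCoord i z 0)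
      exact (hφ.differentiable (by norm_num) _).hasFDerivAt.comp_hasDerivAt t hl
    · refine (hc.comp ?_).intervalIntegrable _ _
      simpa using continuous_insertCoord_mul i 1 z
  · rw [indicator_of_notMem hz, hind]
    have : {t | insertCoord i z t ∈ Ω} = ∅ := by
      ext t
      simp only [mem_ofPred_eq, mem_empty_iff_false, iff_false]
      exact fun h => hz (mem_dropCoord_image.2 ⟨_, h⟩)
    rw [this]
    simp

end IsConvexC2Domain

/-! ### Convergence in `L²` and Green's formula for traces -/

theorem tendsto_integral_mul_of_tendsto_eLpNorm {α : Type*} [MeasurableSpace α] {μ : Measure α}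
    {f g : ℕ → α → ℝ} {f₀ g₀ : α → ℝ} (hf : ∀ n, MemLp (f n) 2 μ) (hg : ∀ n, MemLp (g n) 2 μ)
    (hf₀ : MemLp f₀ 2 μ) (hg₀ : MemLp g₀ 2 μ)
    (hfl : Tendsto (fun n => eLpNorm (fun x => f n x - f₀ x) 2 μ) atTop (𝓝 0))
    (hgl : Tendsto (fun n => eLpNorm (fun x => g n x - g₀ x) 2 μ) atTop (𝓝 0)) :
    Tendsto (fun n => ∫ x, f n x * g n x ∂μ) atTop (𝓝 (∫ x, f₀ x * g₀ x ∂μ)) := by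
  have h1 := (Lp.tendsto_Lp_iff_tendsto_eLpNorm'' f hf f₀ hf₀).2 hfl
  have h2 := (Lp.tendsto_Lp_iff_tendsto_eLpNorm'' g hg g₀ hg₀).2 hgl
  have key : ∀ {a b : α → ℝ} (ha : MemLp a 2 μ) (hb : MemLp b 2 μ),
      ⟪ha.toLp, hb.toLp⟫ = ∫ x, a x * b x ∂μ := by
    intro a b ha hb
    rw [L2.inner_def]
    refine integral_congr_ae ?_
    filter_upwards [ha.coeFn_toLp, hb.coeFn_toLp] with x hx hy
    rw [hx, hy, RCLike.inner_apply, conj_trivial, mul_comm]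
  have := h1.inner (𝕜 := ℝ) h2
  simpa only [key] using this

theorem tendsto_eLpNorm_two_zero_of_dominated {α : Type*} [MeasurableSpace α] {μ : Measure α}
    {F : ℕ → α → ℝ} {G : α → ℝ} (hF : ∀ n, AEStronglyMeasurable (F n) μ) (hG : MemLp G 2 μ)
    (hb : ∀ n, ∀ᵐ x ∂μ, ‖F n x‖ ≤ ‖G x‖) (hl : ∀ᵐ x ∂μ, Tendsto (fun n => F n x) atTop (𝓝 0)) :
    Tendsto (fun n => eLpNorm (F n) 2 μ) atTop (𝓝 0) := by
  have h : Tendsto (fun n => ∫⁻ x, ‖F n x‖ₑ ^ (2 : ℝ) ∂μ) atTop (𝓝 (∫⁻ _x, 0 ∂μ)) := by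
    refine tendsto_lintegral_of_dominated_convergence' (fun x => ‖G x‖ₑ ^ (2 : ℝ))
      (fun n => (hF n).enorm.pow_const _) (fun n => ?_) ?_ ?_
    · filter_upwards [hb n] with x hx
      exact ENNReal.rpow_le_rpow (enorm_le_iff_norm_le.2 hx) (by norm_num)
    · exact (lintegral_rpow_enorm_lt_top_of_eLpNorm_lt_top (p := 2) (by norm_num) (by norm_num)
        hG.2).ne
    · filter_upwards [hl] with x hx
      have := (ENNReal.continuous_rpow_const (y := 2)).continuousAt.tendsto.comp hx.enorm
      simpa [Function.comp_def] using this
  rw [lintegral_zero] at h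
  have h2 := (ENNReal.continuous_rpow_const (y := 1 / 2)).continuousAt.tendsto.comp h
  simp only [ENNReal.zero_rpow_of_pos (show (0 : ℝ) < 1 / 2 by norm_num)] at h2
  refine h2.congr fun n => ?_
  rw [eLpNorm_eq_lintegral_rpow_enorm_toReal (by norm_num) (by norm_num)]
  simp

/-- The difference splits as `bₙ (fₙ - f₀) + (bₙ - b₀) f₀`: the first part is controlled by the
uniform bound on `bₙ`, the second by dominated convergence. It serves for `Φ'(φₖ) ∂ᵢφₖ`, where `Φ'`
is merely bounded and continuous. -/
theorem tendsto_eLpNorm_mul_sub_mul {α : Type*} [MeasurableSpace α] {μ : Measure α}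
    {b f : ℕ → α → ℝ} {b₀ f₀ : α → ℝ} {K : ℝ} (hb : ∀ n, AEStronglyMeasurable (b n) μ)
    (hbK : ∀ n x, ‖b n x‖ ≤ K) (hb₀ : AEStronglyMeasurable b₀ μ) (hb₀K : ∀ x, ‖b₀ x‖ ≤ K)
    (hbl : ∀ᵐ x ∂μ, Tendsto (fun n => b n x) atTop (𝓝 (b₀ x)))
    (hf : ∀ n, MemLp (f n) 2 μ) (hf₀ : MemLp f₀ 2 μ)
    (hfl : Tendsto (fun n => eLpNorm (fun x => f n x - f₀ x) 2 μ) atTop (𝓝 0)) :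
    Tendsto (fun n => eLpNorm (fun x => b n x * f n x - b₀ x * f₀ x) 2 μ) atTop (𝓝 0) := by
  have h1 : Tendsto (fun n => eLpNorm (fun x => b n x * (f n x - f₀ x)) 2 μ) atTop (𝓝 0) := by
    refine tendsto_of_tendsto_of_tendsto_of_le_of_le tendsto_const_nhds
      (h := fun n => ENNReal.ofReal K * eLpNorm (fun x => f n x - f₀ x) 2 μ) ?_
      (fun _ => zero_le) (fun n => ?_)
    · simpa using ENNReal.Tendsto.const_mul hfl (Or.inr (by simp))
    · refine eLpNorm_le_mul_eLpNorm_of_ae_le_mul (Eventually.of_forall fun x => ?_) 2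
      rw [norm_mul]; gcongr; exact hbK n x
  have h2 : Tendsto (fun n => eLpNorm (fun x => (b n x - b₀ x) * f₀ x) 2 μ) atTop (𝓝 0) := by
    refine tendsto_eLpNorm_two_zero_of_dominated (G := fun x => (2 * K) * f₀ x)
      (fun n => ((hb n).sub hb₀).mul hf₀.1) (hf₀.const_mul _) (fun n => ?_) ?_
    · refine Eventually.of_forall fun x => ?_
      rw [norm_mul, norm_mul]
      gcongr
      have := norm_sub_le (b n x) (b₀ x)
      have h3 := hbK n x
      have h4 := hb₀K x
      exact (by linarith : ‖b n x - b₀ x‖ ≤ 2 * K).trans (le_abs_self _)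
    · filter_upwards [hbl] with x hx
      have := (hx.sub_const (b₀ x)).mul_const (f₀ x)
      simpa using this
  refine tendsto_of_tendsto_of_tendsto_of_le_of_le tendsto_const_nhds
    (by simpa using h1.add h2) (fun _ => zero_le) (fun n => ?_)
  have e : (fun x => b n x * f n x - b₀ x * f₀ x) =
      (fun x => b n x * (f n x - f₀ x)) + fun x => (b n x - b₀ x) * f₀ x := by
    ext x; simp only [Pi.add_apply]; ring
  rw [e]
  exact eLpNorm_add_le ((hb n).mul ((hf n).1.sub hf₀.1)) (((hb n).sub hb₀).mul hf₀.1) (by norm_num)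

theorem tendsto_eLpNorm_comp_sub_comp {α : Type*} [MeasurableSpace α] {μ : Measure α}
    {f : ℕ → α → ℝ} {f₀ : α → ℝ} {K : ℝ} {Φ : ℝ → ℝ} (hΦ : ∀ x y, |Φ x - Φ y| ≤ K * |x - y|)
    (hfl : Tendsto (fun n => eLpNorm (fun x => f n x - f₀ x) 2 μ) atTop (𝓝 0)) :
    Tendsto (fun n => eLpNorm (fun x => Φ (f n x) - Φ (f₀ x)) 2 μ) atTop (𝓝 0) := by
  refine tendsto_of_tendsto_of_tendsto_of_le_of_le tendsto_const_nhds
    (h := fun n => ENNReal.ofReal K * eLpNorm (fun x => f n x - f₀ x) 2 μ) ?_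
    (fun _ => zero_le) (fun n => ?_)
  · simpa using ENNReal.Tendsto.const_mul hfl (Or.inr (by simp))
  · exact eLpNorm_le_mul_eLpNorm_of_ae_le_mul (Eventually.of_forall fun x => hΦ _ _) 2

theorem abs_sub_le_of_abs_deriv_le {Φ Φ' : ℝ → ℝ} {K : ℝ} (hΦ : ∀ s, HasDerivAt Φ (Φ' s) s)
    (hK : ∀ s, |Φ' s| ≤ K) (x y : ℝ) : |Φ x - Φ y| ≤ K * |x - y| := by
  have := Convex.norm_image_sub_le_of_norm_hasDerivWithin_le (f := Φ) (f' := Φ') (s := univ)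
    (x := y) (y := x) (C := K) (fun s _ => (hΦ s).hasDerivWithinAt) (fun s _ => hK s)
    convex_univ trivial trivial
  simpa using this

theorem MeasureTheory.MemLp.comp_of_abs_deriv_le {α : Type*} [MeasurableSpace α] {μ : Measure α}
    {f : α → ℝ} {Φ Φ' : ℝ → ℝ} {K : ℝ} (hf : MemLp f 2 μ) (hΦ : ∀ s, HasDerivAt Φ (Φ' s) s)
    (hK : ∀ s, |Φ' s| ≤ K) (h0 : Φ 0 = 0) : MemLp (fun x => Φ (f x)) 2 μ := by
  have hc : Continuous Φ := continuous_iff_continuousAt.2 fun s => (hΦ s).continuousAt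
  refine hf.of_le_mul (c := K) (hc.comp_aestronglyMeasurable hf.1) (Eventually.of_forall fun x => ?_)
  simpa [h0] using abs_sub_le_of_abs_deriv_le hΦ hK (f x) 0

/-- The functions `φₖ` of class `C¹` converge to `u`, with gradient `Du`, in `H¹(Ω)`, and to `w` in
`L²(∂Ω)`. -/
structure IsTraceApprox (Ω : Set E3) (u w : E3 → ℝ) (Du : Fin 3 → E3 → ℝ) (φ : ℕ → E3 → ℝ) :
    Prop where
  memLp : MemLp u 2 (volume.restrict Ω)
  memLp_grad : ∀ i, MemLp (Du i) 2 (volume.restrict Ω)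
  memLp_trace : MemLp w 2 (surfaceMeasure Ω)
  contDiff : ∀ k, ContDiff ℝ 1 (φ k)
  tendsto : Tendsto (fun k => eLpNorm (fun x => φ k x - u x) 2 (volume.restrict Ω)) atTop (𝓝 0)
  tendsto_grad : ∀ i, Tendsto (fun k => eLpNorm (fun x => fderiv ℝ (φ k) x (unitVec i) - Du i x) 2
      (volume.restrict Ω)) atTop (𝓝 0)
  tendsto_trace : Tendsto (fun k => eLpNorm (fun x => φ k x - w x) 2 (surfaceMeasure Ω)) atTop (𝓝 0)

theorem HasTrace.exists_isTraceApprox {Ω : Set E3} {u w : E3 → ℝ} (h : HasTrace Ω u w) :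
    ∃ Du φ, HasH1Gradient Ω u Du ∧ IsTraceApprox Ω u w Du φ := by
  obtain ⟨hw, Du, φ, h1, h2, h3, h4, h5⟩ := h
  exact ⟨Du, φ, h1, h1.memLp, h1.memLp_grad, hw, h2, h3, h4, h5⟩

theorem IsTraceApprox.comp_strictMono {Ω : Set E3} {u w : E3 → ℝ} {Du : Fin 3 → E3 → ℝ}
    {φ : ℕ → E3 → ℝ} (h : IsTraceApprox Ω u w Du φ) {n : ℕ → ℕ} (hn : StrictMono n) :
    IsTraceApprox Ω u w Du (fun k => φ (n k)) :=
  ⟨h.memLp, h.memLp_grad, h.memLp_trace, fun k => h.contDiff (n k), h.tendsto.comp hn.tendsto_atTop,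
    fun i => (h.tendsto_grad i).comp hn.tendsto_atTop, h.tendsto_trace.comp hn.tendsto_atTop⟩

namespace IsConvexC2Domain

theorem isFiniteMeasure_restrict {Ω : Set E3} (hΩ : IsConvexC2Domain Ω) :
    IsFiniteMeasure (volume.restrict Ω) :=
  ⟨by rw [Measure.restrict_apply_univ]; exact hΩ.bounded.measure_lt_top⟩

theorem memLp_of_continuous {Ω : Set E3} (hΩ : IsConvexC2Domain Ω) {φ : E3 → ℝ}
    (hφ : Continuous φ) (p : ℝ≥0∞) : MemLp φ p (volume.restrict Ω) := by
  have := hΩ.isFiniteMeasure_restrict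
  obtain ⟨C, hC⟩ := hΩ.isCompact_closure.exists_bound_of_continuousOn hφ.continuousOn
  refine MemLp.of_bound hφ.aestronglyMeasurable C ?_
  filter_upwards [ae_restrict_mem hΩ.isOpen.measurableSet] with y hy using hC y (subset_closure hy)

theorem memLp_surfaceMeasure_of_continuous {Ω : Set E3} (hΩ : IsConvexC2Domain Ω) {φ : E3 → ℝ}
    (hφ : Continuous φ) (p : ℝ≥0∞) : MemLp φ p (surfaceMeasure Ω) := by
  have := hΩ.isFiniteMeasure_surfaceMeasure
  obtain ⟨C, hC⟩ := hΩ.isCompact_frontier.exists_bound_of_continuousOn hφ.continuousOn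
  refine MemLp.of_bound hφ.aestronglyMeasurable C ?_
  filter_upwards [ae_mem_frontier Ω] with y hy using hC y hy

theorem isTraceApprox_of_contDiff {Ω : Set E3} (hΩ : IsConvexC2Domain Ω) {φ : E3 → ℝ}
    (hφ : ContDiff ℝ 1 φ) :
    IsTraceApprox Ω φ φ (fun i x => fderiv ℝ φ x (unitVec i)) (fun _ => φ) where
  memLp := hΩ.memLp_of_continuous hφ.continuous 2
  memLp_grad i := hΩ.memLp_of_continuous
    ((hφ.continuous_fderiv (by norm_num)).clm_apply continuous_const) 2
  memLp_trace := hΩ.memLp_surfaceMeasure_of_continuous hφ.continuous 2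
  contDiff _ := hφ
  tendsto := by simp
  tendsto_grad := by simp
  tendsto_trace := by simp

/-- Green's formula for functions of class `H¹` with traces. -/
theorem integral_green {Ω : Set E3} (hΩ : IsConvexC2Domain Ω) {u w ψ v : E3 → ℝ}
    {Du Dψ : Fin 3 → E3 → ℝ} {φ χ : ℕ → E3 → ℝ} (hu : IsTraceApprox Ω u w Du φ)
    (hψ : IsTraceApprox Ω ψ v Dψ χ) {Φ Φ' : ℝ → ℝ} {K : ℝ} (hΦ : ∀ s, HasDerivAt Φ (Φ' s) s)
    (hΦc : Continuous Φ') (hK : ∀ s, |Φ' s| ≤ K) (h0 : Φ 0 = 0) (i : Fin 3) :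
    (∫ x in Ω, Dψ i x * Φ (u x)) + ∫ x in Ω, ψ x * (Φ' (u x) * Du i x) =
      ∫ y, v y * (Φ (w y) * outwardNormal Ω y i) ∂(surfaceMeasure Ω) := by
  -- The factor `Φ'(φₖ)` converges only where `φₖ` does, so almost everywhere convergence is
  -- arranged along a subsequence.
  obtain ⟨n, hn, hae⟩ := (tendstoInMeasure_of_tendsto_eLpNorm (by norm_num : (2 : ℝ≥0∞) ≠ 0)
    (fun k => (hu.contDiff k).continuous.aestronglyMeasurable) hu.memLp.1
    hu.tendsto).exists_seq_tendsto_ae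
  replace hu := hu.comp_strictMono hn
  replace hψ := hψ.comp_strictMono hn
  generalize hφn : (fun k => φ (n k)) = φ₁ at hu
  generalize (fun k => χ (n k)) = χ₁ at hψ
  have hae' : ∀ᵐ x ∂volume.restrict Ω, Tendsto (fun k => φ₁ k x) atTop (𝓝 (u x)) := by
    rw [← hφn]; exact hae
  have hΦcont : Continuous Φ := continuous_iff_continuousAt.2 fun s => (hΦ s).continuousAt
  have hΦ1 : ContDiff ℝ 1 Φ := by
    rw [contDiff_one_iff_deriv]
    refine ⟨fun s => (hΦ s).differentiableAt, ?_⟩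
    rwa [show deriv Φ = Φ' from funext fun s => (hΦ s).deriv]
  have hgradc : ∀ {f : E3 → ℝ}, ContDiff ℝ 1 f → Continuous fun x => fderiv ℝ f x (unitVec i) :=
    fun hf => (hf.continuous_fderiv (by norm_num)).clm_apply continuous_const
  have hsmooth : ∀ k, (∫ x in Ω, fderiv ℝ (χ₁ k) x (unitVec i) * Φ (φ₁ k x)) +
      ∫ x in Ω, χ₁ k x * (Φ' (φ₁ k x) * fderiv ℝ (φ₁ k) x (unitVec i)) =
      ∫ y, χ₁ k y * (Φ (φ₁ k y) * outwardNormal Ω y i) ∂(surfaceMeasure Ω) := by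
    intro k
    have hχ := hψ.contDiff k
    have hφ := hu.contDiff k
    have h1 := hΩ.integral_fderiv_unitVec i (hχ.mul (hΦ1.comp hφ))
    simp only [Function.comp_def, mul_assoc] at h1
    rw [← h1, ← integral_add]
    · refine integral_congr_ae (Eventually.of_forall fun x => ?_)
      have hd1 := (hχ.differentiable (by norm_num) x).hasFDerivAt
      have hd2 := (hΦ (φ₁ k x)).comp_hasFDerivAt x (hφ.differentiable (by norm_num) x).hasFDerivAt
      have := (hd1.mul hd2).fderiv
      simp only [Function.comp_def] at this
      change _ = fderiv ℝ (fun x => χ₁ k x * Φ (φ₁ k x)) x (unitVec i)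
      rw [show (fun x => χ₁ k x * Φ (φ₁ k x)) = (χ₁ k * fun x => Φ (φ₁ k x)) from rfl, this]
      simp only [_root_.add_apply, _root_.smul_apply, smul_eq_mul]
      ring
    · exact memLp_one_iff_integrable.1 (hΩ.memLp_of_continuous
        ((hgradc hχ).mul (hΦcont.comp hφ.continuous)) 1)
    · exact memLp_one_iff_integrable.1 (hΩ.memLp_of_continuous
        (hχ.continuous.mul ((hΦc.comp hφ.continuous).mul (hgradc hφ))) 1)
  have hLip := abs_sub_le_of_abs_deriv_le hΦ hK
  have l1 : Tendsto (fun k => ∫ x in Ω, fderiv ℝ (χ₁ k) x (unitVec i) * Φ (φ₁ k x)) atTop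
      (𝓝 (∫ x in Ω, Dψ i x * Φ (u x))) :=
    tendsto_integral_mul_of_tendsto_eLpNorm
      (fun k => hΩ.memLp_of_continuous (hgradc (hψ.contDiff k)) 2)
      (fun k => hΩ.memLp_of_continuous (hΦcont.comp (hu.contDiff k).continuous) 2)
      (hψ.memLp_grad i) (hu.memLp.comp_of_abs_deriv_le hΦ hK h0) (hψ.tendsto_grad i)
      (tendsto_eLpNorm_comp_sub_comp hLip hu.tendsto)
  have l2 : Tendsto (fun k => ∫ x in Ω, χ₁ k x * (Φ' (φ₁ k x) * fderiv ℝ (φ₁ k) x (unitVec i)))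
      atTop (𝓝 (∫ x in Ω, ψ x * (Φ' (u x) * Du i x))) := by
    refine tendsto_integral_mul_of_tendsto_eLpNorm
      (fun k => hΩ.memLp_of_continuous (hψ.contDiff k).continuous 2)
      (fun k => hΩ.memLp_of_continuous
        ((hΦc.comp (hu.contDiff k).continuous).mul (hgradc (hu.contDiff k))) 2)
      hψ.memLp ?_ hψ.tendsto ?_
    · exact (hu.memLp_grad i).of_le_mul (c := K)
        ((hΦc.comp_aestronglyMeasurable hu.memLp.1).mul (hu.memLp_grad i).1)
        (Eventually.of_forall fun x => by rw [norm_mul]; gcongr; exact hK _)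
    · refine tendsto_eLpNorm_mul_sub_mul
        (fun k => (hΦc.comp (hu.contDiff k).continuous).aestronglyMeasurable) (fun k x => hK _)
        (hΦc.comp_aestronglyMeasurable hu.memLp.1) (fun x => hK _) ?_
        (fun k => hΩ.memLp_of_continuous (hgradc (hu.contDiff k)) 2) (hu.memLp_grad i)
        (hu.tendsto_grad i)
      filter_upwards [hae'] with x hx
      exact (hΦc.tendsto _).comp hx
  have hnb : ∀ᵐ y ∂surfaceMeasure Ω, ‖outwardNormal Ω y i‖ ≤ 1 := by
    filter_upwards [ae_mem_frontier Ω] with y hy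
    exact hΩ.norm_outwardNormal hy ▸ PiLp.norm_apply_le _ i
  have hnm := (hΩ.aemeasurable_outwardNormal i).aestronglyMeasurable
  have hmulmem : ∀ {f : E3 → ℝ}, MemLp f 2 (surfaceMeasure Ω) →
      MemLp (fun y => f y * outwardNormal Ω y i) 2 (surfaceMeasure Ω) := by
    intro f hf
    refine hf.mono (hf.1.mul hnm) ?_
    filter_upwards [hnb] with y hy
    rw [norm_mul]
    exact mul_le_of_le_one_right (norm_nonneg _) hy
  have l3 : Tendsto (fun k => ∫ y, χ₁ k y * (Φ (φ₁ k y) * outwardNormal Ω y i)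
      ∂(surfaceMeasure Ω)) atTop
      (𝓝 (∫ y, v y * (Φ (w y) * outwardNormal Ω y i) ∂(surfaceMeasure Ω))) := by
    refine tendsto_integral_mul_of_tendsto_eLpNorm
      (fun k => hΩ.memLp_surfaceMeasure_of_continuous (hψ.contDiff k).continuous 2)
      (fun k => hmulmem (hΩ.memLp_surfaceMeasure_of_continuous
        (hΦcont.comp (hu.contDiff k).continuous) 2))
      hψ.memLp_trace (hmulmem (hu.memLp_trace.comp_of_abs_deriv_le hΦ hK h0)) hψ.tendsto_trace ?_
    refine tendsto_of_tendsto_of_tendsto_of_le_of_le tendsto_const_nhds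
      (tendsto_eLpNorm_comp_sub_comp hLip hu.tendsto_trace) (fun _ => zero_le) (fun k => ?_)
    refine eLpNorm_mono_ae ?_
    filter_upwards [hnb] with y hy
    rw [← sub_mul, norm_mul]
    exact mul_le_of_le_one_right (norm_nonneg _) hy
  exact tendsto_nhds_unique (l1.add l2) (l3.congr fun k => (hsmooth k).symm)

end IsConvexC2Domain

/-! ### Test functions and weak derivatives in one variable -/

/-- Smooth functions with compact support in `U`. -/
structure IsTestFunction {V : Type*} [NormedAddCommGroup V] [NormedSpace ℝ V] (U : Set V)
    (φ : V → ℝ) : Prop where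
  contDiff : ContDiff ℝ ∞ φ
  hasCompactSupport : HasCompactSupport φ
  tsupport_subset : tsupport φ ⊆ U

section TestFunctions

theorem IsTestFunction.exists_bound {V : Type*} [NormedAddCommGroup V] [NormedSpace ℝ V]
    {U : Set V} {φ : V → ℝ} (hφ : IsTestFunction U φ) : ∃ C, ∀ x, ‖φ x‖ ≤ C :=
  hφ.hasCompactSupport.exists_bound_of_continuous hφ.contDiff.continuous

theorem IsTestFunction.continuous_fderiv {V : Type*} [NormedAddCommGroup V] [NormedSpace ℝ V]
    {U : Set V} {φ : V → ℝ} (hφ : IsTestFunction U φ) (v : V) :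
    Continuous fun x => fderiv ℝ φ x v :=
  (hφ.contDiff.continuous_fderiv (by simp)).clm_apply continuous_const

theorem IsTestFunction.exists_bound_fderiv {V : Type*} [NormedAddCommGroup V] [NormedSpace ℝ V]
    {U : Set V} {φ : V → ℝ} (hφ : IsTestFunction U φ) (v : V) :
    ∃ C, ∀ x, ‖fderiv ℝ φ x v‖ ≤ C :=
  (hφ.hasCompactSupport.fderiv_apply (𝕜 := ℝ) v).exists_bound_of_continuous (hφ.continuous_fderiv v)

theorem IsTestFunction.memLp {V : Type*} [NormedAddCommGroup V] [NormedSpace ℝ V]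
    [FiniteDimensional ℝ V] [MeasurableSpace V] [BorelSpace V] {U : Set V} {φ : V → ℝ}
    (hφ : IsTestFunction U φ) (μ : Measure V) [IsLocallyFiniteMeasure μ] :
    MemLp φ 2 μ :=
  hφ.contDiff.continuous.memLp_of_hasCompactSupport hφ.hasCompactSupport

/-- `L²` is separable, so the test functions contain a countable subset dense among them in `L²`,
and orthogonality passes to the closure. Countability makes it possible to discard one null set of
slices for all test functions at once. -/
theorem exists_countable_testFunctions {V : Type*} [NormedAddCommGroup V] [NormedSpace ℝ V]
    [FiniteDimensional ℝ V] [MeasurableSpace V] [BorelSpace V] (μ : Measure V)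
    [IsLocallyFiniteMeasure μ] {U : Set V} (hU : IsOpen U) :
    ∃ S : Set (V → ℝ), S.Countable ∧ (∀ φ ∈ S, IsTestFunction U φ) ∧
      ∀ f : V → ℝ, MemLp f 2 (μ.restrict U) → (∀ φ ∈ S, ∫ x in U, f x * φ x ∂μ = 0) →
        f =ᵐ[μ.restrict U] 0 := by
  let A : Set (Lp ℝ 2 (μ.restrict U)) := {p | ∃ φ, IsTestFunction U φ ∧ p =ᵐ[μ.restrict U] φ}
  have : Fact ((2 : ℝ≥0∞) ≠ ⊤) := ⟨by norm_num⟩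
  obtain ⟨t, htA, htc, htd⟩ :=
    (TopologicalSpace.IsSeparable.of_separableSpace A).exists_countable_dense_subset
  choose! ψ hψ hψe using htA
  refine ⟨ψ '' t, htc.image _, ?_, ?_⟩
  · rintro _ ⟨p, hp, rfl⟩; exact hψ hp
  intro f hf h
  have key : ∀ (p : Lp ℝ 2 (μ.restrict U)) (φ : V → ℝ), p =ᵐ[μ.restrict U] φ →
      ⟪hf.toLp f, p⟫ = ∫ x in U, f x * φ x ∂μ := by
    intro p φ hp
    rw [L2.inner_def]
    refine integral_congr_ae ?_
    filter_upwards [hf.coeFn_toLp, hp] with x hx hy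
    rw [hx, hy, RCLike.inner_apply, conj_trivial, mul_comm]
  have hzero : ∀ p ∈ A, ⟪hf.toLp f, p⟫ = 0 := by
    have hcl : IsClosed {p : Lp ℝ 2 (μ.restrict U) | ⟪hf.toLp f, p⟫ = 0} :=
      isClosed_eq (by fun_prop) continuous_const
    have hsub : t ⊆ {p : Lp ℝ 2 (μ.restrict U) | ⟪hf.toLp f, p⟫ = 0} := fun p hp => by
      rw [mem_ofPred_eq, key p _ (hψe hp)]
      exact h _ (mem_image_of_mem _ hp)
    exact fun p hp => (hcl.closure_subset_iff.2 hsub) (htd hp)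
  have hloc : LocallyIntegrableOn f U μ :=
    locallyIntegrableOn_of_locallyIntegrable_restrict (hf.locallyIntegrable (by norm_num))
  rw [EventuallyEq, ae_restrict_iff' hU.measurableSet]
  refine hU.ae_eq_zero_of_integral_contDiff_smul_eq_zero hloc fun g hg hgc hgs => ?_
  have hgt : IsTestFunction U g := ⟨hg, hgc, hgs⟩
  have hgm := hgt.memLp (μ.restrict U)
  have h1 := hzero (hgm.toLp g) ⟨g, hgt, hgm.coeFn_toLp⟩
  rw [key _ _ hgm.coeFn_toLp] at h1
  rw [← setIntegral_eq_integral_of_forall_compl_eq_zero (s := U), ← h1]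
  · exact integral_congr_ae (Eventually.of_forall fun x => by simp [mul_comm])
  · intro x hx
    rw [image_eq_zero_of_notMem_tsupport fun h => hx (hgs h), zero_smul]

theorem AbsolutelyContinuousOnInterval.comp_of_abs_deriv_le {f Φ Φ' : ℝ → ℝ} {a b K : ℝ}
    (hf : AbsolutelyContinuousOnInterval f a b) (hΦ : ∀ s, HasDerivAt Φ (Φ' s) s)
    (hK : ∀ s, |Φ' s| ≤ K) : AbsolutelyContinuousOnInterval (fun t => Φ (f t)) a b := by
  refine squeeze_zero (fun E => Finset.sum_nonneg fun _ _ => dist_nonneg) (fun E => ?_)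
    (by simpa using Tendsto.const_mul K hf)
  rw [Finset.mul_sum]
  exact Finset.sum_le_sum fun i _ => abs_sub_le_of_abs_deriv_le hΦ hK _ _

theorem exists_testFunction_integral_eq_one {τ : ℝ} (hτ : 0 < τ) :
    ∃ θ : ℝ → ℝ, IsTestFunction (Ioo 0 τ) θ ∧ ∫ t in Ioo 0 τ, θ t = 1 := by
  let f : ContDiffBump (τ / 2) := ⟨τ / 8, τ / 4, by positivity, by linarith⟩
  have hsub : tsupport (f.normed volume) ⊆ Ioo 0 τ := by
    rw [f.tsupport_normed_eq, Real.closedBall_eq_Icc]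
    intro t ht
    have h1 : f.rOut = τ / 4 := rfl
    rw [h1] at ht
    exact ⟨by linarith [ht.1], by linarith [ht.2]⟩
  refine ⟨f.normed volume, ⟨f.contDiff_normed, f.hasCompactSupport_normed, hsub⟩, ?_⟩
  rw [setIntegral_eq_integral_of_forall_compl_eq_zero, f.integral_normed]
  exact fun x hx => image_eq_zero_of_notMem_tsupport fun h => hx (hsub h)

/-- The primitive starting at `0` vanishes before the support of `θ`, and also after it because the
total integral is zero. -/
theorem IsTestFunction.exists_primitive {τ : ℝ} (hτ : 0 < τ) {θ : ℝ → ℝ}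
    (hθ : IsTestFunction (Ioo 0 τ) θ) (h0 : ∫ t in Ioo 0 τ, θ t = 0) :
    ∃ η, IsTestFunction (Ioo 0 τ) η ∧ ∀ t, HasDerivAt η (θ t) t := by
  have hc := hθ.contDiff.continuous
  obtain ⟨a, b, ha, hb, hab⟩ : ∃ a b, 0 < a ∧ b < τ ∧ tsupport θ ⊆ Icc a b := by
    rcases (tsupport θ).eq_empty_or_nonempty with h | h
    · exact ⟨τ / 2, τ / 2, by linarith, by linarith, by simp [h]⟩
    · have hcomp : IsCompact (tsupport θ) := hθ.hasCompactSupport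
      exact ⟨sInf (tsupport θ), sSup (tsupport θ), (hθ.tsupport_subset (hcomp.sInf_mem h)).1,
        (hθ.tsupport_subset (hcomp.sSup_mem h)).2,
        fun x hx => ⟨csInf_le hcomp.bddBelow hx, le_csSup hcomp.bddAbove hx⟩⟩
  have hz : ∀ t, t ∉ Icc a b → θ t = 0 := fun t ht =>
    image_eq_zero_of_notMem_tsupport fun h => ht (hab h)
  have hd : ∀ t, HasDerivAt (fun t => ∫ s in (0 : ℝ)..t, θ s) (θ t) t := fun t =>
    intervalIntegral.integral_hasDerivAt_right (hc.intervalIntegrable _ _)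
      hc.stronglyMeasurable.stronglyMeasurableAtFilter hc.continuousAt
  have hsupp : ∀ t, t ∉ Icc a b → ∫ s in (0 : ℝ)..t, θ s = 0 := by
    intro t ht
    rw [mem_Icc, not_and_or, not_le, not_le] at ht
    rcases ht with ht | ht
    · refine (intervalIntegral.integral_congr fun s hs => ?_).trans
        (intervalIntegral.integral_zero (a := 0) (b := t))
      refine hz s fun h => ?_
      have := hs.2
      have h3 : max 0 t < a := max_lt ha ht
      linarith [h.1]
    · have h1 : ∫ s in (0 : ℝ)..τ, θ s = 0 := by
        rw [intervalIntegral.integral_of_le hτ.le, integral_Ioc_eq_integral_Ioo, h0]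
      rw [← intervalIntegral.integral_add_adjacent_intervals (hc.intervalIntegrable 0 τ)
        (hc.intervalIntegrable τ t), h1, zero_add]
      refine (intervalIntegral.integral_congr fun s hs => ?_).trans
        (intervalIntegral.integral_zero (a := τ) (b := t))
      refine hz s fun h => ?_
      have := hs.1
      have h3 : b < min τ t := lt_min hb ht
      linarith [h.2]
  refine ⟨fun t => ∫ s in (0 : ℝ)..t, θ s, ⟨?_, ?_, ?_⟩, hd⟩
  · rw [contDiff_infty_iff_deriv]
    refine ⟨fun t => (hd t).differentiableAt, ?_⟩
    rw [show deriv (fun t => ∫ s in (0 : ℝ)..t, θ s) = θ from funext fun t => (hd t).deriv]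
    exact hθ.contDiff
  · exact HasCompactSupport.intro isCompact_Icc hsupp
  · refine (closure_minimal (fun t ht => ?_) isClosed_Icc).trans
      (Icc_subset_Ioo ha hb : Icc a b ⊆ Ioo 0 τ)
    by_contra h
    exact ht (hsupp t h)

/-- The du Bois-Reymond lemma with countably many test functions. For `θ` in a countable determining
family, `θ - (∫ θ) θ₀` has mean zero and hence a primitive `η` that is a test function. Testing with
these `η` shows that `f` minus the primitive of `f'` is constant. -/
theorem exists_countable_testFunctions_primitive {τ : ℝ} (hτ : 0 < τ) :
    ∃ S : Set (ℝ → ℝ), S.Countable ∧ (∀ η ∈ S, IsTestFunction (Ioo 0 τ) η) ∧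
      ∀ f f' : ℝ → ℝ, MemLp f 2 (volume.restrict (Ioo 0 τ)) →
        MemLp f' 2 (volume.restrict (Ioo 0 τ)) →
        (∀ η ∈ S, ∫ t in Ioo 0 τ, f t * deriv η t = -∫ t in Ioo 0 τ, f' t * η t) →
        ∃ c, ∀ᵐ t ∂(volume.restrict (Ioo 0 τ)), f t = c + ∫ s in (0 : ℝ)..t, f' s := by
  obtain ⟨S, hSc, hS, hSd⟩ := exists_countable_testFunctions (volume : Measure ℝ)
    (isOpen_Ioo (a := 0) (b := τ))
  obtain ⟨θ₀, hθ₀, hθ₀1⟩ := exists_testFunction_integral_eq_one hτ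
  have hint : ∀ {θ : ℝ → ℝ}, IsTestFunction (Ioo 0 τ) θ → IntegrableOn θ (Ioo 0 τ) := fun hθ =>
    (hθ.memLp (volume.restrict (Ioo 0 τ))).integrable (by norm_num)
  have hprim : ∀ θ ∈ S, ∃ η, IsTestFunction (Ioo 0 τ) η ∧
      ∀ t, HasDerivAt η (θ t - (∫ r in Ioo 0 τ, θ r) * θ₀ t) t := by
    intro θ hθ
    refine IsTestFunction.exists_primitive hτ
      (θ := fun t => θ t - (∫ r in Ioo 0 τ, θ r) * θ₀ t) ⟨?_, ?_, ?_⟩ ?_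
    · exact (hS θ hθ).contDiff.sub (contDiff_const.mul hθ₀.contDiff)
    · exact (hS θ hθ).hasCompactSupport.sub hθ₀.hasCompactSupport.mul_left
    · refine (tsupport_sub _ _).trans (union_subset (hS θ hθ).tsupport_subset ?_)
      exact (tsupport_mul_subset_right).trans hθ₀.tsupport_subset
    · rw [integral_sub (hint (hS θ hθ)) ((hint hθ₀).const_mul _), integral_const_mul, hθ₀1,
        mul_one, sub_self]
  choose! N hN hNd using hprim
  refine ⟨N '' S, hSc.image _, ?_, ?_⟩
  · rintro _ ⟨θ, hθ, rfl⟩; exact hN θ hθ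
  intro f f' hf hf' h
  have hf'i : IntervalIntegrable f' volume 0 τ := by
    rw [intervalIntegrable_iff_integrableOn_Ioo_of_le hτ.le]
    exact hf'.integrable (by norm_num)
  set P : ℝ → ℝ := fun t => ∫ s in (0 : ℝ)..t, f' s with hP
  have hPac : AbsolutelyContinuousOnInterval P 0 τ :=
    hf'i.absolutelyContinuousOnInterval_intervalIntegral (by simp)
  have hPm : MemLp P 2 (volume.restrict (Ioo 0 τ)) := by
    have hcont := hPac.continuousOn
    rw [uIcc_of_le hτ.le] at hcont
    obtain ⟨C, hC⟩ := isCompact_Icc.exists_bound_of_continuousOn hcont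
    refine MemLp.of_bound ((hcont.mono Ioo_subset_Icc_self).aestronglyMeasurable
      measurableSet_Ioo) C ?_
    filter_upwards [ae_restrict_mem measurableSet_Ioo] with t ht using hC t (Ioo_subset_Icc_self ht)
  have hrm : MemLp (fun t => f t - P t) 2 (volume.restrict (Ioo 0 τ)) := hf.sub hPm
  -- The constant must be the mean of `f - P` against `θ₀`, a test function of integral one.
  set c := ∫ t in Ioo 0 τ, (f t - P t) * θ₀ t with hc
  have hmul : ∀ {θ : ℝ → ℝ}, IsTestFunction (Ioo 0 τ) θ → ∀ {u : ℝ → ℝ},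
      MemLp u 2 (volume.restrict (Ioo 0 τ)) → IntegrableOn (fun t => u t * θ t) (Ioo 0 τ) :=
    fun hθ _ hu => hu.integrable_mul (hθ.memLp _)
  have hkey : ∀ θ ∈ S, ∫ t in Ioo 0 τ, (f t - P t - c) * θ t = 0 := by
    intro θ hθ
    have hη := hN θ hθ
    have hηd := hNd θ hθ
    have h1 := h _ (mem_image_of_mem _ hθ)
    have hderiv : deriv (N θ) = fun t => θ t - (∫ r in Ioo 0 τ, θ r) * θ₀ t :=
      funext fun t => (hηd t).deriv
    have hηac : AbsolutelyContinuousOnInterval (N θ) 0 τ :=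
      ContDiffOn.absolutelyContinuousOnInterval
        ((hη.contDiff.of_le (by simp)).contDiffOn)
    have h2 := hPac.integral_mul_deriv_eq_deriv_mul hηac
    have hzero : ∀ t, t ∉ Ioo 0 τ → N θ t = 0 := fun t ht =>
      image_eq_zero_of_notMem_tsupport fun hmem => ht (hη.tsupport_subset hmem)
    rw [hzero τ (by simp), hzero 0 (by simp), mul_zero, mul_zero, sub_zero, zero_sub,
      intervalIntegral.integral_of_le hτ.le, intervalIntegral.integral_of_le hτ.le,
      integral_Ioc_eq_integral_Ioo, integral_Ioc_eq_integral_Ioo] at h2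
    have h3 : ∫ t in Ioo 0 τ, deriv P t * N θ t = ∫ t in Ioo 0 τ, f' t * N θ t := by
      refine integral_congr_ae ?_
      filter_upwards [ae_restrict_mem measurableSet_Ioo,
        ae_restrict_of_ae hf'i.ae_hasDerivAt_integral] with t ht htd
      have := htd (by rw [uIcc_of_le hτ.le]; exact Ioo_subset_Icc_self ht) 0 (by simp)
      rw [this.deriv]
    rw [h3, ← h1, hderiv] at h2
    have hθt := hS θ hθ
    simp only [mul_sub, sub_mul] at h2 ⊢
    have e1 : ∀ u : ℝ → ℝ, (fun t => u t * ((∫ r in Ioo 0 τ, θ r) * θ₀ t)) =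
        fun t => (∫ r in Ioo 0 τ, θ r) * (u t * θ₀ t) := fun u => by ext t; ring
    rw [integral_sub (hmul hθt hPm) (by rw [e1]; exact (hmul hθ₀ hPm).const_mul _),
      integral_sub (hmul hθt hf) (by rw [e1]; exact (hmul hθ₀ hf).const_mul _), e1, e1,
      integral_const_mul, integral_const_mul] at h2
    have hc' : c = (∫ t in Ioo 0 τ, f t * θ₀ t) - ∫ t in Ioo 0 τ, P t * θ₀ t := by
      rw [hc, ← integral_sub (hmul hθ₀ hf) (hmul hθ₀ hPm)]
      simp only [sub_mul]
    rw [integral_sub (f := fun t => f t * θ t - P t * θ t) ((hmul hθt hf).sub (hmul hθt hPm))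
        ((hint hθt).const_mul _),
      integral_sub (hmul hθt hf) (hmul hθt hPm), integral_const_mul, hc']
    linarith
  have := hSd (fun t => f t - P t - c) (hrm.sub (memLp_const c)) hkey
  refine ⟨c, ?_⟩
  filter_upwards [this] with t ht
  simp only [Pi.zero_apply] at ht
  linarith

/-- Chain rule for the composition with a function that is, almost everywhere, a primitive. -/
theorem integral_comp_mul_of_ae_eq_primitive {τ c K : ℝ} (hτ : 0 < τ) {f f' H h : ℝ → ℝ}
    (hf' : IntegrableOn f' (Ioo 0 τ))
    (hf : ∀ᵐ t ∂(volume.restrict (Ioo 0 τ)), f t = c + ∫ s in (0 : ℝ)..t, f' s)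
    (hH : ∀ s, HasDerivAt H (h s) s) (hK : ∀ s, |h s| ≤ K) :
    ∃ r, ∫ t in Ioo 0 τ, h (f t) * f' t = H r - H c := by
  have hf'i : IntervalIntegrable f' volume 0 τ := by
    rwa [intervalIntegrable_iff_integrableOn_Ioo_of_le hτ.le]
  set F : ℝ → ℝ := fun t => c + ∫ s in (0 : ℝ)..t, f' s with hF
  have hFac : AbsolutelyContinuousOnInterval F 0 τ := by
    have := (contDiff_const (c := c) (𝕜 := ℝ) (n := 1)).contDiffOn (s := uIcc 0 τ)
    exact this.absolutelyContinuousOnInterval.add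
      (hf'i.absolutelyContinuousOnInterval_intervalIntegral (by simp))
  have h1 := (hFac.comp_of_abs_deriv_le hH hK).integral_deriv_eq_sub
  have hF0 : F 0 = c := by simp [hF]
  refine ⟨F τ, ?_⟩
  rw [hF0, intervalIntegral.integral_of_le hτ.le, integral_Ioc_eq_integral_Ioo] at h1
  rw [← h1]
  refine integral_congr_ae ?_
  filter_upwards [ae_restrict_mem measurableSet_Ioo, hf,
    ae_restrict_of_ae hf'i.ae_hasDerivAt_integral] with t ht hft htd
  have h2 := (htd (by rw [uIcc_of_le hτ.le]; exact Ioo_subset_Icc_self ht) 0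
    (by simp)).const_add c
  have h3 : HasDerivAt (fun t => H (F t)) (h (F t) * f' t) t := (hH (F t)).comp t h2
  rw [h3.deriv, hft]

end TestFunctions

/-! ### Slices of functions on the space-time cylinder -/

theorem restrict_spaceTimeCylinder (τ : ℝ) (Ω : Set E3) :
    (volume : Measure (ℝ × E3)).restrict (spaceTimeCylinder τ Ω) =
      (volume.restrict (Ioo 0 τ)).prod (volume.restrict Ω) := by
  rw [spaceTimeCylinder, Measure.volume_eq_prod, Measure.prod_restrict]

theorem MeasureTheory.MemLp.ae_memLp_prodMk_left {α β : Type*} [MeasurableSpace α]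
    [MeasurableSpace β] {μ : Measure α} {ν : Measure β} [SFinite μ] [SFinite ν] {u : α × β → ℝ}
    (hu : MemLp u 2 (μ.prod ν)) : ∀ᵐ a ∂μ, MemLp (fun b => u (a, b)) 2 ν := by
  filter_upwards [hu.1.prodMk_left, hu.integrable_sq.prod_right_ae] with a h1 h2
  exact (memLp_two_iff_integrable_sq h1).2 h2

theorem MeasureTheory.MemLp.ae_memLp_prodMk_right {α β : Type*} [MeasurableSpace α]
    [MeasurableSpace β] {μ : Measure α} {ν : Measure β} [SFinite μ] [SFinite ν] {u : α × β → ℝ}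
    (hu : MemLp u 2 (μ.prod ν)) : ∀ᵐ b ∂ν, MemLp (fun a => u (a, b)) 2 μ :=
  (hu.comp_measurePreserving Measure.measurePreserving_swap).ae_memLp_prodMk_left

theorem IsTestFunction.mul_prod {V : Type*} [NormedAddCommGroup V] [NormedSpace ℝ V] {A : Set ℝ}
    {B : Set V} {η : ℝ → ℝ} {φ : V → ℝ} (hη : IsTestFunction A η) (hφ : IsTestFunction B φ) :
    IsTestFunction (A ×ˢ B) fun q : ℝ × V => η q.1 * φ q.2 := by
  have hsub : Function.support (fun q : ℝ × V => η q.1 * φ q.2) ⊆ tsupport η ×ˢ tsupport φ := by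
    intro q hq
    rw [Function.mem_support] at hq
    exact ⟨subset_tsupport _ (left_ne_zero_of_mul hq), subset_tsupport _ (right_ne_zero_of_mul hq)⟩
  have hcomp : IsCompact (tsupport η ×ˢ tsupport φ) :=
    IsCompact.prod hη.hasCompactSupport hφ.hasCompactSupport
  refine ⟨?_, ?_, ?_⟩
  · exact (hη.contDiff.comp contDiff_fst).mul (hφ.contDiff.comp contDiff_snd)
  · exact HasCompactSupport.of_support_subset_isCompact hcomp hsub
  · exact (closure_minimal hsub ((isClosed_tsupport η).prod (isClosed_tsupport φ))).trans
      (prod_mono hη.tsupport_subset hφ.tsupport_subset)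

theorem fderiv_mul_prod {V : Type*} [NormedAddCommGroup V] [NormedSpace ℝ V] {A : Set ℝ}
    {B : Set V} {η : ℝ → ℝ} {φ : V → ℝ} (hη : IsTestFunction A η) (hφ : IsTestFunction B φ)
    (q : ℝ × V) (a : ℝ) (v : V) : fderiv ℝ (fun q : ℝ × V => η q.1 * φ q.2) q (a, v) =
      a * (deriv η q.1 * φ q.2) + η q.1 * fderiv ℝ φ q.2 v := by
  have h1 : HasFDerivAt (fun q : ℝ × V => η q.1) _ q :=
    (hη.contDiff.differentiable (by simp) q.1).hasFDerivAt.comp q hasFDerivAt_fst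
  have h2 : HasFDerivAt (fun q : ℝ × V => φ q.2) _ q :=
    (hφ.contDiff.differentiable (by simp) q.2).hasFDerivAt.comp q hasFDerivAt_snd
  have h3 := (h1.mul h2).fderiv
  rw [show (fun q : ℝ × V => η q.1 * φ q.2) = (fun q : ℝ × V => η q.1) * fun q : ℝ × V => φ q.2
    from rfl, h3]
  simp only [_root_.add_apply, _root_.smul_apply, ContinuousLinearMap.comp_apply,
    ContinuousLinearMap.coe_fst', ContinuousLinearMap.coe_snd', smul_eq_mul]
  rw [fderiv_eq_smul_deriv, smul_eq_mul]
  ring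

section Slices

variable {τ : ℝ} {Ω : Set E3} {u u' : ℝ × E3 → ℝ}

/-- Testing with products `η(t) φ(x)` for all `η` shows that the slicewise defect of integration by
parts against `φ` vanishes for almost every `t`. -/
theorem ae_integral_fderiv_slice (hΩ : IsConvexC2Domain Ω)
    (hu : MemLp u 2 (volume.restrict (spaceTimeCylinder τ Ω)))
    (hu' : MemLp u' 2 (volume.restrict (spaceTimeCylinder τ Ω))) {v : E3}
    (h : HasWeakDeriv (spaceTimeCylinder τ Ω) ((0, v) : ℝ × E3) u u') {φ : E3 → ℝ}
    (hφ : IsTestFunction Ω φ) : ∀ᵐ t ∂(volume.restrict (Ioo 0 τ)),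
      ∫ x in Ω, u (t, x) * fderiv ℝ φ x v = -∫ x in Ω, u' (t, x) * φ x := by
  have := hΩ.isFiniteMeasure_restrict
  rw [restrict_spaceTimeCylinder] at hu hu'
  obtain ⟨C₁, hC₁⟩ := hφ.exists_bound_fderiv v
  obtain ⟨C₂, hC₂⟩ := hφ.exists_bound
  have i1 : Integrable (fun q : ℝ × E3 => u q * fderiv ℝ φ q.2 v)
      ((volume.restrict (Ioo 0 τ)).prod (volume.restrict Ω)) :=
    (hu.integrable (by norm_num)).mul_bdd (c := C₁)
      ((hφ.continuous_fderiv v).comp continuous_snd).aestronglyMeasurable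
      (Eventually.of_forall fun q => hC₁ _)
  have i2 : Integrable (fun q : ℝ × E3 => u' q * φ q.2)
      ((volume.restrict (Ioo 0 τ)).prod (volume.restrict Ω)) :=
    (hu'.integrable (by norm_num)).mul_bdd (c := C₂)
      (hφ.contDiff.continuous.comp continuous_snd).aestronglyMeasurable
      (Eventually.of_forall fun q => hC₂ _)
  have i3 := (i1.add i2).integral_prod_left
  have key := (isOpen_Ioo (a := 0) (b := τ)).ae_eq_zero_of_integral_contDiff_smul_eq_zero
    (μ := volume) (f := fun t => ∫ x in Ω, (u (t, x) * fderiv ℝ φ x v + u' (t, x) * φ x))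
    (locallyIntegrableOn_of_locallyIntegrable_restrict i3.locallyIntegrable) ?_
  · rw [ae_restrict_iff' measurableSet_Ioo]
    filter_upwards [key, (ae_restrict_iff' measurableSet_Ioo).1 i1.prod_right_ae,
      (ae_restrict_iff' measurableSet_Ioo).1 i2.prod_right_ae] with t h1 h2 h3 ht
    have h4 := h1 ht
    rw [integral_add (h2 ht) (h3 ht)] at h4
    linarith
  · intro η hη hηc hηs
    have hηt : IsTestFunction (Ioo 0 τ) η := ⟨hη, hηc, hηs⟩
    obtain ⟨C₃, hC₃⟩ := hηt.exists_bound
    rw [← setIntegral_eq_integral_of_forall_compl_eq_zero (s := Ioo 0 τ)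
      (fun t ht => by rw [image_eq_zero_of_notMem_tsupport fun h => ht (hηs h), zero_smul])]
    have h1 := h.2.2 _ (hηt.mul_prod hφ).contDiff (hηt.mul_prod hφ).hasCompactSupport
      (hηt.mul_prod hφ).tsupport_subset
    simp only [fderiv_mul_prod hηt hφ, zero_mul, zero_add] at h1
    rw [restrict_spaceTimeCylinder] at h1
    have hηm : AEStronglyMeasurable (fun q : ℝ × E3 => η q.1)
      ((volume.restrict (Ioo 0 τ)).prod (volume.restrict Ω)) :=
      (hη.continuous.comp continuous_fst).aestronglyMeasurable
    have j1 := i1.bdd_mul (c := C₃) hηm (Eventually.of_forall fun q => hC₃ _)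
    have j2 := i2.bdd_mul (c := C₃) hηm (Eventually.of_forall fun q => hC₃ _)
    have e1 : ∀ q : ℝ × E3, u q * (η q.1 * fderiv ℝ φ q.2 v) =
      η q.1 * (u q * fderiv ℝ φ q.2 v) := fun q => by ring
    have e2 : ∀ q : ℝ × E3, u' q * (η q.1 * φ q.2) = η q.1 * (u' q * φ q.2) := fun q => by ring
    simp only [e1, e2] at h1
    have h2 : ∫ q, (η q.1 * (u q * fderiv ℝ φ q.2 v) + η q.1 * (u' q * φ q.2))
        ∂((volume.restrict (Ioo 0 τ)).prod (volume.restrict Ω)) = 0 := by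
      rw [integral_add j1 j2, h1]; ring
    refine Eq.trans ?_ ((integral_prod _ (j1.add j2)).symm.trans h2)
    refine integral_congr_ae (Eventually.of_forall fun t => ?_)
    simp only [Pi.add_apply, ← mul_add, integral_const_mul, smul_eq_mul]

theorem ae_integral_deriv_slice (hΩ : IsConvexC2Domain Ω)
    (hu : MemLp u 2 (volume.restrict (spaceTimeCylinder τ Ω)))
    (hu' : MemLp u' 2 (volume.restrict (spaceTimeCylinder τ Ω)))
    (h : HasWeakDeriv (spaceTimeCylinder τ Ω) ((1, 0) : ℝ × E3) u u') {η : ℝ → ℝ}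
    (hη : IsTestFunction (Ioo 0 τ) η) : ∀ᵐ x ∂(volume.restrict Ω),
      ∫ t in Ioo 0 τ, u (t, x) * deriv η t = -∫ t in Ioo 0 τ, u' (t, x) * η t := by
  have := hΩ.isFiniteMeasure_restrict
  rw [restrict_spaceTimeCylinder] at hu hu'
  obtain ⟨C₁, hC₁⟩ := hη.exists_bound_fderiv 1
  obtain ⟨C₂, hC₂⟩ := hη.exists_bound
  have i1 : Integrable (fun q : ℝ × E3 => u q * deriv η q.1)
      ((volume.restrict (Ioo 0 τ)).prod (volume.restrict Ω)) :=
    (hu.integrable (by norm_num)).mul_bdd (c := C₁)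
      ((hη.contDiff.continuous_deriv (by simp)).comp continuous_fst).aestronglyMeasurable
      (Eventually.of_forall fun q => hC₁ _)
  have i2 : Integrable (fun q : ℝ × E3 => u' q * η q.1)
      ((volume.restrict (Ioo 0 τ)).prod (volume.restrict Ω)) :=
    (hu'.integrable (by norm_num)).mul_bdd (c := C₂)
      (hη.contDiff.continuous.comp continuous_fst).aestronglyMeasurable
      (Eventually.of_forall fun q => hC₂ _)
  have i3 := (i1.add i2).integral_prod_right
  have key := hΩ.isOpen.ae_eq_zero_of_integral_contDiff_smul_eq_zero
    (μ := volume) (f := fun x => ∫ t in Ioo 0 τ, (u (t, x) * deriv η t + u' (t, x) * η t))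
    (locallyIntegrableOn_of_locallyIntegrable_restrict i3.locallyIntegrable) ?_
  · rw [ae_restrict_iff' hΩ.isOpen.measurableSet]
    filter_upwards [key, (ae_restrict_iff' hΩ.isOpen.measurableSet).1 i1.prod_left_ae,
      (ae_restrict_iff' hΩ.isOpen.measurableSet).1 i2.prod_left_ae] with t h1 h2 h3 ht
    have h4 := h1 ht
    rw [integral_add (h2 ht) (h3 ht)] at h4
    linarith
  · intro φ hφ hφc hφs
    have hφt : IsTestFunction Ω φ := ⟨hφ, hφc, hφs⟩
    obtain ⟨C₃, hC₃⟩ := hφt.exists_bound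
    rw [← setIntegral_eq_integral_of_forall_compl_eq_zero (s := Ω)
      (fun t ht => by rw [image_eq_zero_of_notMem_tsupport fun h => ht (hφs h), zero_smul])]
    have h1 := h.2.2 _ (hη.mul_prod hφt).contDiff (hη.mul_prod hφt).hasCompactSupport
      (hη.mul_prod hφt).tsupport_subset
    simp only [fderiv_mul_prod hη hφt, map_zero, mul_zero, add_zero, one_mul] at h1
    rw [restrict_spaceTimeCylinder] at h1
    have hφm : AEStronglyMeasurable (fun q : ℝ × E3 => φ q.2)
      ((volume.restrict (Ioo 0 τ)).prod (volume.restrict Ω)) :=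
      (hφ.continuous.comp continuous_snd).aestronglyMeasurable
    have j1 := i1.bdd_mul (c := C₃) hφm (Eventually.of_forall fun q => hC₃ _)
    have j2 := i2.bdd_mul (c := C₃) hφm (Eventually.of_forall fun q => hC₃ _)
    have e1 : ∀ q : ℝ × E3, u q * (deriv η q.1 * φ q.2) =
      φ q.2 * (u q * deriv η q.1) := fun q => by ring
    have e2 : ∀ q : ℝ × E3, u' q * (η q.1 * φ q.2) = φ q.2 * (u' q * η q.1) := fun q => by ring
    simp only [e1, e2] at h1
    have h2 : ∫ q, (φ q.2 * (u q * deriv η q.1) + φ q.2 * (u' q * η q.1))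
        ∂((volume.restrict (Ioo 0 τ)).prod (volume.restrict Ω)) = 0 := by
      rw [integral_add j1 j2, h1]; ring
    refine Eq.trans ?_ ((integral_prod_symm _ (j1.add j2)).symm.trans h2)
    refine integral_congr_ae (Eventually.of_forall fun t => ?_)
    simp only [Pi.add_apply, ← mul_add, integral_const_mul, smul_eq_mul]

/-- For almost every `t`, the weak derivative of `u(t,·)` is the slice of that of `u`. -/
theorem ae_weakDeriv_slice_eq (hΩ : IsConvexC2Domain Ω)
    (hu : MemLp u 2 (volume.restrict (spaceTimeCylinder τ Ω)))
    (hu' : MemLp u' 2 (volume.restrict (spaceTimeCylinder τ Ω))) {v : E3}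
    (h : HasWeakDeriv (spaceTimeCylinder τ Ω) ((0, v) : ℝ × E3) u u') :
    ∀ᵐ t ∂(volume.restrict (Ioo 0 τ)), ∀ D : E3 → ℝ, MemLp D 2 (volume.restrict Ω) →
      HasWeakDeriv Ω v (fun x => u (t, x)) D → D =ᵐ[volume.restrict Ω] fun x => u' (t, x) := by
  obtain ⟨S, hSc, hS, hSd⟩ := exists_countable_testFunctions (volume : Measure E3) hΩ.isOpen
  have h1 : ∀ᵐ t ∂(volume.restrict (Ioo 0 τ)), ∀ φ ∈ S,
      ∫ x in Ω, u (t, x) * fderiv ℝ φ x v = -∫ x in Ω, u' (t, x) * φ x :=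
    (ae_ball_iff hSc).2 fun φ hφ => ae_integral_fderiv_slice hΩ hu hu' h (hS φ hφ)
  rw [restrict_spaceTimeCylinder] at hu'
  filter_upwards [h1, hu'.ae_memLp_prodMk_left] with t ht htm D hD hDw
  have h2 := hSd (fun x => D x - u' (t, x)) (hD.sub htm) fun φ hφ => by
    have h3 := hDw.2.2 φ (hS φ hφ).contDiff (hS φ hφ).hasCompactSupport (hS φ hφ).tsupport_subset
    have h4 := ht φ hφ
    simp only [sub_mul]
    have hφm := (hS φ hφ).memLp (volume.restrict Ω)
    refine (integral_sub (f := fun x => D x * φ x) (g := fun x => u' (t, x) * φ x)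
      (hD.integrable_mul hφm) (htm.integrable_mul hφm)).trans ?_
    simp only at h3
    linarith
  filter_upwards [h2] with x hx
  exact sub_eq_zero.1 hx

/-- For almost every `x`, the function `u(·,x)` is, almost everywhere, a primitive of `u'(·,x)`. -/
theorem ae_exists_eq_primitive (hΩ : IsConvexC2Domain Ω) (hτ : 0 < τ)
    (hu : MemLp u 2 (volume.restrict (spaceTimeCylinder τ Ω)))
    (hu' : MemLp u' 2 (volume.restrict (spaceTimeCylinder τ Ω)))
    (h : HasWeakDeriv (spaceTimeCylinder τ Ω) ((1, 0) : ℝ × E3) u u') :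
    ∀ᵐ x ∂(volume.restrict Ω), ∃ c, ∀ᵐ t ∂(volume.restrict (Ioo 0 τ)),
      u (t, x) = c + ∫ s in (0 : ℝ)..t, u' (s, x) := by
  obtain ⟨S, hSc, hS, hSd⟩ := exists_countable_testFunctions_primitive hτ
  have h1 : ∀ᵐ x ∂(volume.restrict Ω), ∀ η ∈ S,
      ∫ t in Ioo 0 τ, u (t, x) * deriv η t = -∫ t in Ioo 0 τ, u' (t, x) * η t :=
    (ae_ball_iff hSc).2 fun η hη => ae_integral_deriv_slice hΩ hu hu' h (hS η hη)
  rw [restrict_spaceTimeCylinder] at hu hu'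
  filter_upwards [h1, hu.ae_memLp_prodMk_right, hu'.ae_memLp_prodMk_right] with x h2 h3 h4
  exact hSd _ _ h3 h4 h2

end Slices

/-! ### Identification of the initial value -/

section InitialValue

variable {τ : ℝ} {Ω : Set E3} {u u' : ℝ × E3 → ℝ} {T₀ : E3 → ℝ}

theorem tendsto_average_primitive {τ c : ℝ} (hτ : 0 < τ) {f f' : ℝ → ℝ}
    (hf' : IntegrableOn f' (Ioo 0 τ))
    (hf : ∀ᵐ t ∂(volume.restrict (Ioo 0 τ)), f t = c + ∫ s in (0 : ℝ)..t, f' s) :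
    Tendsto (fun δ => δ⁻¹ * ∫ t in Ioo 0 δ, f t) (𝓝[>] 0) (𝓝 c) := by
  -- Extending `f'` by zero makes the primitive continuous on the whole line, so its average over
  -- `(0, δ)` tends to its value at `0`.
  set g : ℝ → ℝ := fun t => c + ∫ s in (0 : ℝ)..t, (Ioo 0 τ).indicator f' s with hg
  have hgc : Continuous g := continuous_const.add
    (intervalIntegral.continuous_primitive (fun a b =>
      ((integrable_indicator_iff measurableSet_Ioo).2 hf').intervalIntegrable) 0)
  have hg0 : g 0 = c := by simp [hg]
  have hd : HasDerivAt (fun δ => ∫ t in (0 : ℝ)..δ, g t) c 0 := by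
    have := intervalIntegral.integral_hasDerivAt_right (hgc.intervalIntegrable 0 0)
      hgc.stronglyMeasurable.stronglyMeasurableAtFilter hgc.continuousAt
    rwa [hg0] at this
  have hs := (hasDerivAt_iff_tendsto_slope.1 hd).mono_left
    (nhdsWithin_mono 0 (fun t (ht : t ∈ Ioi (0 : ℝ)) => ne_of_gt ht))
  refine hs.congr' ?_
  have hlt : ∀ᶠ δ in 𝓝[>] (0 : ℝ), δ < τ := nhdsWithin_le_nhds (gt_mem_nhds hτ)
  filter_upwards [hlt, self_mem_nhdsWithin] with δ h1 h2
  have h2' : (0 : ℝ) < δ := h2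
  rw [slope_def_field, intervalIntegral.integral_same, sub_zero, sub_zero, div_eq_inv_mul,
    intervalIntegral.integral_of_le h2'.le, integral_Ioc_eq_integral_Ioo]
  congr 1
  refine setIntegral_congr_ae measurableSet_Ioo ?_
  filter_upwards [(ae_restrict_iff' measurableSet_Ioo).1 hf] with t ht h3
  rw [ht ⟨h3.1, h3.2.trans h1⟩, hg]
  simp only
  congr 1
  rw [intervalIntegral.integral_of_le h3.1.le, intervalIntegral.integral_of_le h3.1.le]
  refine setIntegral_congr_fun measurableSet_Ioc fun s hs => ?_
  rw [indicator_of_mem]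
  exact ⟨hs.1, lt_of_le_of_lt hs.2 (h3.2.trans h1)⟩

/-- Averages over `(0, δ)` do not see null sets of times, which fits the initial condition.
Convergence of slices in `L²(Ω)` gives it in `L¹(Ω)` because `Ω` has finite volume, and Tonelli's
theorem passes it to averages. -/
theorem tendsto_eLpNorm_average_sub (hΩ : IsConvexC2Domain Ω) (hτ : 0 < τ)
    (hu : MemLp u 2 (volume.restrict (spaceTimeCylinder τ Ω)))
    (hT₀ : MemLp T₀ 2 (volume.restrict Ω))
    (hl : Tendsto (fun t => eLpNorm (fun x => u (t, x) - T₀ x) 2 (volume.restrict Ω))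
      (𝓝[>] 0 ⊓ ae volume) (𝓝 0)) :
    Tendsto (fun δ : ℝ => eLpNorm (fun x => (δ⁻¹ * ∫ t in Ioo 0 δ, u (t, x)) - T₀ x) 1
      (volume.restrict Ω)) (𝓝[>] 0) (𝓝 0) := by
  have hfin := hΩ.isFiniteMeasure_restrict
  rw [restrict_spaceTimeCylinder] at hu
  have hl1 : Tendsto (fun t => ∫⁻ x in Ω, ‖u (t, x) - T₀ x‖ₑ) (𝓝[>] 0 ⊓ ae volume) (𝓝 0) := by
    have h1 : Tendsto (fun t => eLpNorm (fun x => u (t, x) - T₀ x) 2 (volume.restrict Ω) *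
        (volume.restrict Ω) univ ^ (1 / (1 : ℝ≥0∞).toReal - 1 / (2 : ℝ≥0∞).toReal))
        (𝓝[>] 0 ⊓ ae volume) (𝓝 0) := by
      have := ENNReal.Tendsto.mul_const (b := (volume.restrict Ω) univ ^
        (1 / (1 : ℝ≥0∞).toReal - 1 / (2 : ℝ≥0∞).toReal)) hl (Or.inr (by
          refine (ENNReal.rpow_lt_top_of_nonneg (by norm_num) (measure_ne_top _ _)).ne))
      rwa [zero_mul] at this
    have hmeas : ∀ᶠ t in 𝓝[>] 0 ⊓ ae volume,
        AEStronglyMeasurable (fun x => u (t, x) - T₀ x) (volume.restrict Ω) := by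
      have h2 : ∀ᵐ t ∂(volume : Measure ℝ), t ∈ Ioo 0 τ →
          AEStronglyMeasurable (fun x => u (t, x)) (volume.restrict Ω) :=
        (ae_restrict_iff' measurableSet_Ioo).1 hu.1.prodMk_left
      have h3 : ∀ᶠ t in 𝓝[>] (0 : ℝ), t ∈ Ioo 0 τ := Ioo_mem_nhdsGT hτ
      filter_upwards [h2.filter_mono (inf_le_right : 𝓝[>] (0 : ℝ) ⊓ ae volume ≤ _),
        h3.filter_mono (inf_le_left : 𝓝[>] (0 : ℝ) ⊓ ae volume ≤ _)] with t h4 h5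
      exact (h4 h5).sub hT₀.1
    refine tendsto_of_tendsto_of_tendsto_of_le_of_le' tendsto_const_nhds h1
      (Eventually.of_forall fun _ => zero_le) ?_
    filter_upwards [hmeas] with t ht
    rw [← eLpNorm_one_eq_lintegral_enorm]
    exact eLpNorm_le_eLpNorm_mul_rpow_measure_univ (by norm_num) ht
  rw [ENNReal.tendsto_nhds_zero] at hl1 ⊢
  intro ε hε
  obtain ⟨A, hA, B, hB, hAB⟩ := Filter.mem_inf_iff_superset.1 (hl1 ε hε)
  obtain ⟨δ₀, hδ₀, hA⟩ := mem_nhdsGT_iff_exists_Ioo_subset.1 hA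
  have hlt : ∀ᶠ δ in 𝓝[>] (0 : ℝ), δ < min δ₀ τ :=
    nhdsWithin_le_nhds (gt_mem_nhds (lt_min hδ₀ hτ))
  filter_upwards [hlt, self_mem_nhdsWithin] with δ h1 h2
  have h2' : (0 : ℝ) < δ := h2
  have hsub : Ioo 0 δ ⊆ Ioo 0 τ := Ioo_subset_Ioo_right (h1.le.trans (min_le_right _ _))
  have huδ : MemLp u 2 ((volume.restrict (Ioo 0 δ)).prod (volume.restrict Ω)) := by
    refine hu.mono_measure ?_
    exact Measure.prod_mono (Measure.restrict_mono hsub le_rfl) le_rfl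
  have hslice := (huδ.integrable (by norm_num)).prod_left_ae
  rw [eLpNorm_one_eq_lintegral_enorm]
  calc ∫⁻ x in Ω, ‖(δ⁻¹ * ∫ t in Ioo 0 δ, u (t, x)) - T₀ x‖ₑ
      ≤ ∫⁻ x in Ω, ENNReal.ofReal δ⁻¹ * ∫⁻ t in Ioo 0 δ, ‖u (t, x) - T₀ x‖ₑ := by
        refine lintegral_mono_ae ?_
        filter_upwards [hslice] with x hx
        have e : (δ⁻¹ * ∫ t in Ioo 0 δ, u (t, x)) - T₀ x =
            δ⁻¹ * ∫ t in Ioo 0 δ, (u (t, x) - T₀ x) := by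
          rw [integral_sub hx (integrable_const _)]
          simp [h2'.le]
          field_simp
        rw [e, enorm_mul, Real.enorm_of_nonneg (inv_nonneg.2 h2'.le)]
        gcongr
        exact enorm_integral_le_lintegral_enorm _
    _ = ENNReal.ofReal δ⁻¹ * ∫⁻ t in Ioo 0 δ, ∫⁻ x in Ω, ‖u (t, x) - T₀ x‖ₑ := by
        rw [lintegral_const_mul' _ _ (by simp), lintegral_lintegral_swap]
        exact (huδ.1.sub (hT₀.1.comp_snd)).prod_swap.enorm
    _ ≤ ENNReal.ofReal δ⁻¹ * ∫⁻ t in Ioo 0 δ, ε := by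
        gcongr 1
        refine setLIntegral_mono_ae' measurableSet_Ioo ?_
        filter_upwards [hB] with t ht h3
        exact hAB ⟨hA ⟨h3.1, h3.2.trans (h1.trans_le (min_le_left _ _))⟩, ht⟩
    _ = ε := by
        rw [setLIntegral_const, Real.volume_Ioo, sub_zero, mul_comm ε, ← mul_assoc,
          ← ENNReal.ofReal_mul (inv_nonneg.2 h2'.le), inv_mul_cancel₀ h2'.ne', ENNReal.ofReal_one,
          one_mul]
    _ ≤ ε := le_rfl

/-- For almost every `x` the averages near time `0` tend to the constant of the primitive, while a
subsequence tends to `T₀ x` by the convergence in `L¹`; the two limits agree. -/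
theorem ae_eq_initial_add_primitive (hΩ : IsConvexC2Domain Ω) (hτ : 0 < τ)
    (hu : MemLp u 2 (volume.restrict (spaceTimeCylinder τ Ω)))
    (hu' : MemLp u' 2 (volume.restrict (spaceTimeCylinder τ Ω)))
    (h : HasWeakDeriv (spaceTimeCylinder τ Ω) ((1, 0) : ℝ × E3) u u')
    (hT₀ : MemLp T₀ 2 (volume.restrict Ω))
    (hl : Tendsto (fun t => eLpNorm (fun x => u (t, x) - T₀ x) 2 (volume.restrict Ω))
      (𝓝[>] 0 ⊓ ae volume) (𝓝 0)) :
    ∀ᵐ x ∂(volume.restrict Ω), ∀ᵐ t ∂(volume.restrict (Ioo 0 τ)),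
      u (t, x) = T₀ x + ∫ s in (0 : ℝ)..t, u' (s, x) := by
  have hprim := ae_exists_eq_primitive hΩ hτ hu hu' h
  have hav := tendsto_eLpNorm_average_sub hΩ hτ hu hT₀ hl
  rw [restrict_spaceTimeCylinder] at hu hu'
  obtain ⟨δ, -, hδ, hδl⟩ := exists_seq_strictAnti_tendsto' hτ
  have hδ0 : Tendsto δ atTop (𝓝[>] 0) :=
    tendsto_nhdsWithin_iff.2 ⟨hδl, Eventually.of_forall fun n => (hδ n).1⟩
  have hm : ∀ n, AEStronglyMeasurable (fun x => (δ n)⁻¹ * ∫ t in Ioo 0 (δ n), u (t, x))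
      (volume.restrict Ω) := by
    intro n
    have : MemLp u 2 ((volume.restrict (Ioo 0 (δ n))).prod (volume.restrict Ω)) :=
      hu.mono_measure (Measure.prod_mono
        (Measure.restrict_mono (Ioo_subset_Ioo_right (hδ n).2.le) le_rfl) le_rfl)
    exact this.1.prod_swap.integral_prod_right'.const_mul _
  obtain ⟨n, hn, hae⟩ := (tendstoInMeasure_of_tendsto_eLpNorm one_ne_zero hm hT₀.1
    (hav.comp hδ0)).exists_seq_tendsto_ae
  filter_upwards [hprim, hae, hu'.ae_memLp_prodMk_right] with x ⟨c, hc⟩ h1 h2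
  have h3 := (tendsto_average_primitive hτ (h2.integrable (by norm_num)) hc).comp
    (hδ0.comp hn.tendsto_atTop)
  rw [← tendsto_nhds_unique h3 h1]
  exact hc

/-- Testing the time derivative with `h(u)`, where `h` is the derivative of `H ≥ 0`. -/
theorem neg_integral_mul_timeDeriv_le (hΩ : IsConvexC2Domain Ω) (hτ : 0 < τ)
    (hu : MemLp u 2 (volume.restrict (spaceTimeCylinder τ Ω)))
    (hu' : MemLp u' 2 (volume.restrict (spaceTimeCylinder τ Ω)))
    (h : HasWeakDeriv (spaceTimeCylinder τ Ω) ((1, 0) : ℝ × E3) u u')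
    (hT₀ : MemLp T₀ 2 (volume.restrict Ω))
    (hl : Tendsto (fun t => eLpNorm (fun x => u (t, x) - T₀ x) 2 (volume.restrict Ω))
      (𝓝[>] 0 ⊓ ae volume) (𝓝 0)) {H η : ℝ → ℝ} {K : ℝ} {B : E3 → ℝ}
    (hH : ∀ s, HasDerivAt H (η s) s) (hηc : Continuous η) (hK : ∀ s, |η s| ≤ K)
    (hH0 : ∀ s, 0 ≤ H s) (hB : Integrable B (volume.restrict Ω))
    (hHB : ∀ᵐ x ∂(volume.restrict Ω), H (T₀ x) ≤ B x) :
    -∫ q in spaceTimeCylinder τ Ω, η (u q) * u' q ≤ ∫ x in Ω, B x := by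
  have hfin := hΩ.isFiniteMeasure_restrict
  have hae := ae_eq_initial_add_primitive hΩ hτ hu hu' h hT₀ hl
  rw [restrict_spaceTimeCylinder] at hu hu' ⊢
  have hi : Integrable (fun q => η (u q) * u' q)
      ((volume.restrict (Ioo 0 τ)).prod (volume.restrict Ω)) :=
    (hu'.integrable (by norm_num)).bdd_mul (c := K) (hηc.comp_aestronglyMeasurable hu.1)
      (Eventually.of_forall fun q => hK _)
  rw [integral_prod_symm _ hi, ← integral_neg]
  refine integral_mono_ae hi.integral_prod_right.neg hB ?_
  filter_upwards [hae, hu'.ae_memLp_prodMk_right, hHB] with x h1 h2 h3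
  -- On almost every line in time the integral equals `H(r) - H(T₀ x)` for the final value `r`, and
  -- `H(r) ≥ 0` may be dropped.
  obtain ⟨r, hr⟩ := integral_comp_mul_of_ae_eq_primitive hτ (h2.integrable (by norm_num)) h1 hH hK
  simp only [hr]
  linarith [hH0 r]

end InitialValue

/-! ### The test functions -/

theorem hasDerivAt_max_zero_pow (n : ℕ) (y : ℝ) :
    HasDerivAt (fun y : ℝ => max y 0 ^ (n + 2)) ((n + 2) * max y 0 ^ (n + 1)) y := by
  rcases lt_trichotomy y 0 with h | rfl | h
  · have h1 : (fun y : ℝ => max y 0 ^ (n + 2)) =ᶠ[𝓝 y] fun _ => 0 := by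
      filter_upwards [gt_mem_nhds h] with z hz
      rw [max_eq_right (le_of_lt hz), zero_pow (by omega)]
    rw [max_eq_right h.le, zero_pow (by omega), mul_zero]
    exact (hasDerivAt_const y (0 : ℝ)).congr_of_eventuallyEq h1
  · rw [max_self, zero_pow (by omega), mul_zero, hasDerivAt_iff_isLittleO]
    have h1 : (fun y : ℝ => y ^ (n + 2)) =o[𝓝 0] fun y => y :=
      Asymptotics.isLittleO_pow_id (by omega)
    simp only [max_self, sub_zero, smul_zero]
    rw [zero_pow (by omega)]
    simp only [sub_zero]
    refine Asymptotics.IsBigO.trans_isLittleO ?_ h1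
    refine Asymptotics.IsBigO.of_bound 1 (Eventually.of_forall fun z => ?_)
    rw [one_mul, norm_pow, norm_pow]
    gcongr
    rw [Real.norm_eq_abs, Real.norm_eq_abs, abs_of_nonneg (le_max_right _ _)]
    exact max_le (le_abs_self z) (abs_nonneg z)
  · have h1 : (fun y : ℝ => max y 0 ^ (n + 2)) =ᶠ[𝓝 y] fun y => y ^ (n + 2) := by
      filter_upwards [lt_mem_nhds h] with z hz
      rw [max_eq_left (le_of_lt hz)]
    rw [max_eq_left h.le]
    have h2 := hasDerivAt_pow (n + 2) y
    push_cast at h2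
    exact h2.congr_of_eventuallyEq h1

/-- The excess `((s₊)⁴ - M)₊`. -/
noncomputable def powExcess (M s : ℝ) : ℝ := max (max s 0 ^ 4 - M) 0

/-- A bounded increasing `C¹` function of `s` that converges to `((s₊)⁴ - M)₊` as `ε → 0`. -/
noncomputable def testFun (M ε s : ℝ) : ℝ :=
  powExcess M s ^ 3 / (ε + powExcess M s ^ 2 + ε * powExcess M s ^ 3)

/-- The derivative of `testFun M ε`. -/
noncomputable def testFunDeriv (M ε s : ℝ) : ℝ :=
  (3 * ε * powExcess M s ^ 2 + powExcess M s ^ 4) /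
    (ε + powExcess M s ^ 2 + ε * powExcess M s ^ 3) ^ 2 * (4 * max s 0 ^ 3)

section TestFun

variable {M ε : ℝ}

theorem powExcess_nonneg (M s : ℝ) : 0 ≤ powExcess M s := le_max_right _ _

theorem continuous_powExcess (M : ℝ) : Continuous (powExcess M) := by
  unfold powExcess; fun_prop

theorem powExcess_zero_left (s : ℝ) : powExcess 0 s = max s 0 ^ 4 := by
  rw [powExcess, sub_zero, max_eq_left (by positivity)]

theorem powExcess_le (hM : 0 ≤ M) (s : ℝ) : powExcess M s ≤ max s 0 ^ 4 :=
  max_le (by linarith) (by positivity)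

theorem le_powExcess_add (M s : ℝ) : max s 0 ^ 4 ≤ powExcess M s + M := by
  have := le_max_left (max s 0 ^ 4 - M) 0
  rw [powExcess]; linarith

theorem testFun_denom_pos (hε : 0 < ε) (M s : ℝ) :
    0 < ε + powExcess M s ^ 2 + ε * powExcess M s ^ 3 := by
  have := powExcess_nonneg M s
  positivity

/-- Only the square and the cube of the excess occur, and these are `C¹` although the excess itself
may have a corner; this explains the exponents in `testFun`. -/
theorem hasDerivAt_testFun (hε : 0 < ε) (M s : ℝ) :
    HasDerivAt (testFun M ε) (testFunDeriv M ε s) s := by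
  have h0 : HasDerivAt (fun s : ℝ => max s 0 ^ 4 - M) (4 * max s 0 ^ 3) s := by
    have := hasDerivAt_max_zero_pow 2 s
    norm_num at this
    exact this.sub_const M
  have h2 : HasDerivAt (fun s => powExcess M s ^ 2) (2 * powExcess M s * (4 * max s 0 ^ 3)) s := by
    have := (hasDerivAt_max_zero_pow 0 (max s 0 ^ 4 - M)).comp s h0
    norm_num at this
    exact this
  have h3 : HasDerivAt (fun s => powExcess M s ^ 3)
      (3 * powExcess M s ^ 2 * (4 * max s 0 ^ 3)) s := by
    have := (hasDerivAt_max_zero_pow 1 (max s 0 ^ 4 - M)).comp s h0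
    norm_num at this
    exact this
  have hd := testFun_denom_pos hε M s
  have := h3.div ((h2.const_add ε).add (h3.const_mul ε)) hd.ne'
  refine this.congr_deriv ?_
  simp only [testFunDeriv, Pi.add_apply]
  field_simp
  ring

theorem continuous_testFun (hε : 0 < ε) (M : ℝ) : Continuous (testFun M ε) :=
  continuous_iff_continuousAt.2 fun s => (hasDerivAt_testFun hε M s).continuousAt

theorem continuous_testFunDeriv (hε : 0 < ε) (M : ℝ) : Continuous (testFunDeriv M ε) := by
  have := continuous_powExcess M
  unfold testFunDeriv
  refine Continuous.mul (Continuous.div (by fun_prop) (by fun_prop) fun s => ?_) (by fun_prop)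
  exact (pow_pos (testFun_denom_pos hε M s) 2).ne'

theorem testFun_nonneg (hε : 0 < ε) (M s : ℝ) : 0 ≤ testFun M ε s :=
  div_nonneg (pow_nonneg (powExcess_nonneg M s) 3) (testFun_denom_pos hε M s).le

theorem testFun_le_powExcess (hε : 0 < ε) (M s : ℝ) : testFun M ε s ≤ powExcess M s := by
  rw [testFun, div_le_iff₀ (testFun_denom_pos hε M s)]
  have := powExcess_nonneg M s
  nlinarith [mul_nonneg hε.le this, mul_nonneg hε.le (pow_nonneg this 4)]

theorem testFun_le_inv (hε : 0 < ε) (M s : ℝ) : testFun M ε s ≤ 1 / ε := by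
  rw [testFun, div_le_div_iff₀ (testFun_denom_pos hε M s) hε]
  nlinarith [sq_nonneg (powExcess M s)]

theorem testFun_le_pow (hε : 0 < ε) (hM : 0 ≤ M) (s : ℝ) : testFun M ε s ≤ max s 0 ^ 4 :=
  (testFun_le_powExcess hε M s).trans (powExcess_le hM s)

theorem abs_testFun_le (hε : 0 < ε) (M s : ℝ) : |testFun M ε s| ≤ 1 / ε := by
  rw [abs_of_nonneg (testFun_nonneg hε M s)]
  exact testFun_le_inv hε M s

theorem testFun_eq_zero {s : ℝ} (h : max s 0 ^ 4 ≤ M) : testFun M ε s = 0 := by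
  have : powExcess M s = 0 := max_eq_right (by linarith)
  simp [testFun, this]

theorem testFun_zero_right (hM : 0 ≤ M) : testFun M ε 0 = 0 :=
  testFun_eq_zero (by simpa using hM)

theorem testFunDeriv_nonneg (hε : 0 < ε) (M s : ℝ) : 0 ≤ testFunDeriv M ε s := by
  have := powExcess_nonneg M s
  have h2 : 0 ≤ max s 0 := le_max_right _ _
  unfold testFunDeriv
  positivity

theorem profileDeriv_le (hε : 0 < ε) {z : ℝ} (hz : 0 ≤ z) :
    (3 * ε * z ^ 2 + z ^ 4) / (ε + z ^ 2 + ε * z ^ 3) ^ 2 ≤ 4 := by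
  rw [div_le_iff₀ (by positivity)]
  have h0 : 0 ≤ ε * z ^ 3 := by positivity
  have h1 : (ε + z ^ 2) ^ 2 ≤ (ε + z ^ 2 + ε * z ^ 3) ^ 2 :=
    pow_le_pow_left₀ (by positivity) (by linarith) 2
  nlinarith [mul_nonneg hε.le (sq_nonneg z), sq_nonneg ε, pow_nonneg hz 4]

theorem profileDeriv_mul_le (hε : 0 < ε) {z : ℝ} (hz : 0 ≤ z) :
    (3 * ε * z ^ 2 + z ^ 4) / (ε + z ^ 2 + ε * z ^ 3) ^ 2 * z ≤ 4 / ε := by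
  rw [div_mul_eq_mul_div, div_le_div_iff₀ (by positivity) hε]
  have h1 : (ε + z ^ 2) * (ε * z ^ 3) ≤ (ε + z ^ 2 + ε * z ^ 3) ^ 2 := by
    have h2 : 0 ≤ ε * z ^ 3 := by positivity
    have h3 : 0 ≤ ε + z ^ 2 := by positivity
    nlinarith [mul_nonneg h2 h3]
  nlinarith [mul_nonneg hε.le (pow_nonneg hz 5), mul_nonneg (sq_nonneg ε) (pow_nonneg hz 3)]

/-- With `z` the excess, the derivative is `ψ'(z) · 4 s₊³`, where `ψ(z) = z³ / (ε + z² + ε z³)`. The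
factor `s₊³` is at most `1 + M + z`, and both `ψ'(z)` and `z ψ'(z)` are bounded. -/
theorem abs_testFunDeriv_le (hε : 0 < ε) (hM : 0 ≤ M) (s : ℝ) :
    |testFunDeriv M ε s| ≤ 16 * (1 + M) + 16 / ε := by
  rw [abs_of_nonneg (testFunDeriv_nonneg hε M s)]
  have hz := powExcess_nonneg M s
  have h0 : 0 ≤ max s 0 := le_max_right _ _
  have h1 : max s 0 ^ 3 ≤ 1 + M + powExcess M s := by
    have h2 := le_powExcess_add M s
    have h3 : max s 0 ^ 3 ≤ 1 + max s 0 ^ 4 := by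
      nlinarith [sq_nonneg (max s 0 ^ 2 - max s 0 / 2), sq_nonneg (max s 0 - 1),
        sq_nonneg (max s 0 ^ 2 - 1), sq_nonneg (max s 0)]
    linarith
  have h4 := profileDeriv_le hε hz
  have h5 := profileDeriv_mul_le hε hz
  unfold testFunDeriv
  set A := (3 * ε * powExcess M s ^ 2 + powExcess M s ^ 4) /
    (ε + powExcess M s ^ 2 + ε * powExcess M s ^ 3) ^ 2 with hA
  have hA0 : 0 ≤ A := by positivity
  calc A * (4 * max s 0 ^ 3) ≤ A * (4 * (1 + M + powExcess M s)) := by gcongr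
    _ = 4 * (1 + M) * A + 4 * (A * powExcess M s) := by ring
    _ ≤ 4 * (1 + M) * 4 + 4 * (4 / ε) := by gcongr
    _ = _ := by ring

theorem mul_testFunDeriv_zero (s : ℝ) : max s 0 * testFunDeriv 0 ε s =
    4 * ((3 * ε * powExcess 0 s ^ 2 + powExcess 0 s ^ 4) /
    (ε + powExcess 0 s ^ 2 + ε * powExcess 0 s ^ 3) ^ 2 * powExcess 0 s) := by
  rw [testFunDeriv]
  conv_rhs => rw [show ∀ a : ℝ, 4 * (a * powExcess 0 s) = a * (4 * max s 0 ^ 4) from fun a => by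
    rw [powExcess_zero_left]; ring]
  ring

theorem mul_testFunDeriv_zero_eq (s : ℝ) :
    s * testFunDeriv 0 ε s = max s 0 * testFunDeriv 0 ε s := by
  rcases le_total s 0 with h | h
  · simp [testFunDeriv, max_eq_right h]
  · rw [max_eq_left h]

/-- For `M = 0` the excess is `z = s₊⁴`, so `s dz/ds = 4z`, and `z ψ'(z) ≤ 3 ψ(z)` for the profile
`ψ`; hence `12 = 4 · 3`. -/
theorem mul_testFunDeriv_le (hε : 0 < ε) (s : ℝ) :
    s * testFunDeriv 0 ε s ≤ 12 * testFun 0 ε s := by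
  rw [mul_testFunDeriv_zero_eq, mul_testFunDeriv_zero, testFun]
  have hz := powExcess_nonneg 0 s
  generalize powExcess 0 s = z at *
  have hd : 0 < ε + z ^ 2 + ε * z ^ 3 := by positivity
  have e : 12 * (z ^ 3 / (ε + z ^ 2 + ε * z ^ 3)) =
      4 * (3 * (ε + z ^ 2 + ε * z ^ 3) * z ^ 2 / (ε + z ^ 2 + ε * z ^ 3) ^ 2 * z) := by
    field_simp
    ring
  rw [e]
  gcongr
  have h3 : 0 ≤ ε * z ^ 3 * z ^ 2 := by positivity
  nlinarith [pow_nonneg hz 4]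

/-- The regularised form of `(s⁴)² = (s⁵/4) · 4s³`. It makes the dissipation `h'(T) |∇T|²` strong
enough to absorb terms of the form `h(T) |∇T|`. -/
theorem testFun_sq_le (hε : 0 < ε) (s : ℝ) :
    testFun 0 ε s ^ 2 ≤ max s 0 ^ 5 / 4 * testFunDeriv 0 ε s := by
  have e : max s 0 ^ 5 / 4 * testFunDeriv 0 ε s = (3 * ε * powExcess 0 s ^ 2 + powExcess 0 s ^ 4) *
      powExcess 0 s ^ 2 / (ε + powExcess 0 s ^ 2 + ε * powExcess 0 s ^ 3) ^ 2 := by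
    rw [testFunDeriv]
    conv_rhs => rw [show ∀ a : ℝ, a * powExcess 0 s ^ 2 = a * (max s 0) ^ 8 from fun a => by
      rw [powExcess_zero_left]; ring]
    ring
  rw [e, testFun, div_pow]
  have hz := powExcess_nonneg 0 s
  gcongr
  have : 0 ≤ 3 * ε * powExcess 0 s ^ 2 * powExcess 0 s ^ 2 := by positivity
  nlinarith

theorem abs_testFun_add_mul_le (hε : 0 < ε) (s : ℝ) :
    |testFun 0 ε s + s * testFunDeriv 0 ε s| ≤ 13 * (1 / ε) := by
  have h1 := testFun_nonneg hε 0 s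
  have h2 := testFun_le_inv hε 0 s
  have h3 := mul_testFunDeriv_le hε s
  have h4 : 0 ≤ s * testFunDeriv 0 ε s := by
    rw [mul_testFunDeriv_zero_eq]
    exact mul_nonneg (le_max_right _ _) (testFunDeriv_nonneg hε 0 s)
  rw [abs_of_nonneg (by linarith)]
  linarith

theorem tendsto_testFun (M s : ℝ) :
    Tendsto (fun ε => testFun M ε s) (𝓝[>] 0) (𝓝 (powExcess M s)) := by
  rcases (powExcess_nonneg M s).eq_or_lt with h | h
  · simp [testFun, ← h]
  · have h1 : Tendsto (fun ε : ℝ => testFun M ε s) (𝓝 0)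
        (𝓝 (powExcess M s ^ 3 / (0 + powExcess M s ^ 2 + 0 * powExcess M s ^ 3))) := by
      refine Tendsto.div tendsto_const_nhds ?_ (by positivity)
      exact ((tendsto_id.add tendsto_const_nhds).add (tendsto_id.mul tendsto_const_nhds))
    have e : powExcess M s ^ 3 / (0 + powExcess M s ^ 2 + 0 * powExcess M s ^ 3) =
      powExcess M s := by field_simp; simp
    rw [e] at h1
    exact h1.mono_left nhdsWithin_le_nhds

/-- The primitive of `testFun M ε` that vanishes at `0`. -/
noncomputable def testFunPrimitive (M ε s : ℝ) : ℝ := ∫ r in (0 : ℝ)..s, testFun M ε r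

theorem hasDerivAt_testFunPrimitive (hε : 0 < ε) (M s : ℝ) :
    HasDerivAt (testFunPrimitive M ε) (testFun M ε s) s :=
  intervalIntegral.integral_hasDerivAt_right ((continuous_testFun hε M).intervalIntegrable _ _)
    (continuous_testFun hε M).stronglyMeasurable.stronglyMeasurableAtFilter
    (continuous_testFun hε M).continuousAt

theorem testFunPrimitive_nonneg (hε : 0 < ε) (hM : 0 ≤ M) (s : ℝ) :
    0 ≤ testFunPrimitive M ε s := by
  rcases le_total 0 s with h | h
  · exact intervalIntegral.integral_nonneg h fun r _ => testFun_nonneg hε M r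
  · refine le_of_eq (Eq.symm ?_)
    refine (intervalIntegral.integral_congr fun r hr => ?_).trans
      (intervalIntegral.integral_zero (a := 0) (b := s))
    rw [uIcc_of_ge h] at hr
    exact testFun_eq_zero (by rw [max_eq_right hr.2]; simpa using hM)

theorem testFunPrimitive_le (hε : 0 < ε) (hM : 0 ≤ M) {s : ℝ} (hs : 0 ≤ s) :
    testFunPrimitive M ε s ≤ s ^ 5 / 5 := by
  have h1 : ∫ r in (0 : ℝ)..s, r ^ 4 = s ^ 5 / 5 := by
    rw [integral_pow]; norm_num
  rw [← h1]
  refine intervalIntegral.integral_mono_on hs ((continuous_testFun hε M).intervalIntegrable _ _)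
    ((continuous_pow 4).intervalIntegrable _ _) fun r hr => ?_
  have := testFun_le_pow hε hM r
  rwa [max_eq_left hr.1] at this

end TestFun

/-! ### Green's formula for the Laplacian on time slices -/

theorem IsTraceApprox.congr_grad {Ω : Set E3} {u w : E3 → ℝ} {Du Du' : Fin 3 → E3 → ℝ}
    {φ : ℕ → E3 → ℝ} (h : IsTraceApprox Ω u w Du φ)
    (he : ∀ i, Du i =ᵐ[volume.restrict Ω] Du' i) : IsTraceApprox Ω u w Du' φ :=
  { h with
    memLp_grad := fun i => (h.memLp_grad i).ae_eq (he i)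
    tendsto_grad := fun i => (h.tendsto_grad i).congr fun k => eLpNorm_congr_ae <| by
      filter_upwards [he i] with x hx
      rw [hx] }

/-- `w` and `v i` are the traces of `u` and of `∂ᵢu`; `Du` and `D2` are the first and second
derivatives of `u`. -/
structure HasTraces (Ω : Set E3) (u w : E3 → ℝ) (Du v : Fin 3 → E3 → ℝ)
    (D2 : Fin 3 → Fin 3 → E3 → ℝ) : Prop where
  trace : ∃ φ, IsTraceApprox Ω u w Du φ
  trace_grad : ∀ i, ∃ χ, IsTraceApprox Ω (Du i) (v i) (D2 i) χ

section Slices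

variable {Ω : Set E3} {u w : E3 → ℝ} {Du v : Fin 3 → E3 → ℝ} {D2 : Fin 3 → Fin 3 → E3 → ℝ}
  {Φ Φ' : ℝ → ℝ} {K : ℝ}

/-- Each trace comes with its own weak gradient of the slice. For almost every `t` these gradients
are the slices of the space-time derivatives, so traces and derivatives can be used in the same
Green formula. -/
theorem ae_hasTraces (hΩ : IsConvexC2Domain Ω) {τ : ℝ} {T Tt : ℝ × E3 → ℝ}
    {DT : Fin 3 → ℝ × E3 → ℝ} {D2T : Fin 3 → Fin 3 → ℝ × E3 → ℝ}
    (h : HasW21Derivs 2 (spaceTimeCylinder τ Ω) T Tt DT D2T) :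
    ∀ᵐ t ∂(volume.restrict (Ioo 0 τ)), ∀ w v, HasTrace Ω (fun x => T (t, x)) w →
      (∀ i, HasTrace Ω (fun x => DT i (t, x)) (v i)) →
      HasTraces Ω (fun x => T (t, x)) w (fun i x => DT i (t, x)) v (fun i j x => D2T i j (t, x)) := by
  have h1 : ∀ i, _ := fun i => ae_weakDeriv_slice_eq hΩ h.memLp (h.memLp_grad i) (h.weakDeriv_grad i)
  have h2 : ∀ i j, _ := fun i j =>
    ae_weakDeriv_slice_eq hΩ (h.memLp_grad i) (h.memLp_hess i j) (h.weakDeriv_hess i j)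
  filter_upwards [ae_all_iff.2 h1, ae_all_iff.2 fun i => ae_all_iff.2 (h2 i)] with t e1 e2 w v hw hv
  constructor
  · obtain ⟨D, φ, hD, hφ⟩ := hw.exists_isTraceApprox
    exact ⟨φ, hφ.congr_grad fun i => e1 i (D i) (hD.memLp_grad i) (hD.weakDeriv i)⟩
  · intro i
    obtain ⟨D, φ, hD, hφ⟩ := (hv i).exists_isTraceApprox
    exact ⟨φ, hφ.congr_grad fun j => e2 i j (D j) (hD.memLp_grad j) (hD.weakDeriv j)⟩

theorem HasTraces.integrable_laplacian_mul (h : HasTraces Ω u w Du v D2)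
    (hΦ : ∀ s, HasDerivAt Φ (Φ' s) s) (hK : ∀ s, |Φ' s| ≤ K) (h0 : Φ 0 = 0) (i : Fin 3) :
    Integrable (fun x => D2 i i x * Φ (u x)) (volume.restrict Ω) := by
  obtain ⟨φ, hφ⟩ := h.trace
  obtain ⟨χ, hχ⟩ := h.trace_grad i
  exact (hχ.memLp_grad i).integrable_mul (hφ.memLp.comp_of_abs_deriv_le hΦ hK h0)

theorem HasTraces.integrable_deriv_mul_sq (h : HasTraces Ω u w Du v D2)
    (hΦc : Continuous Φ') (hK : ∀ s, |Φ' s| ≤ K) (i : Fin 3) :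
    Integrable (fun x => Φ' (u x) * Du i x ^ 2) (volume.restrict Ω) := by
  obtain ⟨φ, hφ⟩ := h.trace
  exact (hφ.memLp_grad i).integrable_sq.bdd_mul (c := K)
    (hΦc.comp_aestronglyMeasurable hφ.memLp.1) (Eventually.of_forall fun x => hK _)

theorem HasTraces.integrable_normal_mul (hΩ : IsConvexC2Domain Ω) (h : HasTraces Ω u w Du v D2)
    (hΦ : ∀ s, HasDerivAt Φ (Φ' s) s) (hK : ∀ s, |Φ' s| ≤ K) (h0 : Φ 0 = 0) (i : Fin 3) :
    Integrable (fun y => v i y * Φ (w y) * outwardNormal Ω y i) (surfaceMeasure Ω) := by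
  obtain ⟨φ, hφ⟩ := h.trace
  obtain ⟨χ, hχ⟩ := h.trace_grad i
  exact hΩ.integrable_mul_normal i
    (hχ.memLp_trace.integrable_mul (hφ.memLp_trace.comp_of_abs_deriv_le hΦ hK h0))

theorem HasTraces.integral_laplacian_mul (hΩ : IsConvexC2Domain Ω) (h : HasTraces Ω u w Du v D2)
    (hΦ : ∀ s, HasDerivAt Φ (Φ' s) s) (hΦc : Continuous Φ') (hK : ∀ s, |Φ' s| ≤ K)
    (h0 : Φ 0 = 0) :
    (∫ x in Ω, (∑ i, D2 i i x) * Φ (u x)) =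
      (∫ y, (∑ i, v i y * outwardNormal Ω y i) * Φ (w y) ∂(surfaceMeasure Ω)) -
      ∫ x in Ω, Φ' (u x) * ∑ i, Du i x ^ 2 := by
  simp_rw [Finset.sum_mul, Finset.mul_sum, mul_right_comm _ (outwardNormal Ω _ _)]
  rw [integral_finsetSum _ fun i _ => h.integrable_laplacian_mul hΦ hK h0 i,
    integral_finsetSum _ fun i _ => h.integrable_deriv_mul_sq hΦc hK i,
    integral_finsetSum _ fun i _ => h.integrable_normal_mul hΩ hΦ hK h0 i,
    ← Finset.sum_sub_distrib]
  refine Finset.sum_congr rfl fun i _ => ?_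
  obtain ⟨φ, hφ⟩ := h.trace
  obtain ⟨χ, hχ⟩ := h.trace_grad i
  have := hΩ.integral_green hφ hχ hΦ hΦc hK h0 i
  have e : (∫ x in Ω, Du i x * (Φ' (u x) * Du i x)) = ∫ x in Ω, Φ' (u x) * Du i x ^ 2 := by
    congr 1; ext x; ring
  simp_rw [← mul_assoc] at this e
  rw [e] at this
  linarith

/-- The divergence theorem for the field `Φ(u) (x - x₀)`; the factor `3` is the divergence of `x -
x₀`. -/
theorem HasTraces.integral_mul_inner_normal (hΩ : IsConvexC2Domain Ω)
    (h : HasTraces Ω u w Du v D2) (hΦ : ∀ s, HasDerivAt Φ (Φ' s) s) (hΦc : Continuous Φ')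
    (hK : ∀ s, |Φ' s| ≤ K) (h0 : Φ 0 = 0) (x₀ : E3) :
    Integrable (fun y => Φ (w y) * ⟪outwardNormal Ω y, y - x₀⟫) (surfaceMeasure Ω) ∧
    Integrable (fun x => 3 * Φ (u x) + Φ' (u x) * ∑ i, Du i x * (x - x₀) i) (volume.restrict Ω) ∧
    ∫ y, Φ (w y) * ⟪outwardNormal Ω y, y - x₀⟫ ∂(surfaceMeasure Ω) =
      ∫ x in Ω, 3 * Φ (u x) + Φ' (u x) * ∑ i, Du i x * (x - x₀) i := by
  have := hΩ.isFiniteMeasure_restrict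
  have := hΩ.isFiniteMeasure_surfaceMeasure
  obtain ⟨φ, hφ⟩ := h.trace
  have hcont : ∀ i : Fin 3, ContDiff ℝ 1 fun x : E3 => (x - x₀) i := fun i => by fun_prop
  have hder : ∀ (i : Fin 3) (x : E3), fderiv ℝ (fun x : E3 => (x - x₀) i) x (unitVec i) = 1 := by
    intro i x
    have h1 : HasFDerivAt (fun x : E3 => (x - x₀) i)
        (EuclideanSpace.proj i : E3 →L[ℝ] ℝ) x := by
      simpa using ((EuclideanSpace.proj i : E3 →L[ℝ] ℝ).hasFDerivAt (x := x)).sub_const (x₀ i)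
    rw [h1.fderiv]
    simp [unitVec]
  have hb := hφ.memLp_trace.comp_of_abs_deriv_le hΦ hK h0
  have hi := hφ.memLp.comp_of_abs_deriv_le hΦ hK h0
  have hb1 : ∀ i, Integrable (fun y => (y - x₀) i * Φ (w y) * outwardNormal Ω y i)
      (surfaceMeasure Ω) := fun i => hΩ.integrable_mul_normal i
    ((hΩ.memLp_surfaceMeasure_of_continuous (hcont i).continuous 2).integrable_mul hb)
  have hi1 := hi.integrable one_le_two
  have hi2 : ∀ i, Integrable (fun x => Φ' (u x) * (Du i x * (x - x₀) i)) (volume.restrict Ω) :=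
    fun i => ((hφ.memLp_grad i).integrable_mul
      (hΩ.memLp_of_continuous (hcont i).continuous 2)).bdd_mul (c := K)
      (hΦc.comp_aestronglyMeasurable hφ.memLp.1) (Eventually.of_forall fun x => hK _)
  have e1 : (fun y => Φ (w y) * ⟪outwardNormal Ω y, y - x₀⟫) =
      fun y => ∑ i, (y - x₀) i * Φ (w y) * outwardNormal Ω y i := by
    ext y
    rw [PiLp.inner_apply, Finset.mul_sum]
    refine Finset.sum_congr rfl fun i _ => ?_
    simp only [RCLike.inner_apply, conj_trivial]
    ring
  have e2 : (fun x => 3 * Φ (u x) + Φ' (u x) * ∑ i, Du i x * (x - x₀) i) =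
      fun x => ∑ i, (Φ (u x) + Φ' (u x) * (Du i x * (x - x₀) i)) := by
    ext x
    rw [Finset.sum_add_distrib, Finset.mul_sum]
    simp
  rw [e1, e2]
  have hi3 : ∀ i, Integrable (fun x => Φ (u x) + Φ' (u x) * (Du i x * (x - x₀) i))
      (volume.restrict Ω) := fun i => hi1.add (hi2 i)
  refine ⟨integrable_finsetSum _ fun i _ => hb1 i, integrable_finsetSum _ fun i _ => hi3 i, ?_⟩
  rw [integral_finsetSum _ fun i _ => hb1 i, integral_finsetSum _ fun i _ => hi3 i]
  refine Finset.sum_congr rfl fun i _ => ?_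
  have h2 := hΩ.integral_green hφ (hΩ.isTraceApprox_of_contDiff (hcont i)) hΦ hΦc hK h0 i
  simp only [hder, one_mul] at h2
  refine Eq.trans ?_ (h2.symm.trans ?_)
  · simp only [mul_assoc]
  · rw [← integral_add hi1]
    · congr 1; ext x; ring
    · refine (hi2 i).congr (Eventually.of_forall fun x => ?_)
      simp only; ring

end Slices

/-! ### Estimates of the diffusion term on time slices -/

/-- Integrability need not be assumed: a non-integrable function has integral `0` by convention,
which is also below the bound. -/
theorem integral_le_toReal_const_mul {α : Type*} [MeasurableSpace α] {μ : Measure α} {f : α → ℝ}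
    {c : ℝ≥0∞} (hf : ∀ᵐ x ∂μ, ENNReal.ofReal (f x) ≤ c) (hc : c * μ univ ≠ ⊤) :
    ∫ x, f x ∂μ ≤ (c * μ univ).toReal := by
  by_cases hi : Integrable f μ
  · rw [integral_eq_lintegral_pos_part_sub_lintegral_neg_part hi]
    refine (sub_le_self _ ENNReal.toReal_nonneg).trans (ENNReal.toReal_mono hc ?_)
    exact (lintegral_mono_ae hf).trans (lintegral_const c).le
  · rw [integral_undef hi]
    exact ENNReal.toReal_nonneg

/-- Since `b/a > 0`, a positive flux forces `w ≤ |g|/|b|`. Then the flux is at most `|g|/|a|` and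
the test function at most `(|g|/|b|)⁴`. -/
theorem robin_flux_le {a b g w ε : ℝ} (hab : 0 < a * b) (hε : 0 < ε) :
    (g - b * w) / a * testFun 0 ε w ≤ |g| ^ 5 / (|a| * |b| ^ 4) := by
  have ha : a ≠ 0 := left_ne_zero_of_mul hab.ne'
  have hb : b ≠ 0 := right_ne_zero_of_mul hab.ne'
  have hr : 0 ≤ |g| ^ 5 / (|a| * |b| ^ 4) := by positivity
  rcases le_total w 0 with hw | hw
  · rw [testFun_eq_zero (by rw [max_eq_right hw]; norm_num), mul_zero]
    exact hr
  have h0 := testFun_nonneg hε 0 w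
  rcases le_total ((g - b * w) / a) 0 with h | h
  · exact (mul_nonpos_of_nonpos_of_nonneg h h0).trans hr
  have e : (g - b * w) / a = g / a - b / a * w := by ring
  have hba : b / a = |b| / |a| := by
    rw [← abs_div, abs_of_pos]
    rcases mul_pos_iff.1 hab with h | h
    · exact div_pos h.2 h.1
    · exact div_pos_of_neg_of_neg h.2 h.1
  have h1 : g / a ≤ |g| / |a| := by rw [← abs_div]; exact le_abs_self _
  have h2 : |b| / |a| * w ≤ |g| / |a| := by rw [← hba]; linarith
  have h3 : w ≤ |g| / |b| := by
    rw [le_div_iff₀ (abs_pos.2 hb)]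
    rw [div_mul_eq_mul_div, div_le_div_iff_of_pos_right (abs_pos.2 ha)] at h2
    linarith
  have h4 : testFun 0 ε w ≤ (|g| / |b|) ^ 4 := by
    refine (testFun_le_pow hε le_rfl w).trans ?_
    rw [max_eq_left hw]
    gcongr
  calc (g - b * w) / a * testFun 0 ε w ≤ |g| / |a| * (|g| / |b|) ^ 4 := by
        refine mul_le_mul ?_ h4 h0 (by positivity)
        rw [e, hba]
        have : 0 ≤ |b| / |a| * w := by positivity
        linarith
    _ = _ := by field_simp

/-- If `y ≤ δ w`, the first term suffices; otherwise `w ≤ y/δ` and the test function is at most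
`(y/δ)⁴`. -/
theorem mul_testFun_le_add {y w δ ε : ℝ} (hy : 0 ≤ y) (hδ : 0 < δ) (hε : 0 < ε) :
    y * testFun 0 ε w ≤ δ * (w * testFun 0 ε w) + y ^ 5 / δ ^ 4 := by
  have hr : 0 ≤ y ^ 5 / δ ^ 4 := by positivity
  rcases le_total w 0 with hw | hw
  · rw [testFun_eq_zero (by rw [max_eq_right hw]; norm_num)]
    simpa using hr
  have h0 := testFun_nonneg hε 0 w
  rcases le_total y (δ * w) with h | h
  · have := mul_le_mul_of_nonneg_right h h0
    linarith
  · have h1 : w ≤ y / δ := by rw [le_div_iff₀ hδ]; linarith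
    have h4 : testFun 0 ε w ≤ (y / δ) ^ 4 := by
      refine (testFun_le_pow hε le_rfl w).trans ?_
      rw [max_eq_left hw]
      gcongr
    have h5 : 0 ≤ δ * (w * testFun 0 ε w) := by positivity
    calc y * testFun 0 ε w ≤ y * (y / δ) ^ 4 := by gcongr
      _ = y ^ 5 / δ ^ 4 := by ring
      _ ≤ _ := by linarith

/-- By `testFun_sq_le` the square of the left side is at most four times the product of the two
terms on the right, hence at most the square of their sum. -/
theorem mul_testFun_mul_le {c d u ε : ℝ} (hε : 0 < ε) :
    c * testFun 0 ε u * d ≤ testFunDeriv 0 ε u * d ^ 2 + c ^ 2 / 16 * max u 0 ^ 5 := by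
  have h1 := testFun_sq_le hε u
  have h2 := testFunDeriv_nonneg hε 0 u
  have h3 : 0 ≤ max u 0 ^ 5 := pow_nonneg (le_max_right _ _) 5
  have h4 : 0 ≤ testFunDeriv 0 ε u * d ^ 2 + c ^ 2 / 16 * max u 0 ^ 5 := by positivity
  refine (le_abs_self _).trans (abs_le_of_sq_le_sq ?_ h4)
  have h5 := mul_le_mul_of_nonneg_left h1 (mul_nonneg (sq_nonneg c) (sq_nonneg d))
  nlinarith [sq_nonneg (testFunDeriv 0 ε u * d ^ 2 - c ^ 2 / 16 * max u 0 ^ 5)]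

section Slices

variable {Ω : Set E3} {u w : E3 → ℝ} {Du v : Fin 3 → E3 → ℝ} {D2 : Fin 3 → Fin 3 → E3 → ℝ}
  {M ε : ℝ}

theorem HasTraces.integral_laplacian_mul_testFun (hΩ : IsConvexC2Domain Ω)
    (h : HasTraces Ω u w Du v D2) (hε : 0 < ε) (hM : 0 ≤ M) :
    (∫ x in Ω, (∑ i, D2 i i x) * testFun M ε (u x)) =
      (∫ y, (∑ i, v i y * outwardNormal Ω y i) * testFun M ε (w y) ∂(surfaceMeasure Ω)) -
      ∫ x in Ω, testFunDeriv M ε (u x) * ∑ i, Du i x ^ 2 :=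
  h.integral_laplacian_mul hΩ (hasDerivAt_testFun hε M) (continuous_testFunDeriv hε M)
    (abs_testFunDeriv_le hε hM) (testFun_zero_right hM)

theorem HasTraces.integral_laplacian_mul_testFun_le (hΩ : IsConvexC2Domain Ω)
    (h : HasTraces Ω u w Du v D2) (hε : 0 < ε) (hM : 0 ≤ M) :
    (∫ x in Ω, (∑ i, D2 i i x) * testFun M ε (u x)) ≤
      ∫ y, (∑ i, v i y * outwardNormal Ω y i) * testFun M ε (w y) ∂(surfaceMeasure Ω) := by
  rw [h.integral_laplacian_mul_testFun hΩ hε hM]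
  refine sub_le_self _ (integral_nonneg fun x => ?_)
  exact mul_nonneg (testFunDeriv_nonneg hε M _) (Finset.sum_nonneg fun i _ => sq_nonneg _)

theorem HasTraces.laplacian_le_of_robin (hΩ : IsConvexC2Domain Ω)
    (h : HasTraces Ω u w Du v D2) (hε : 0 < ε) {a b : ℝ} (hab : 0 < a * b) {g : E3 → ℝ} {N : ℝ≥0∞}
    (hbc : ∀ᵐ y ∂(surfaceMeasure Ω), a * ∑ i, v i y * outwardNormal Ω y i + b * w y = g y)
    (hg : ∀ y ∈ closure Ω, ‖g y‖ₑ ≤ N)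
    (hN : ENNReal.ofReal (1 / (|a| * |b| ^ 4)) * N ^ 5 * boundaryArea Ω ≠ ⊤) :
    (∫ x in Ω, (∑ i, D2 i i x) * testFun 0 ε (u x)) ≤
      (ENNReal.ofReal (1 / (|a| * |b| ^ 4)) * N ^ 5 * boundaryArea Ω).toReal := by
  refine (h.integral_laplacian_mul_testFun_le hΩ hε le_rfl).trans
    (integral_le_toReal_const_mul ?_ hN)
  filter_upwards [hbc, IsConvexC2Domain.ae_mem_frontier Ω] with y hy hyf
  have ha : a ≠ 0 := left_ne_zero_of_mul hab.ne'
  have e : ∑ i, v i y * outwardNormal Ω y i = (g y - b * w y) / a := by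
    rw [eq_div_iff ha]; linarith
  rw [e]
  calc ENNReal.ofReal ((g y - b * w y) / a * testFun 0 ε (w y))
      ≤ ENNReal.ofReal (1 / (|a| * |b| ^ 4) * |g y| ^ 5) := by
        refine ENNReal.ofReal_le_ofReal ((robin_flux_le hab hε).trans (le_of_eq ?_))
        ring
    _ = ENNReal.ofReal (1 / (|a| * |b| ^ 4)) * ‖g y‖ₑ ^ 5 := by
        rw [ENNReal.ofReal_mul (by positivity), ENNReal.ofReal_pow (abs_nonneg _),
          Real.enorm_eq_ofReal_abs]
    _ ≤ _ := by
        gcongr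
        exact hg y (frontier_subset_closure hyf)

/-- The truncation level is at least the fourth power of the positive part of the boundary values,
so the test function vanishes on `∂Ω` and only the dissipation remains, with a favourable sign. -/
theorem HasTraces.laplacian_le_of_dirichlet (hΩ : IsConvexC2Domain Ω)
    (h : HasTraces Ω u w Du v D2) (hε : 0 < ε) {b m : ℝ} (hb : 0 < b) {g : E3 → ℝ}
    (hbc : ∀ᵐ y ∂(surfaceMeasure Ω), b * w y = g y) (hm : 0 ≤ m)
    (hg : ∀ y ∈ closure Ω, |g y| ≤ b * m) :
    (∫ x in Ω, (∑ i, D2 i i x) * testFun (m ^ 4) ε (u x)) ≤ 0 := by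
  refine (h.integral_laplacian_mul_testFun_le hΩ hε (by positivity)).trans (le_of_eq ?_)
  refine integral_eq_zero_of_ae ?_
  filter_upwards [hbc, IsConvexC2Domain.ae_mem_frontier Ω] with y hy hyf
  have h1 := hg y (frontier_subset_closure hyf)
  rw [← hy] at h1
  have h2 : w y ≤ m := le_of_mul_le_mul_left ((le_abs_self _).trans h1) hb
  rw [testFun_eq_zero, mul_zero, Pi.zero_apply]
  exact pow_le_pow_left₀ (le_max_right _ _) (max_le h2 hm) 4

/-- The flux is bounded by a small multiple of `∫ w h(w)` over `∂Ω` plus a constant. Star-shapedness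
turns this into the boundary integral of `w h(w) n · (y - x₀)`, which the divergence theorem
expresses by integrals over `Ω` that the dissipation and `∫ u⁵` absorb. -/
theorem IsConvexC2Domain.exists_neumann_bound (hΩ : IsConvexC2Domain Ω) {a : ℝ} (ha : a ≠ 0) :
    ∃ C : ℝ, 0 < C ∧ ∀ {u w : E3 → ℝ} {Du v : Fin 3 → E3 → ℝ} {D2 : Fin 3 → Fin 3 → E3 → ℝ}
      {g : E3 → ℝ} {N ε : ℝ}, HasTraces Ω u w Du v D2 → 0 < ε →
      (∀ᵐ y ∂(surfaceMeasure Ω), a * ∑ i, v i y * outwardNormal Ω y i = g y) →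
      (∀ y ∈ closure Ω, |g y| ≤ N) → 0 ≤ N →
      Integrable (fun x => max (u x) 0 ^ 5) (volume.restrict Ω) →
      (∫ x in Ω, (∑ i, D2 i i x) * testFun 0 ε (u x)) ≤
        (∫ x in Ω, max (u x) 0 ^ 5) + C * N ^ 5 := by
  have := hΩ.isFiniteMeasure_surfaceMeasure
  obtain ⟨x₀, hx₀⟩ := hΩ.nonempty
  obtain ⟨r, hr, hball⟩ := Metric.nhds_basis_closedBall.mem_iff.1 (hΩ.isOpen.mem_nhds hx₀)
  obtain ⟨R, hR⟩ := hΩ.bounded.subset_closedBall x₀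
  have hR0 : 0 ≤ R := by simpa using hR hx₀
  -- In `q` the part `3/r` comes from the divergence of `x - x₀`, and the other part from absorbing
  -- the gradient term, where `13 = 1 + 12` bounds `h + s h'` by `13 h` and `R` bounds `|x - x₀|`.
  -- The choice of `δ` brings the coefficient of `∫ u⁵` below `1`.
  set q : ℝ := 3 / r + (13 * R / r) ^ 2 / 16 with hq
  have hq0 : 0 ≤ q := by positivity
  set δ : ℝ := 1 / (1 + q) with hδ
  have hδ0 : 0 < δ := by positivity
  have hδ1 : δ ≤ 1 := by rw [hδ, div_le_one (by positivity)]; linarith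
  have hδq : δ * q ≤ 1 := by
    rw [hδ, div_mul_eq_mul_div, one_mul, div_le_one (by positivity)]; linarith
  set A := (surfaceMeasure Ω).real univ with hA
  have hA0 : 0 ≤ A := measureReal_nonneg
  -- The summand `1` only makes the constant visibly positive.
  refine ⟨A / |a| ^ 5 / δ ^ 4 + 1, by positivity, ?_⟩
  intro u w Du v D2 g N ε h hε hbc hg hN hP
  have hk : ∀ s, HasDerivAt (fun s => s * testFun 0 ε s)
      (testFun 0 ε s + s * testFunDeriv 0 ε s) s := fun s =>
    ((hasDerivAt_id' s).mul (hasDerivAt_testFun hε 0 s)).congr_deriv (by rw [one_mul])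
  have hkc : Continuous fun s => testFun 0 ε s + s * testFunDeriv 0 ε s :=
    (continuous_testFun hε 0).add (continuous_id.mul (continuous_testFunDeriv hε 0))
  obtain ⟨hI1, hI2, hI⟩ := h.integral_mul_inner_normal hΩ hk hkc (abs_testFun_add_mul_le hε)
    (zero_mul _) x₀
  have hk0 : ∀ s, 0 ≤ s * testFun 0 ε s := fun s => by
    rcases le_total s 0 with hs | hs
    · rw [testFun_eq_zero (by rw [max_eq_right hs]; norm_num), mul_zero]
    · exact mul_nonneg hs (testFun_nonneg hε 0 s)
  have hbd : (∫ y, (∑ i, v i y * outwardNormal Ω y i) * testFun 0 ε (w y) ∂(surfaceMeasure Ω)) ≤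
      ∫ y, (δ / r * (w y * testFun 0 ε (w y) * ⟪outwardNormal Ω y, y - x₀⟫) +
        N ^ 5 / |a| ^ 5 / δ ^ 4) ∂(surfaceMeasure Ω) := by
    refine integral_mono_ae ?_ ((hI1.const_mul _).add (integrable_const _)) ?_
    · simp_rw [Finset.sum_mul, mul_right_comm _ (outwardNormal Ω _ _)]
      exact integrable_finsetSum _ fun i _ => h.integrable_normal_mul hΩ (hasDerivAt_testFun hε 0)
        (abs_testFunDeriv_le hε le_rfl) (testFun_zero_right le_rfl) i
    · filter_upwards [hbc, IsConvexC2Domain.ae_mem_frontier Ω] with y hy hyf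
      have h1 : ∑ i, v i y * outwardNormal Ω y i = g y / a := by
        rw [eq_div_iff ha]; linarith
      have h2 : g y / a ≤ N / |a| := by
        refine (le_abs_self _).trans ?_
        rw [abs_div]
        gcongr
        exact hg y (frontier_subset_closure hyf)
      have h3 := hΩ.le_inner_outwardNormal hr.le hyf hball
      have h4 := mul_testFun_le_add (w := w y) (by positivity : 0 ≤ N / |a|) hδ0 hε
      have h5 : δ * (w y * testFun 0 ε (w y)) ≤
          δ / r * (w y * testFun 0 ε (w y) * ⟪outwardNormal Ω y, y - x₀⟫) := by
        have := mul_le_mul_of_nonneg_left h3 (mul_nonneg (div_nonneg hδ0.le hr.le) (hk0 (w y)))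
        calc _ = δ / r * (w y * testFun 0 ε (w y)) * r := by field_simp
          _ ≤ _ := this
          _ = _ := by ring
      simp only [h1]
      have h6 := mul_le_mul_of_nonneg_right h2 (testFun_nonneg hε 0 (w y))
      rw [div_pow] at h4
      linarith
  rw [integral_add (hI1.const_mul _) (integrable_const _), integral_const_mul, hI,
    integral_const, smul_eq_mul, ← hA] at hbd
  rw [h.integral_laplacian_mul_testFun hΩ hε le_rfl]
  have hI3 : Integrable (fun x => testFunDeriv 0 ε (u x) * ∑ i, Du i x ^ 2) (volume.restrict Ω) := by
    simp_rw [Finset.mul_sum]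
    exact integrable_finsetSum _ fun i _ =>
      h.integrable_deriv_mul_sq (continuous_testFunDeriv hε 0) (abs_testFunDeriv_le hε le_rfl) i
  have hin : δ / r * (∫ x in Ω, 3 * (u x * testFun 0 ε (u x)) +
      (testFun 0 ε (u x) + u x * testFunDeriv 0 ε (u x)) * ∑ i, Du i x * (x - x₀) i) ≤
      (∫ x in Ω, testFunDeriv 0 ε (u x) * ∑ i, Du i x ^ 2) + ∫ x in Ω, max (u x) 0 ^ 5 := by
    rw [← integral_const_mul, ← integral_add hI3 hP]
    refine integral_mono_ae (hI2.const_mul _) (hI3.add hP) ?_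
    filter_upwards [ae_restrict_mem hΩ.isOpen.measurableSet] with x hx
    set D := Real.sqrt (∑ i, Du i x ^ 2) with hD
    have hD2 : D ^ 2 = ∑ i, Du i x ^ 2 := Real.sq_sqrt (Finset.sum_nonneg fun i _ => sq_nonneg _)
    have hDx : |∑ i, Du i x * (x - x₀) i| ≤ D * R := by
      refine abs_le_of_sq_le_sq ?_ (by positivity)
      refine (Finset.sum_mul_sq_le_sq_mul_sq _ _ _).trans ?_
      rw [mul_pow, hD2]
      gcongr
      rw [← EuclideanSpace.real_norm_sq_eq]
      gcongr
      simpa [dist_eq_norm] using hR hx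
    have h0 := testFun_nonneg hε 0 (u x)
    have h1 : |testFun 0 ε (u x) + u x * testFunDeriv 0 ε (u x)| ≤ 13 * testFun 0 ε (u x) := by
      have h3 := mul_testFunDeriv_le hε (u x)
      have h4 : 0 ≤ u x * testFunDeriv 0 ε (u x) := by
        rw [mul_testFunDeriv_zero_eq]
        exact mul_nonneg (le_max_right _ _) (testFunDeriv_nonneg hε 0 _)
      rw [abs_of_nonneg (by linarith)]
      linarith
    have h2 : u x * testFun 0 ε (u x) ≤ max (u x) 0 ^ 5 := by
      have h3 := testFun_le_pow hε le_rfl (u x)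
      calc u x * testFun 0 ε (u x) ≤ max (u x) 0 * testFun 0 ε (u x) :=
            mul_le_mul_of_nonneg_right (le_max_left _ _) h0
        _ ≤ max (u x) 0 * max (u x) 0 ^ 4 :=
            mul_le_mul_of_nonneg_left h3 (le_max_right _ _)
        _ = _ := by ring
    have h3 : (testFun 0 ε (u x) + u x * testFunDeriv 0 ε (u x)) * ∑ i, Du i x * (x - x₀) i ≤
        13 * testFun 0 ε (u x) * (D * R) := by
      refine (le_abs_self _).trans ?_
      rw [abs_mul]
      gcongr
    -- The gradient term `c h(u) |∇u|` is split into the dissipation and a multiple of `u⁵`; the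
    -- latter carries `δ² ≤ δ`.
    have h4 := mul_testFun_mul_le (c := δ * (13 * R / r)) (d := D) (u := u x) hε
    rw [hD2] at h4
    have hP0 : 0 ≤ max (u x) 0 ^ 5 := pow_nonneg (le_max_right _ _) 5
    calc δ / r * (3 * (u x * testFun 0 ε (u x)) +
          (testFun 0 ε (u x) + u x * testFunDeriv 0 ε (u x)) * ∑ i, Du i x * (x - x₀) i)
        ≤ δ / r * (3 * max (u x) 0 ^ 5 + 13 * testFun 0 ε (u x) * (D * R)) := by gcongr
      _ = δ * (3 / r) * max (u x) 0 ^ 5 + δ * (13 * R / r) * testFun 0 ε (u x) * D := by ring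
      _ ≤ δ * (3 / r) * max (u x) 0 ^ 5 + (testFunDeriv 0 ε (u x) * ∑ i, Du i x ^ 2 +
          (δ * (13 * R / r)) ^ 2 / 16 * max (u x) 0 ^ 5) := by gcongr
      _ = testFunDeriv 0 ε (u x) * ∑ i, Du i x ^ 2 +
          (δ * (3 / r) + δ ^ 2 * ((13 * R / r) ^ 2 / 16)) * max (u x) 0 ^ 5 := by ring
      _ ≤ testFunDeriv 0 ε (u x) * ∑ i, Du i x ^ 2 + 1 * max (u x) 0 ^ 5 := by
          gcongr
          refine le_trans ?_ hδq
          rw [hq, mul_add]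
          gcongr
          nlinarith
      _ = _ := by ring
  have hN5 : 0 ≤ N ^ 5 := by positivity
  have e : (A / |a| ^ 5 / δ ^ 4 + 1) * N ^ 5 = A * (N ^ 5 / |a| ^ 5 / δ ^ 4) + N ^ 5 := by ring
  rw [e]
  linarith

end Slices

/-! ### The energy estimate -/

theorem IsConvexC2Domain.isFiniteMeasure_restrict_cylinder {Ω : Set E3} (hΩ : IsConvexC2Domain Ω)
    (τ : ℝ) : IsFiniteMeasure (volume.restrict (spaceTimeCylinder τ Ω)) := by
  have := hΩ.isFiniteMeasure_restrict
  rw [restrict_spaceTimeCylinder]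
  infer_instance

theorem integral_cylinder_le {Ω : Set E3} {τ : ℝ} {F : ℝ × E3 → ℝ} {B : ℝ → ℝ}
    (hF : Integrable F (volume.restrict (spaceTimeCylinder τ Ω)))
    (hB : Integrable B (volume.restrict (Ioo 0 τ)))
    (h : ∀ᵐ t ∂(volume.restrict (Ioo 0 τ)), ∫ x in Ω, F (t, x) ≤ B t) :
    ∫ q in spaceTimeCylinder τ Ω, F q ≤ ∫ t in Ioo 0 τ, B t := by
  rw [restrict_spaceTimeCylinder] at hF ⊢
  rw [integral_prod _ hF]
  exact integral_mono_ae hF.integral_prod_left hB h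

section Energy

variable {Ω : Set E3} {a b θ τ : ℝ} {G g T Tt : ℝ × E3 → ℝ} {T₀ : E3 → ℝ}
  {DT : Fin 3 → ℝ × E3 → ℝ} {D2T : Fin 3 → Fin 3 → ℝ × E3 → ℝ} {M β : ℝ}

/-- The equation expresses `T⁴` through `G`, `∂ₜT` and `ΔT`, all of which are in `L²`. Thus
`‖T‖_{L⁸}` is finite beforehand, and multiples of `∫ T⁸` may be absorbed. -/
theorem memLp_pow_four (hθ : 0 < θ)
    (hW : HasW21Derivs 2 (spaceTimeCylinder τ Ω) T Tt DT D2T)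
    (heq : ∀ᵐ q ∂(volume.restrict (spaceTimeCylinder τ Ω)),
      Tt q - ∑ i, D2T i i q + 4 * Real.pi * θ * T q ^ 4 = θ * G q)
    (hG : MemLp G 2 (volume.restrict (spaceTimeCylinder τ Ω))) :
    MemLp (fun q => T q ^ 4) 2 (volume.restrict (spaceTimeCylinder τ Ω)) := by
  have h1 := (((hG.const_mul θ).sub hW.memLp_time).add
    (memLp_finsetSum Finset.univ fun i _ => hW.memLp_hess i i)).const_mul (4 * Real.pi * θ)⁻¹
  refine h1.ae_eq ?_
  filter_upwards [heq] with q hq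
  have := Real.pi_pos
  simp only [Pi.add_apply, Pi.sub_apply]
  rw [inv_mul_eq_iff_eq_mul₀ (by positivity)]
  linarith

theorem mul_testFun_le_young {ε G T : ℝ} (hε : 0 < ε) (hM : 0 ≤ M) (hT : 0 ≤ T) :
    G * testFun M ε T ≤ 2 * Real.pi * (T ^ 4 * testFun M ε T) + 1 / (8 * Real.pi) * G ^ 2 := by
  have h0 := testFun_nonneg hε M T
  have h1 := testFun_le_pow hε hM T
  rw [max_eq_left hT] at h1
  have h2 := mul_le_mul_of_nonneg_right h1 h0
  have hpi := Real.pi_pos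
  have h3 : 2 * (2 * Real.pi * testFun M ε T) * G ≤ (2 * Real.pi * testFun M ε T) ^ 2 * 2 + G ^ 2 / 2 := by
    nlinarith [sq_nonneg (2 * Real.pi * testFun M ε T * 2 - G)]
  have h4 : G * testFun M ε T ≤ 2 * Real.pi * testFun M ε T ^ 2 + 1 / (8 * Real.pi) * G ^ 2 := by
    have e : 2 * Real.pi * testFun M ε T ^ 2 + 1 / (8 * Real.pi) * G ^ 2 - G * testFun M ε T =
      ((2 * Real.pi * testFun M ε T) ^ 2 * 2 + G ^ 2 / 2 - 2 * (2 * Real.pi * testFun M ε T) * G) /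
        (4 * Real.pi) := by field_simp; ring
    have : 0 ≤ 2 * Real.pi * testFun M ε T ^ 2 + 1 / (8 * Real.pi) * G ^ 2 - G * testFun M ε T := by
      rw [e]
      exact div_nonneg (by linarith) (by positivity)
    linarith
  refine h4.trans ?_
  have h5 : testFun M ε T ^ 2 ≤ T ^ 4 * testFun M ε T := by linarith [sq (testFun M ε T)]
  gcongr

theorem integral_pow_four_mul_testFun_le (hΩ : IsConvexC2Domain Ω) (hτ : 0 < τ) (hθ : 0 < θ)
    (hW : HasW21Derivs 2 (spaceTimeCylinder τ Ω) T Tt DT D2T)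
    (hT : ∀ᵐ q ∂(volume.restrict (spaceTimeCylinder τ Ω)), 0 ≤ T q)
    (heq : ∀ᵐ q ∂(volume.restrict (spaceTimeCylinder τ Ω)),
      Tt q - ∑ i, D2T i i q + 4 * Real.pi * θ * T q ^ 4 = θ * G q)
    (hG : MemLp G 2 (volume.restrict (spaceTimeCylinder τ Ω)))
    (hT₀ : MemLp T₀ 2 (volume.restrict Ω)) (hT₀n : ∀ᵐ x ∂(volume.restrict Ω), 0 ≤ T₀ x)
    (hT₀i : Integrable (fun x => T₀ x ^ 5) (volume.restrict Ω))
    (hl : Tendsto (fun t => eLpNorm (fun x => T (t, x) - T₀ x) 2 (volume.restrict Ω))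
      (𝓝[>] 0 ⊓ ae volume) (𝓝 0)) {ε : ℝ} (hε : 0 < ε) (hM : 0 ≤ M)
    (hβ : ∫ q in spaceTimeCylinder τ Ω, (∑ i, D2T i i q) * testFun M ε (T q) ≤ β) :
    2 * Real.pi * θ * ∫ q in spaceTimeCylinder τ Ω, T q ^ 4 * testFun M ε (T q) ≤
      θ / (8 * Real.pi) * (∫ q in spaceTimeCylinder τ Ω, G q ^ 2) +
        1 / 5 * (∫ x in Ω, T₀ x ^ 5) + β := by
  have := hΩ.isFiniteMeasure_restrict_cylinder τ
  have hh : ∀ {f : ℝ × E3 → ℝ}, MemLp f 2 (volume.restrict (spaceTimeCylinder τ Ω)) →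
      Integrable (fun q => f q * testFun M ε (T q)) (volume.restrict (spaceTimeCylinder τ Ω)) :=
    fun hf => (hf.integrable one_le_two).mul_bdd (c := 1 / ε)
      ((continuous_testFun hε M).comp_aestronglyMeasurable hW.memLp.1)
      (Eventually.of_forall fun q => abs_testFun_le hε M _)
  have h4 := hh (memLp_pow_four hθ hW heq hG)
  have hGi := hh hG
  have ht : Integrable (fun q => testFun M ε (T q) * Tt q)
      (volume.restrict (spaceTimeCylinder τ Ω)) := by
    simpa only [mul_comm] using hh hW.memLp_time
  have hL : Integrable (fun q => (∑ i, D2T i i q) * testFun M ε (T q))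
      (volume.restrict (spaceTimeCylinder τ Ω)) := by
    have := hh (memLp_finsetSum Finset.univ fun i _ => hW.memLp_hess i i)
    simpa only [Finset.sum_apply] using this
  have hB := neg_integral_mul_timeDeriv_le hΩ hτ hW.memLp hW.memLp_time hW.weakDeriv_time hT₀ hl
    (hasDerivAt_testFunPrimitive hε M) (continuous_testFun hε M) (abs_testFun_le hε M)
    (testFunPrimitive_nonneg hε hM) (hT₀i.div_const 5) (by
      filter_upwards [hT₀n] with x hx using testFunPrimitive_le hε hM hx)
  rw [integral_div] at hB
  have h1 : (∫ q in spaceTimeCylinder τ Ω, 2 * Real.pi * θ * (T q ^ 4 * testFun M ε (T q))) ≤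
      ∫ q in spaceTimeCylinder τ Ω, (θ / (8 * Real.pi) * G q ^ 2 - testFun M ε (T q) * Tt q +
        (∑ i, D2T i i q) * testFun M ε (T q)) := by
    refine integral_mono_ae (h4.const_mul _)
      (((hG.integrable_sq.const_mul _).sub ht).add hL) ?_
    filter_upwards [heq, hT] with q hq hq0
    have := mul_le_mul_of_nonneg_left (mul_testFun_le_young (G := G q) hε hM hq0) hθ.le
    have e := congrArg (· * testFun M ε (T q)) hq
    simp only [add_mul, sub_mul] at e
    have e2 : θ / (8 * Real.pi) * G q ^ 2 = θ * (1 / (8 * Real.pi) * G q ^ 2) := by ring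
    rw [e2]
    linarith
  have h2 : ∫ q in spaceTimeCylinder τ Ω, (θ / (8 * Real.pi) * G q ^ 2 - testFun M ε (T q) * Tt q +
        (∑ i, D2T i i q) * testFun M ε (T q)) =
      θ / (8 * Real.pi) * (∫ q in spaceTimeCylinder τ Ω, G q ^ 2) -
      (∫ q in spaceTimeCylinder τ Ω, testFun M ε (T q) * Tt q) +
      ∫ q in spaceTimeCylinder τ Ω, (∑ i, D2T i i q) * testFun M ε (T q) := by
    rw [← integral_const_mul]
    refine (integral_add (f := fun q => θ / (8 * Real.pi) * G q ^ 2 - testFun M ε (T q) * Tt q)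
      ((hG.integrable_sq.const_mul _).sub ht) hL).trans ?_
    congr 1
    exact integral_sub (hG.integrable_sq.const_mul _) ht
  rw [integral_const_mul, h2] at h1
  linarith

/-- As `ε → 0` the integrand `T⁴ h(T)` is dominated by `T⁸`, which is integrable by
`memLp_pow_four`. -/
theorem integral_pow_four_mul_powExcess_le (hΩ : IsConvexC2Domain Ω) (hτ : 0 < τ) (hθ : 0 < θ)
    (hW : HasW21Derivs 2 (spaceTimeCylinder τ Ω) T Tt DT D2T)
    (hT : ∀ᵐ q ∂(volume.restrict (spaceTimeCylinder τ Ω)), 0 ≤ T q)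
    (heq : ∀ᵐ q ∂(volume.restrict (spaceTimeCylinder τ Ω)),
      Tt q - ∑ i, D2T i i q + 4 * Real.pi * θ * T q ^ 4 = θ * G q)
    (hG : MemLp G 2 (volume.restrict (spaceTimeCylinder τ Ω)))
    (hT₀ : MemLp T₀ 2 (volume.restrict Ω)) (hT₀n : ∀ᵐ x ∂(volume.restrict Ω), 0 ≤ T₀ x)
    (hT₀i : Integrable (fun x => T₀ x ^ 5) (volume.restrict Ω))
    (hl : Tendsto (fun t => eLpNorm (fun x => T (t, x) - T₀ x) 2 (volume.restrict Ω))
      (𝓝[>] 0 ⊓ ae volume) (𝓝 0)) (hM : 0 ≤ M)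
    (hβ : ∀ ε, 0 < ε →
      ∫ q in spaceTimeCylinder τ Ω, (∑ i, D2T i i q) * testFun M ε (T q) ≤ β) :
    2 * Real.pi * θ * ∫ q in spaceTimeCylinder τ Ω, T q ^ 4 * powExcess M (T q) ≤
      θ / (8 * Real.pi) * (∫ q in spaceTimeCylinder τ Ω, G q ^ 2) +
        1 / 5 * (∫ x in Ω, T₀ x ^ 5) + β := by
  have h4 := memLp_pow_four hθ hW heq hG
  have hlim : Tendsto (fun ε => ∫ q in spaceTimeCylinder τ Ω, T q ^ 4 * testFun M ε (T q))
      (𝓝[>] (0 : ℝ)) (𝓝 (∫ q in spaceTimeCylinder τ Ω, T q ^ 4 * powExcess M (T q))) := by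
    refine tendsto_integral_filter_of_dominated_convergence (fun q => (T q ^ 4) ^ 2) ?_ ?_
      h4.integrable_sq ?_
    · filter_upwards [self_mem_nhdsWithin] with ε hε
      exact h4.1.mul ((continuous_testFun hε M).comp_aestronglyMeasurable hW.memLp.1)
    · filter_upwards [self_mem_nhdsWithin] with ε hε
      filter_upwards [hT] with q hq
      have h1 := testFun_le_pow hε hM (T q)
      rw [max_eq_left hq] at h1
      rw [norm_mul, Real.norm_of_nonneg (testFun_nonneg hε M _),
        Real.norm_of_nonneg (by positivity), sq]
      gcongr
    · exact Eventually.of_forall fun q => (tendsto_testFun M (T q)).const_mul _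
  refine le_of_tendsto (hlim.const_mul _) ?_
  filter_upwards [self_mem_nhdsWithin] with ε hε
  exact integral_pow_four_mul_testFun_le hΩ hτ hθ hW hT heq hG hT₀ hT₀n hT₀i hl hε hM (hβ ε hε)

/-- The common core of the three cases: the boundary condition enters only through the level `M` and
the bound `B` for the diffusion term on almost every time slice, uniform in `ε`. -/
theorem IsNonnegSolution.energy_le (h : IsNonnegSolution a b θ τ Ω G g T₀ T)
    (hΩ : IsConvexC2Domain Ω) (hτ : 0 < τ) (hθ : 0 < θ)
    (hG : MemLp G 2 (volume.restrict (spaceTimeCylinder τ Ω))) (hT₀ : IsInitialDatum Ω T₀)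
    (hT₀i : Integrable (fun x => T₀ x ^ 5) (volume.restrict Ω)) (hM : 0 ≤ M) {B : ℝ → ℝ}
    (hB : Integrable B (volume.restrict (Ioo 0 τ)))
    (hs : ∀ ε, 0 < ε → ∀ᵐ t ∂(volume.restrict (Ioo 0 τ)), ∀ w Du v D2,
      HasTraces Ω (fun x => T (t, x)) w Du v D2 →
      (∀ᵐ x ∂(surfaceMeasure Ω), a * ∑ i, v i x * outwardNormal Ω x i + b * w x = g (t, x)) →
      ∫ x in Ω, (∑ i, D2 i i x) * testFun M ε (T (t, x)) ≤ B t) :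
    2 * Real.pi * θ * ∫ q in spaceTimeCylinder τ Ω, T q ^ 4 * powExcess M (T q) ≤
      θ / (8 * Real.pi) * (∫ q in spaceTimeCylinder τ Ω, G q ^ 2) +
        1 / 5 * (∫ x in Ω, T₀ x ^ 5) + ∫ t in Ioo 0 τ, B t := by
  have := hΩ.isFiniteMeasure_restrict_cylinder τ
  obtain ⟨Tt, DT, D2T, hW, hT, heq, hbc, hl⟩ := h
  obtain ⟨DT₀, hDT₀⟩ := hT₀.sobolev
  refine integral_pow_four_mul_powExcess_le hΩ hτ hθ hW hT heq hG hDT₀.memLp hT₀.nonneg hT₀i hl hM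
    fun ε hε => integral_cylinder_le ?_ hB ?_
  · have h1 := (memLp_finsetSum Finset.univ fun i _ => hW.memLp_hess i i).integrable one_le_two
    have h2 := h1.mul_bdd (c := 1 / ε)
      ((continuous_testFun hε M).comp_aestronglyMeasurable hW.memLp.1)
      (Eventually.of_forall fun q => abs_testFun_le hε M _)
    simpa only [Finset.sum_apply] using h2
  · filter_upwards [ae_hasTraces hΩ hW, hbc, hs ε hε] with t h1 ⟨w, v, hw, hv, hwv⟩ h2
    exact h2 w _ v _ (h1 w v hw hv) hwv

theorem IsNonnegSolution.memLp_pow_four (h : IsNonnegSolution a b θ τ Ω G g T₀ T) (hθ : 0 < θ)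
    (hG : MemLp G 2 (volume.restrict (spaceTimeCylinder τ Ω))) :
    MemLp T 2 (volume.restrict (spaceTimeCylinder τ Ω)) ∧
    MemLp (fun q => T q ^ 4) 2 (volume.restrict (spaceTimeCylinder τ Ω)) ∧
    ∀ᵐ q ∂(volume.restrict (spaceTimeCylinder τ Ω)), 0 ≤ T q := by
  obtain ⟨Tt, DT, D2T, hW, hT, heq, hbc, hl⟩ := h
  exact ⟨hW.memLp, _root_.memLp_pow_four hθ hW heq hG, hT⟩

end Energy

/-! ### Integrals of powers as norms -/

theorem eLpNorm_pow_eq_lintegral {α : Type*} [MeasurableSpace α] {μ : Measure α} (f : α → ℝ)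
    {n : ℕ} (hn : n ≠ 0) : eLpNorm f n μ ^ n = ∫⁻ x, ‖f x‖ₑ ^ n ∂μ := by
  have h := eLpNorm_nnreal_pow_eq_lintegral (f := f) (μ := μ) (p := (n : ℝ≥0))
    (by exact_mod_cast hn)
  simpa using h

theorem eLpNorm_pow_eq_ofReal {α : Type*} [MeasurableSpace α] {μ : Measure α} {f : α → ℝ}
    {n : ℕ} (hn : n ≠ 0) (hf : ∀ᵐ x ∂μ, |f x| ^ n = f x ^ n)
    (hi : Integrable (fun x => f x ^ n) μ) :
    eLpNorm f n μ ^ n = ENNReal.ofReal (∫ x, f x ^ n ∂μ) := by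
  rw [eLpNorm_pow_eq_lintegral f hn, ofReal_integral_eq_lintegral_ofReal hi]
  · refine lintegral_congr_ae ?_
    filter_upwards [hf] with x hx
    rw [← hx, ENNReal.ofReal_pow (abs_nonneg _), Real.enorm_eq_ofReal_abs]
  · filter_upwards [hf] with x hx
    rw [← hx]
    exact pow_nonneg (abs_nonneg _) n

theorem integrable_pow_of_eLpNorm_ne_top {α : Type*} [MeasurableSpace α] {μ : Measure α} {f : α → ℝ}
    {n : ℕ} (hn : n ≠ 0) (hf : AEStronglyMeasurable f μ) (h : eLpNorm f n μ ^ n ≠ ⊤) :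
    Integrable (fun x => f x ^ n) μ := by
  refine ⟨hf.pow n, ?_⟩
  rw [eLpNorm_pow_eq_lintegral f hn] at h
  rw [HasFiniteIntegral]
  simp_rw [enorm_pow]
  exact h.lt_top

/-! ### The estimates -/

section Estimates

variable {Ω : Set E3} {a b θ τ : ℝ} {G g T : ℝ × E3 → ℝ} {T₀ : E3 → ℝ}

theorem enorm_le_supNormClosure {t : ℝ} (ht : t ∈ Ioo 0 τ) {x : E3} (hx : x ∈ closure Ω) :
    ‖g (t, x)‖ₑ ≤ supNormClosure τ Ω g :=
  (le_iSup₂ (f := fun x (_ : x ∈ closure Ω) => ‖g (t, x)‖ₑ) x hx).trans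
    (le_iSup₂ (f := fun t (_ : t ∈ Ioo 0 τ) => ⨆ x ∈ closure Ω, ‖g (t, x)‖ₑ) t ht)

theorem IsNonnegSolution.normCylinder_eq (h : IsNonnegSolution a b θ τ Ω G g T₀ T) (hθ : 0 < θ)
    (hG : MemLp G 2 (volume.restrict (spaceTimeCylinder τ Ω))) :
    Integrable (fun q => T q ^ 8) (volume.restrict (spaceTimeCylinder τ Ω)) ∧
    normCylinder 8 τ Ω T ^ 8 = ENNReal.ofReal (∫ q in spaceTimeCylinder τ Ω, T q ^ 8) := by
  have h4 := (h.memLp_pow_four hθ hG).2.1.integrable_sq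
  simp_rw [← pow_mul] at h4
  exact ⟨h4, eLpNorm_pow_eq_ofReal (n := 8) (by norm_num)
    (Eventually.of_forall fun q => by rw [← abs_pow]; exact abs_of_nonneg (by positivity)) h4⟩

theorem normCylinder_two_sq (hG : MemLp G 2 (volume.restrict (spaceTimeCylinder τ Ω))) :
    normCylinder 2 τ Ω G ^ 2 = ENNReal.ofReal (∫ q in spaceTimeCylinder τ Ω, G q ^ 2) :=
  eLpNorm_pow_eq_ofReal (n := 2) (by norm_num)
    (Eventually.of_forall fun q => sq_abs _) hG.integrable_sq

theorem IsInitialDatum.integrable_pow_five (hT₀ : IsInitialDatum Ω T₀)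
    (h : normDomain 5 Ω T₀ ^ 5 ≠ ⊤) :
    Integrable (fun x => T₀ x ^ 5) (volume.restrict Ω) ∧
    normDomain 5 Ω T₀ ^ 5 = ENNReal.ofReal (∫ x in Ω, T₀ x ^ 5) ∧ 0 ≤ ∫ x in Ω, T₀ x ^ 5 := by
  obtain ⟨DT₀, hD⟩ := hT₀.sobolev
  have hi := integrable_pow_of_eLpNorm_ne_top (n := 5) (by norm_num) hD.memLp.1 h
  refine ⟨hi, eLpNorm_pow_eq_ofReal (n := 5) (by norm_num) ?_ hi, integral_nonneg_of_ae ?_⟩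
  · filter_upwards [hT₀.nonneg] with x hx
    rw [abs_of_nonneg hx]
  · filter_upwards [hT₀.nonneg] with x hx using pow_nonneg hx 5

theorem le_of_ne_top_imp_le {x y : ℝ≥0∞} (h : y ≠ ⊤ → x ≤ y) : x ≤ y := by
  by_cases hy : y = ⊤
  · rw [hy]; exact le_top
  · exact h hy

theorem ne_top_of_ofReal_mul_ne_top {c : ℝ} (hc : 0 < c) {x : ℝ≥0∞}
    (h : ENNReal.ofReal c * x ≠ ⊤) : x ≠ ⊤ := by
  rintro rfl
  exact h (ENNReal.mul_top (ENNReal.ofReal_pos.2 hc).ne')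

theorem setIntegral_Ioo_const (hτ : 0 < τ) (c : ℝ) : ∫ _ in Ioo 0 τ, c = τ * c := by
  simp [hτ.le]

theorem integral_cylinder_const (hτ : 0 < τ) (c : ℝ) :
    ∫ _ in spaceTimeCylinder τ Ω, c = τ * (domainVolume Ω).toReal * c := by
  rw [integral_const, smul_eq_mul, measureReal_def, Measure.restrict_apply_univ, spaceTimeCylinder,
    Measure.volume_eq_prod, Measure.prod_prod, ENNReal.toReal_mul]
  simp [hτ.le, domainVolume]

/-! ### The Robin estimate -/

theorem IsNonnegSolution.robin_estimate (h : IsNonnegSolution a b θ τ Ω G g T₀ T)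
    (hΩ : IsConvexC2Domain Ω) (hab : 0 < a * b) (hτ : 0 < τ) (hθ : 0 < θ)
    (hG : MemLp G 2 (volume.restrict (spaceTimeCylinder τ Ω))) (hT₀ : IsInitialDatum Ω T₀) :
    normCylinder 8 τ Ω T ^ 8 ≤
      ENNReal.ofReal (1 / (16 * Real.pi ^ 2)) * normCylinder 2 τ Ω G ^ 2
      + ENNReal.ofReal (1 / (|a| * |b| ^ 4) / (2 * Real.pi * θ) * τ) * boundaryArea Ω *
        supNormClosure τ Ω g ^ 5
      + ENNReal.ofReal (1 / (10 * Real.pi * θ)) * normDomain 5 Ω T₀ ^ 5 := by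
  have ha : a ≠ 0 := left_ne_zero_of_mul hab.ne'
  have hb : b ≠ 0 := right_ne_zero_of_mul hab.ne'
  have hpi := Real.pi_pos
  -- An infinite right side leaves nothing to prove; otherwise `T₀⁵` is integrable and the boundary
  -- bound finite, so the argument can be carried out in real numbers.
  refine le_of_ne_top_imp_le fun htop => ?_
  simp only [ENNReal.add_ne_top] at htop
  obtain ⟨⟨-, h1⟩, h2⟩ := htop
  obtain ⟨h5, e5, h50⟩ := hT₀.integrable_pow_five (ne_top_of_ofReal_mul_ne_top (by positivity) h2)
  obtain ⟨h8, e8⟩ := h.normCylinder_eq hθ hG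
  rw [mul_assoc] at h1
  have hN : ENNReal.ofReal (1 / (|a| * |b| ^ 4)) * supNormClosure τ Ω g ^ 5 * boundaryArea Ω ≠ ⊤ := by
    rw [mul_assoc, mul_comm (supNormClosure τ Ω g ^ 5)]
    exact ENNReal.mul_ne_top ENNReal.ofReal_ne_top
      (ne_top_of_ofReal_mul_ne_top (by positivity) h1)
  have hmain := h.energy_le hΩ hτ hθ hG hT₀ h5 le_rfl (integrable_const
    (ENNReal.ofReal (1 / (|a| * |b| ^ 4)) * supNormClosure τ Ω g ^ 5 * boundaryArea Ω).toReal) (by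
    intro ε hε
    filter_upwards [ae_restrict_mem measurableSet_Ioo] with t ht w Du v D2 hu hbc
    exact hu.laplacian_le_of_robin hΩ hε hab hbc (fun y hy => enorm_le_supNormClosure ht hy) hN)
  rw [setIntegral_Ioo_const hτ] at hmain
  have eX : ∫ q in spaceTimeCylinder τ Ω, T q ^ 4 * powExcess 0 (T q) =
      ∫ q in spaceTimeCylinder τ Ω, T q ^ 8 := by
    refine integral_congr_ae ?_
    filter_upwards [(h.memLp_pow_four hθ hG).2.2] with q hq
    rw [powExcess_zero_left, max_eq_left hq]
    ring
  rw [eX] at hmain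
  rw [e8, e5, normCylinder_two_sq hG]
  set K := ENNReal.ofReal (1 / (|a| * |b| ^ 4)) * supNormClosure τ Ω g ^ 5 * boundaryArea Ω with hK
  have eK : ENNReal.ofReal (1 / (|a| * |b| ^ 4) / (2 * Real.pi * θ) * τ) * boundaryArea Ω *
        supNormClosure τ Ω g ^ 5 = ENNReal.ofReal (τ / (2 * Real.pi * θ) * K.toReal) := by
    have hp : 0 ≤ τ / (2 * Real.pi * θ) := by positivity
    rw [show 1 / (|a| * |b| ^ 4) / (2 * Real.pi * θ) * τ =
      τ / (2 * Real.pi * θ) * (1 / (|a| * |b| ^ 4)) by ring, ENNReal.ofReal_mul hp,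
      ENNReal.ofReal_mul hp, ENNReal.ofReal_toReal hN, hK]
    ring
  have hG0 : 0 ≤ ∫ q in spaceTimeCylinder τ Ω, G q ^ 2 := integral_nonneg fun q => sq_nonneg _
  rw [eK, ← ENNReal.ofReal_mul (by positivity), ← ENNReal.ofReal_mul (by positivity),
    ← ENNReal.ofReal_add (by positivity) (by positivity),
    ← ENNReal.ofReal_add (by positivity) (by positivity)]
  refine ENNReal.ofReal_le_ofReal ?_
  refine le_of_mul_le_mul_left (hmain.trans (le_of_eq ?_)) (by positivity : 0 < 2 * Real.pi * θ)
  field_simp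
  ring

/-! ### The Neumann estimate -/

/-- If `κ s³ ≥ 1`, then `s⁵ ≤ κ s⁸`; otherwise `s⁶ ≤ 1/κ²` and `s⁵ ≤ 1 + s⁶`. -/
theorem pow_five_le {κ s : ℝ} (hκ : 0 < κ) (hs : 0 ≤ s) : s ^ 5 ≤ κ * s ^ 8 + (1 + 1 / κ ^ 2) := by
  rcases le_total 1 (κ * s ^ 3) with h | h
  · have h1 := mul_le_mul_of_nonneg_right h (pow_nonneg hs 5)
    have h2 : 0 ≤ 1 / κ ^ 2 := by positivity
    nlinarith
  · have h1 : s ^ 3 ≤ 1 / κ := by rw [le_div_iff₀ hκ]; linarith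
    have h2 : (s ^ 3) ^ 2 ≤ (1 / κ) ^ 2 := pow_le_pow_left₀ (by positivity) h1 2
    have h3 : s ^ 5 ≤ 1 + s ^ 6 := by
      rcases le_total s 1 with h4 | h4
      · have := pow_le_one₀ (n := 5) hs h4
        have : 0 ≤ s ^ 6 := by positivity
        linarith
      · have := pow_le_pow_right₀ h4 (show 5 ≤ 6 by norm_num)
        linarith
    have h5 : 0 ≤ κ * s ^ 8 := by positivity
    rw [div_pow, one_pow] at h2
    linarith [show (s ^ 3) ^ 2 = s ^ 6 by ring]

theorem IsConvexC2Domain.exists_neumann_estimate (hΩ : IsConvexC2Domain Ω) (ha : a ≠ 0)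
    (hθ : 0 < θ) : ∃ C : ℝ, 0 < C ∧ ∀ {τ : ℝ} {G g T : ℝ × E3 → ℝ} {T₀ : E3 → ℝ}, 0 < τ →
      MemLp G 2 (volume.restrict (spaceTimeCylinder τ Ω)) → IsInitialDatum Ω T₀ →
      IsNonnegSolution a 0 θ τ Ω G g T₀ T →
      normCylinder 8 τ Ω T ^ 8 ≤
        ENNReal.ofReal (5 / (64 * Real.pi ^ 2)) * normCylinder 2 τ Ω G ^ 2
        + ENNReal.ofReal τ * (ENNReal.ofReal
              ((1 + 1 / (2 * Real.pi * θ / 5) ^ 2) * (5 / (8 * Real.pi * θ))) * domainVolume Ω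
            + ENNReal.ofReal C * supNormClosure τ Ω g ^ 5)
        + ENNReal.ofReal (1 / (8 * Real.pi * θ)) * normDomain 5 Ω T₀ ^ 5 := by
  have hpi := Real.pi_pos
  obtain ⟨C, hC, hbound⟩ := hΩ.exists_neumann_bound ha
  refine ⟨C * (5 / (8 * Real.pi * θ)), by positivity, ?_⟩
  intro τ G g T T₀ hτ hG hT₀ h
  have := hΩ.isFiniteMeasure_restrict_cylinder τ
  refine le_of_ne_top_imp_le fun htop => ?_
  simp only [ENNReal.add_ne_top, mul_add] at htop
  obtain ⟨⟨-, -, h1⟩, h2⟩ := htop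
  obtain ⟨h5, e5, h50⟩ := hT₀.integrable_pow_five (ne_top_of_ofReal_mul_ne_top (by positivity) h2)
  obtain ⟨h8, e8⟩ := h.normCylinder_eq hθ hG
  obtain ⟨hT2, h4, hT⟩ := h.memLp_pow_four hθ hG
  have hN5 := ne_top_of_ofReal_mul_ne_top (by positivity) (ne_top_of_ofReal_mul_ne_top hτ h1)
  have hN : supNormClosure τ Ω g ≠ ⊤ := fun hN => hN5 (by rw [hN]; simp)
  set N := (supNormClosure τ Ω g).toReal with hNdef
  have hN0 : 0 ≤ N := ENNReal.toReal_nonneg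
  -- Absorbing `κ ∫ T⁸` with `κ` one fifth of `2πθ` leaves `8πθ/5` on the left, which produces the
  -- coefficients `5/(64π²)` and `1/(8πθ)`.
  set κ : ℝ := 2 * Real.pi * θ / 5 with hκdef
  have hκ : 0 < κ := by positivity
  have hT5le : ∀ᵐ q ∂(volume.restrict (spaceTimeCylinder τ Ω)),
      max (T q) 0 ^ 5 ≤ κ * T q ^ 8 + (1 + 1 / κ ^ 2) := by
    filter_upwards [hT] with q hq
    rw [max_eq_left hq]
    exact pow_five_le hκ hq
  have hdom : Integrable (fun q => κ * T q ^ 8 + (1 + 1 / κ ^ 2))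
      (volume.restrict (spaceTimeCylinder τ Ω)) := (h8.const_mul κ).add (integrable_const _)
  have hT5 : Integrable (fun q => max (T q) 0 ^ 5) (volume.restrict (spaceTimeCylinder τ Ω)) := by
    refine hdom.mono' ((continuous_id.max continuous_const).pow 5
      |>.comp_aestronglyMeasurable hT2.1) ?_
    filter_upwards [hT5le] with q hq
    rwa [Real.norm_of_nonneg (pow_nonneg (le_max_right _ _) 5)]
  have hT5' := hT5
  rw [restrict_spaceTimeCylinder] at hT5'
  have hmain := h.energy_le hΩ hτ hθ hG hT₀ h5 le_rfl
    (hT5'.integral_prod_left.add (integrable_const (C * N ^ 5))) (by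
    intro ε hε
    filter_upwards [ae_restrict_mem measurableSet_Ioo, hT5'.prod_right_ae]
      with t ht hi w Du v D2 hu hbc
    refine hbound (g := fun y => g (t, y)) hu hε ?_ ?_ hN0 hi
    · filter_upwards [hbc] with y hy
      rwa [zero_mul, add_zero] at hy
    · intro y hy
      rw [← Real.norm_eq_abs, ← toReal_enorm]
      exact ENNReal.toReal_mono hN (enorm_le_supNormClosure ht hy))
  have eB : ∫ t in Ioo 0 τ, ((fun t => ∫ x in Ω, max (T (t, x)) 0 ^ 5) + (fun _ => C * N ^ 5) : ℝ → ℝ) t =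
      (∫ q in spaceTimeCylinder τ Ω, max (T q) 0 ^ 5) + τ * (C * N ^ 5) := by
    refine (integral_add hT5'.integral_prod_left (integrable_const _)).trans ?_
    rw [setIntegral_Ioo_const hτ, restrict_spaceTimeCylinder, integral_prod _ hT5']
  have hT5int := integral_mono_ae hT5 hdom hT5le
  rw [integral_add (h8.const_mul κ) (integrable_const _), integral_const_mul,
    integral_cylinder_const hτ] at hT5int
  have eX : ∫ q in spaceTimeCylinder τ Ω, T q ^ 4 * powExcess 0 (T q) =
      ∫ q in spaceTimeCylinder τ Ω, T q ^ 8 := by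
    refine integral_congr_ae ?_
    filter_upwards [hT] with q hq
    rw [powExcess_zero_left, max_eq_left hq]
    ring
  rw [eX, eB] at hmain
  have hV : domainVolume Ω ≠ ⊤ := hΩ.bounded.measure_lt_top.ne
  have hG0 : 0 ≤ ∫ q in spaceTimeCylinder τ Ω, G q ^ 2 := integral_nonneg fun q => sq_nonneg _
  rw [e8, e5, normCylinder_two_sq hG, ← ENNReal.ofReal_toReal hV, ← ENNReal.ofReal_toReal hN,
    ← hNdef, ← ENNReal.ofReal_pow hN0]
  have hV0 : 0 ≤ (domainVolume Ω).toReal := ENNReal.toReal_nonneg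
  rw [← ENNReal.ofReal_mul (by positivity), ← ENNReal.ofReal_mul (by positivity),
    ← ENNReal.ofReal_mul (by positivity), ← ENNReal.ofReal_mul (by positivity),
    ← ENNReal.ofReal_add (by positivity) (by positivity), ← ENNReal.ofReal_mul (by positivity),
    ← ENNReal.ofReal_add (by positivity) (by positivity),
    ← ENNReal.ofReal_add (by positivity) (by positivity)]
  refine ENNReal.ofReal_le_ofReal ?_
  have hfin : 8 * Real.pi * θ / 5 * (∫ q in spaceTimeCylinder τ Ω, T q ^ 8) ≤
      θ / (8 * Real.pi) * (∫ q in spaceTimeCylinder τ Ω, G q ^ 2) +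
        1 / 5 * (∫ x in Ω, T₀ x ^ 5) +
        τ * ((1 + 1 / κ ^ 2) * (domainVolume Ω).toReal + C * N ^ 5) := by
    rw [hκdef] at hT5int ⊢
    linarith
  refine le_of_mul_le_mul_left (hfin.trans (le_of_eq ?_)) (by positivity : 0 < 8 * Real.pi * θ / 5)
  field_simp
  ring

/-! ### The Dirichlet estimate -/

theorem IsBoundaryDatum.continuousOn (hg : IsBoundaryDatum Ω g) {t : ℝ} (ht : 0 < t) :
    ContinuousOn (fun y => g (t, y)) (closure Ω) := by
  obtain ⟨γ, -, hγ⟩ := hg.smooth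
  exact fun x hx => (hγ t ht ⟨x, hx⟩).2.continuousWithinAt

theorem ContinuousOn.le_of_ae_le {f : E3 → ℝ} {c : ℝ} (hf : ContinuousOn f (closure Ω))
    (hΩ : IsOpen Ω) (h : ∀ᵐ x ∂(volume.restrict Ω), f x ≤ c) : ∀ x ∈ closure Ω, f x ≤ c := by
  have h1 : ∀ x ∈ Ω, f x ≤ c := by
    have ho := (hf.mono subset_closure).isOpen_inter_preimage hΩ (isOpen_Ioi (a := c))
    rw [ae_restrict_iff' hΩ.measurableSet] at h
    have h0 : volume (Ω ∩ f ⁻¹' Ioi c) = 0 := by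
      refine measure_mono_null (fun x hx => ?_) h
      simp only [mem_compl_iff, mem_ofPred_eq, Classical.not_imp, not_le]
      exact hx
    intro x hx
    by_contra hc
    exact eq_empty_iff_forall_notMem.1 (ho.measure_eq_zero_iff volume |>.1 h0) x
      ⟨hx, not_le.1 hc⟩
  exact fun x hx => le_on_closure h1 hf continuousOn_const hx

/-- An essential bound on the open cylinder does not see the boundary; continuity of `g(t,·)` on the
closure carries it there for almost every `t`. -/
theorem IsBoundaryDatum.ae_abs_le (hg : IsBoundaryDatum Ω g) (hΩ : IsConvexC2Domain Ω)
    (hN : normCylinder ⊤ τ Ω g ≠ ⊤) :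
    ∀ᵐ t ∂(volume.restrict (Ioo 0 τ)), ∀ x ∈ closure Ω, |g (t, x)| ≤ (normCylinder ⊤ τ Ω g).toReal := by
  have h1 : ∀ᵐ q ∂(volume.restrict (spaceTimeCylinder τ Ω)),
      |g q| ≤ (normCylinder ⊤ τ Ω g).toReal := by
    filter_upwards [ae_le_eLpNormEssSup (f := g) (μ := volume.restrict (spaceTimeCylinder τ Ω))]
      with q hq
    rw [← Real.norm_eq_abs, ← toReal_enorm]
    refine ENNReal.toReal_mono hN ?_
    rwa [normCylinder, eLpNorm_exponent_top]
  rw [restrict_spaceTimeCylinder] at h1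
  filter_upwards [Measure.ae_ae_of_ae_prod h1, ae_restrict_mem measurableSet_Ioo] with t h2 ht
  exact (hg.continuousOn ht.1).abs.le_of_ae_le hΩ.isOpen h2

theorem IsNonnegSolution.dirichlet_estimate (h : IsNonnegSolution 0 b θ τ Ω G g T₀ T)
    (hΩ : IsConvexC2Domain Ω) (hb : 0 < b) (hτ : 0 < τ) (hθ : 0 < θ)
    (hG : MemLp G 2 (volume.restrict (spaceTimeCylinder τ Ω))) (hg : IsBoundaryDatum Ω g)
    (hT₀ : IsInitialDatum Ω T₀) :
    normCylinder 8 τ Ω T ^ 8 ≤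
      ENNReal.ofReal (1 / (8 * Real.pi ^ 2)) * normCylinder 2 τ Ω G ^ 2
      + ENNReal.ofReal (1 / b ^ 8 * τ) * domainVolume Ω * normCylinder ⊤ τ Ω g ^ 8
      + ENNReal.ofReal (1 / (5 * Real.pi * θ)) * normDomain 5 Ω T₀ ^ 5 := by
  have hpi := Real.pi_pos
  have := hΩ.isFiniteMeasure_restrict_cylinder τ
  refine le_of_ne_top_imp_le fun htop => ?_
  simp only [ENNReal.add_ne_top] at htop
  obtain ⟨⟨-, h1⟩, h2⟩ := htop
  obtain ⟨h5, e5, h50⟩ := hT₀.integrable_pow_five (ne_top_of_ofReal_mul_ne_top (by positivity) h2)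
  obtain ⟨h8, e8⟩ := h.normCylinder_eq hθ hG
  obtain ⟨hT2, h4, hT⟩ := h.memLp_pow_four hθ hG
  -- Because `Ω` has positive volume, a finite right side forces `‖g‖` to be finite.
  have hVpos : domainVolume Ω ≠ 0 := (hΩ.isOpen.measure_pos volume hΩ.nonempty).ne'
  rw [mul_assoc] at h1
  have hN : normCylinder ⊤ τ Ω g ≠ ⊤ := by
    intro hN
    refine ne_top_of_ofReal_mul_ne_top (by positivity) h1 ?_
    rw [hN, ENNReal.top_pow (by norm_num), ENNReal.mul_top hVpos]
  set N := (normCylinder ⊤ τ Ω g).toReal with hNdef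
  have hN0 : 0 ≤ N := ENNReal.toReal_nonneg
  have hm0 : 0 ≤ N / b := by positivity
  have hmain := h.energy_le hΩ hτ hθ hG hT₀ h5 (M := (N / b) ^ 4) (by positivity)
    (integrable_const (0 : ℝ)) (by
    intro ε hε
    filter_upwards [hg.ae_abs_le hΩ hN] with t ht w Du v D2 hu hbc
    refine hu.laplacian_le_of_dirichlet (g := fun y => g (t, y)) hΩ hε hb ?_ hm0 ?_
    · filter_upwards [hbc] with y hy
      rwa [zero_mul, zero_add] at hy
    · intro y hy
      rw [mul_div_cancel₀ _ hb.ne']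
      exact ht y hy)
  rw [integral_zero, add_zero] at hmain
  have hi : Integrable (fun q => T q ^ 4 * powExcess ((N / b) ^ 4) (T q))
      (volume.restrict (spaceTimeCylinder τ Ω)) := by
    refine h8.mono' (h4.1.mul ((continuous_powExcess _).comp_aestronglyMeasurable hT2.1)) ?_
    filter_upwards [hT] with q hq
    have h1 := powExcess_le (M := (N / b) ^ 4) (by positivity) (T q)
    rw [max_eq_left hq] at h1
    rw [norm_mul, Real.norm_of_nonneg (powExcess_nonneg _ _), Real.norm_of_nonneg (by positivity),
      show T q ^ 8 = T q ^ 4 * T q ^ 4 by ring]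
    gcongr
  -- With `P` the excess, `T⁴ ≤ P + M` gives `T⁸ ≤ T⁴ P + T⁴ M`, and `T⁴ M ≤ T⁸/2 + M²/2`. The
  -- resulting factor `2` doubles the coefficients of `G` and `T₀` compared with the Robin case.
  have hX : ∫ q in spaceTimeCylinder τ Ω, T q ^ 8 ≤
      2 * (∫ q in spaceTimeCylinder τ Ω, T q ^ 4 * powExcess ((N / b) ^ 4) (T q)) +
      τ * (domainVolume Ω).toReal * ((N / b) ^ 4) ^ 2 := by
    rw [← integral_const_mul, ← integral_cylinder_const hτ,
      ← integral_add (hi.const_mul 2) (integrable_const _)]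
    refine integral_mono_ae h8 ((hi.const_mul 2).add (integrable_const _)) ?_
    filter_upwards [hT] with q hq
    have h1 := le_powExcess_add ((N / b) ^ 4) (T q)
    rw [max_eq_left hq] at h1
    have h2 := mul_le_mul_of_nonneg_left h1 (pow_nonneg hq 4)
    have e : T q ^ 8 = T q ^ 4 * T q ^ 4 := by ring
    rw [e]
    nlinarith [sq_nonneg (T q ^ 4 - (N / b) ^ 4)]
  have hV : domainVolume Ω ≠ ⊤ := hΩ.bounded.measure_lt_top.ne
  have hV0 : 0 ≤ (domainVolume Ω).toReal := ENNReal.toReal_nonneg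
  have hG0 : 0 ≤ ∫ q in spaceTimeCylinder τ Ω, G q ^ 2 := integral_nonneg fun q => sq_nonneg _
  rw [e8, e5, normCylinder_two_sq hG, ← ENNReal.ofReal_toReal hV, ← ENNReal.ofReal_toReal hN,
    ← hNdef, ← ENNReal.ofReal_pow hN0, ← ENNReal.ofReal_mul (by positivity),
    ← ENNReal.ofReal_mul (by positivity), ← ENNReal.ofReal_mul (by positivity),
    ← ENNReal.ofReal_mul (by positivity), ← ENNReal.ofReal_add (by positivity) (by positivity),
    ← ENNReal.ofReal_add (by positivity) (by positivity)]
  refine ENNReal.ofReal_le_ofReal (hX.trans ?_)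
  have hmain' : (∫ q in spaceTimeCylinder τ Ω, T q ^ 4 * powExcess ((N / b) ^ 4) (T q)) ≤
      (θ / (8 * Real.pi) * (∫ q in spaceTimeCylinder τ Ω, G q ^ 2) +
        1 / 5 * (∫ x in Ω, T₀ x ^ 5)) / (2 * Real.pi * θ) := by
    rw [le_div_iff₀ (by positivity)]
    linarith
  refine (add_le_add_left (mul_le_mul_of_nonneg_left hmain' zero_le_two) _).trans (le_of_eq ?_)
  field_simp
  ring

end Estimates

theorem mainTheorem4 :
    -- Robin boundary conditions
    (∀ a b θ : ℝ, 0 < a * b → 0 < θ → ∃ C : ℝ, 0 < C ∧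
      ∀ Ω : Set E3, IsConvexC2Domain Ω → ∀ τ : ℝ, 0 < τ →
      ∀ (G g : ℝ × E3 → ℝ) (T₀ : E3 → ℝ) (T : ℝ × E3 → ℝ),
        MemLp G 2 (volume.restrict (spaceTimeCylinder τ Ω)) → IsBoundaryDatum Ω g → IsInitialDatum Ω T₀ →
        IsNonnegSolution a b θ τ Ω G g T₀ T →
        normCylinder 8 τ Ω T ^ 8 ≤
          ENNReal.ofReal (1 / (16 * Real.pi ^ 2)) * normCylinder 2 τ Ω G ^ 2
          + ENNReal.ofReal (C * τ) * boundaryArea Ω * supNormClosure τ Ω g ^ 5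
          + ENNReal.ofReal (1 / (10 * Real.pi * θ)) * normDomain 5 Ω T₀ ^ 5) ∧
    -- Neumann boundary conditions
    (∀ θ : ℝ, 0 < θ → ∃ C₁ : ℝ, 0 < C₁ ∧
      ∀ a : ℝ, a ≠ 0 → ∀ Ω : Set E3, IsConvexC2Domain Ω → ∃ C₂ : ℝ, 0 < C₂ ∧
      ∀ τ : ℝ, 0 < τ →
      ∀ (G g : ℝ × E3 → ℝ) (T₀ : E3 → ℝ) (T : ℝ × E3 → ℝ),
        MemLp G 2 (volume.restrict (spaceTimeCylinder τ Ω)) → IsBoundaryDatum Ω g → IsInitialDatum Ω T₀ →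
        IsNonnegSolution a 0 θ τ Ω G g T₀ T →
        normCylinder 8 τ Ω T ^ 8 ≤
          ENNReal.ofReal (5 / (64 * Real.pi ^ 2)) * normCylinder 2 τ Ω G ^ 2
          + ENNReal.ofReal τ * (ENNReal.ofReal C₁ * domainVolume Ω
              + ENNReal.ofReal C₂ * supNormClosure τ Ω g ^ 5)
          + ENNReal.ofReal (1 / (8 * Real.pi * θ)) * normDomain 5 Ω T₀ ^ 5) ∧
    -- Dirichlet boundary conditions
    (∀ b : ℝ, 0 < b → ∃ C₁ : ℝ, 0 < C₁ ∧
      ∀ θ : ℝ, 0 < θ → ∃ C₂ C₃ C₄ : ℝ, 0 < C₂ ∧ 0 < C₃ ∧ 0 < C₄ ∧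
      ∀ Ω : Set E3, IsConvexC2Domain Ω → ∀ τ : ℝ, 0 < τ →
      ∀ (G g : ℝ × E3 → ℝ) (T₀ : E3 → ℝ) (T : ℝ × E3 → ℝ),
        MemLp G 2 (volume.restrict (spaceTimeCylinder τ Ω)) → IsBoundaryDatum Ω g → IsInitialDatum Ω T₀ →
        IsDirichletCompatible b Ω g T₀ →
        IsNonnegSolution 0 b θ τ Ω G g T₀ T →
        normCylinder 8 τ Ω T ^ 8 ≤
          ENNReal.ofReal (1 / (8 * Real.pi ^ 2)) * normCylinder 2 τ Ω G ^ 2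
          + ENNReal.ofReal (C₁ * τ) * domainVolume Ω * normCylinder ⊤ τ Ω g ^ 8
          + ENNReal.ofReal (1 / (5 * Real.pi * θ)) * normDomain 5 Ω T₀ ^ 5
          + ENNReal.ofReal C₂ * domainVolume Ω * normCylinder ⊤ τ Ω g ^ 5
          + ENNReal.ofReal (C₃ * τ) * boundaryArea Ω * supNormalTerm τ Ω g
          + ENNReal.ofReal (C₄ * τ) * domainVolume Ω
              * heatNorm τ Ω (fun q => g q ^ 4) ^ (8 / 7 : ℝ)) := by
  refine ⟨fun a b θ hab hθ => ?_, fun θ hθ => ?_, fun b hb => ?_⟩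
  · have ha : a ≠ 0 := left_ne_zero_of_mul hab.ne'
    have hb : b ≠ 0 := right_ne_zero_of_mul hab.ne'
    have hpi := Real.pi_pos
    exact ⟨1 / (|a| * |b| ^ 4) / (2 * Real.pi * θ), by positivity,
      fun Ω hΩ τ hτ G g T₀ T hG _ hT₀ h => h.robin_estimate hΩ hab hτ hθ hG hT₀⟩
  · have hpi := Real.pi_pos
    refine ⟨(1 + 1 / (2 * Real.pi * θ / 5) ^ 2) * (5 / (8 * Real.pi * θ)), by positivity,
      fun a ha Ω hΩ => ?_⟩
    obtain ⟨C, hC, h⟩ := hΩ.exists_neumann_estimate ha hθ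
    exact ⟨C, hC, fun τ hτ G g T₀ T hG _ hT₀ hT => h hτ hG hT₀ hT⟩
  -- The last three terms are added to an estimate that holds without them, so `C₂`, `C₃` and `C₄`
  -- may be any positive numbers.
  · refine ⟨1 / b ^ 8, by positivity, fun θ hθ => ⟨1, 1, 1, one_pos, one_pos, one_pos,
      fun Ω hΩ τ hτ G g T₀ T hG hg hT₀ _ h => ?_⟩⟩
    refine (h.dirichlet_estimate hΩ hb hτ hθ hG hg hT₀).trans ?_
    exact le_self_add.trans (le_self_add.trans le_self_add)
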